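/- Let $f:\mathbb{C}\to\hat{\mathbb{C}}=\mathbb{C}\cup\{\infty\}$ be a meromorphic function that is nonconstant and nonlinear (not of the form $z\mapsto az+b$). If $f$ is rational, it is extended to $\infty$ by continuity; if $f$ is transcendental, it is not defined at $\infty$. The iterates $f^n$ are taken wherever they are defined. The Fatou set $F(f)\subset\mathbb{C}$ is the set of all points having a neighbourhood on which all iterates $f^n$ are defined and form a normal family with respect to the spherical metric; the Julia set is $J(f)=\mathbb{C}\setminus F(f)$. The radial Julia set $J_r(f)$ is the set of all $z\in J(f)$ for which there is some $\delta>0$ such that, for infinitely many $n\in\mathbb{N}$, the iterate $f^n(z)$ is defined and the spherical disk $D=\mathbb{D}^{\#}_\delta(f^n(z))$ can be pulled back univalently along the orbit of $z$; that is, $f^n$ maps the connected component of $f^{-n}(D)$ containing $z$ bijectively (hence conformally) onto $D$. Suppose that $J_r(f)$ has positive Lebesgue measure. Then: 1. $J_r(f)$ has full Lebesgue measure, i.e. $\mathbb{C}\setminus J_r(f)$ is a null set, and $J(f)=\mathbb{C}$. 2. For Lebesgue-almost every $z\in\mathbb{C}$, the forward orbit $\{f^n(z):n\ge 0\}$ is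 dense in $\hat{\mathbb{C}}$. 3. Every Lebesgue measurable set $A\subset\hat{\mathbb{C}}$ that is forward invariant, i.e. $f(A\cap\mathbb{C})\subset A$, has zero or full Lebesgue measure. 4. In particular, $f$ is ergodic: every Lebesgue measurable set $A\subset\hat{\mathbb{C}}$ with $f^{-1}(A)=A\cap\mathbb{C}$ (where $f^{-1}(A)=\{z\in\mathbb{C}:f(z)\in A\}$) has zero or full Lebesgue measure. -/

import Mathlib

open Set Filter Topology MeasureTheory

namespace MeroDyn

/-- The Riemann sphere `ℂ ∪ {∞}`, as the one-point compactification of `ℂ`. -/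
abbrev Sphere : Type := OnePoint ℂ

/-- The coordinate change `w ↦ 1 / w` of the Riemann sphere. -/
noncomputable def sphInv : Sphere → Sphere
  | OnePoint.infty => ((0 : ℂ) : Sphere)
  | OnePoint.some z => open Classical in if z = 0 then OnePoint.infty else ((z⁻¹ : ℂ) : Sphere)

/-- `f : ℂ → ℂ ∪ {∞}` is meromorphic, i.e. holomorphic as a map into the Riemann sphere: near
every point, `f` or `1 / f` is a finite-valued holomorphic function. (The constant `∞` is
formally allowed here; it is excluded by nonconstancy.) -/
def IsMeromorphic (f : ℂ → Sphere) : Prop :=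
  ∀ z₀ : ℂ,
    (∃ g : ℂ → ℂ, AnalyticAt ℂ g z₀ ∧ ∀ᶠ z in 𝓝 z₀, f z = ((g z : ℂ) : Sphere)) ∨
    (∃ g : ℂ → ℂ, AnalyticAt ℂ g z₀ ∧ ∀ᶠ z in 𝓝 z₀, sphInv (f z) = ((g z : ℂ) : Sphere))

/-- `f` is constant (possibly equal to `∞`). -/
def IsConst (f : ℂ → Sphere) : Prop := ∃ c : Sphere, ∀ z : ℂ, f z = c

/-- `f` is linear, `f z = a z + b`. -/
def IsLinear (f : ℂ → Sphere) : Prop :=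
  ∃ a b : ℂ, ∀ z : ℂ, f z = ((a * z + b : ℂ) : Sphere)

/-- `f` as a partial self-map of the sphere. At `∞` it takes the value
`lim_{z → ∞} f z` if that limit exists in the sphere (for meromorphic `f` this is the case exactly
when `f` is rational), and is undefined otherwise (`f` transcendental). -/
noncomputable def sphereExt (f : ℂ → Sphere) : Sphere → Option Sphere
  | OnePoint.infty => open Classical in
      if h : ∃ a : Sphere, Tendsto f (cocompact ℂ) (𝓝 a) then some h.choose else none
  | OnePoint.some z => some (f z)

/-- The `n`-th iterate of `f`, a partial self-map of the sphere. -/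
noncomputable def iter (f : ℂ → Sphere) : ℕ → Sphere → Option Sphere
  | 0, x => some x
  | n + 1, x => (iter f n x).bind (sphereExt f)

/-- The chordal distance on the sphere (of radius one). -/
noncomputable def chordalDist : Sphere → Sphere → ℝ
  | OnePoint.infty, OnePoint.infty => 0
  | OnePoint.infty, OnePoint.some w => 2 / √(1 + ‖w‖ ^ 2)
  | OnePoint.some z, OnePoint.infty => 2 / √(1 + ‖z‖ ^ 2)
  | OnePoint.some z, OnePoint.some w =>
      2 * ‖z - w‖ / (√(1 + ‖z‖ ^ 2) * √(1 + ‖w‖ ^ 2))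

/-- The spherical distance, i.e. the length of the shorter great-circle arc. -/
noncomputable def sphDist (x y : Sphere) : ℝ := 2 * Real.arcsin (chordalDist x y / 2)

/-- The open spherical disk of radius `δ` around `x`. -/
def sphDisk (x : Sphere) (δ : ℝ) : Set Sphere := {y | sphDist y x < δ}

/-- Locally uniform convergence on the open set `U ⊆ ℂ`, in the spherical metric. -/
def LocUnifConv (U : Set ℂ) (G : ℕ → ℂ → Sphere) (g : ℂ → Sphere) : Prop :=
  ∀ K : Set ℂ, IsCompact K → K ⊆ U → ∀ ε : ℝ, 0 < ε →
    ∀ᶠ j in atTop, ∀ z ∈ K, sphDist (G j z) (g z) < ε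

/-- Normality on `U` of a family of maps into the sphere: every sequence in the family has a
subsequence converging locally uniformly on `U` in the spherical metric. -/
def IsNormalOn (U : Set ℂ) (𝓕 : Set (ℂ → Sphere)) : Prop :=
  ∀ G : ℕ → ℂ → Sphere, (∀ j, G j ∈ 𝓕) →
    ∃ φ : ℕ → ℕ, StrictMono φ ∧ ∃ g : ℂ → Sphere, LocUnifConv U (fun j => G (φ j)) g

/-- The Fatou set (in `ℂ`): points with a neighbourhood on which all iterates are defined and form
a normal family. -/
def fatouSet (f : ℂ → Sphere) : Set ℂ :=
  {z | ∃ U : Set ℂ, IsOpen U ∧ z ∈ U ∧ ∃ F : ℕ → ℂ → Sphere,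
    (∀ n, ∀ w ∈ U, iter f n (w : Sphere) = some (F n w)) ∧ IsNormalOn U (range F)}

/-- The Julia set (in `ℂ`). -/
def juliaSet (f : ℂ → Sphere) : Set ℂ := (fatouSet f)ᶜ

/-- The preimage `f⁻ⁿ(D)`, the set of all points at which the `n`-th iterate is defined and takes
a value in `D`. -/
def preimageIter (f : ℂ → Sphere) (n : ℕ) (D : Set Sphere) : Set Sphere :=
  {x | ∃ y ∈ D, iter f n x = some y}

/-- The pullback of `D` along the orbit of `z`: the component of `f⁻ⁿ(D)` containing `z`. -/
def pullback (f : ℂ → Sphere) (n : ℕ) (D : Set Sphere) (z : Sphere) : Set Sphere :=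
  connectedComponentIn (preimageIter f n D) z

/-- `D` can be pulled back univalently along the orbit of `z`, in `n` steps: `fⁿ` maps the pullback
bijectively (so conformally) onto `D`. -/
def PullsBackUnivalently (f : ℂ → Sphere) (n : ℕ) (D : Set Sphere) (z : Sphere) : Prop :=
  BijOn (iter f n) (pullback f n D z) (some '' D)

/-- The radial Julia set. -/
def radialJuliaSet (f : ℂ → Sphere) : Set ℂ :=
  {z | z ∈ juliaSet f ∧ ∃ δ : ℝ, 0 < δ ∧
    {n : ℕ | ∃ x : Sphere, iter f n (z : Sphere) = some x ∧
      PullsBackUnivalently f n (sphDisk x δ) (z : Sphere)}.Infinite}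

/-- The forward orbit of `z`, as far as it is defined. -/
def orbit (f : ℂ → Sphere) (z : Sphere) : Set Sphere := {x | ∃ n : ℕ, iter f n z = some x}

/-- The finite part of a subset of the sphere. -/
def finitePart (A : Set Sphere) : Set ℂ := {z | (z : Sphere) ∈ A}

/-- `A` is forward invariant, `f(A) ⊆ A` (where `f` is applied to the finite points of `A`). -/
def IsForwardInvariant (f : ℂ → Sphere) (A : Set Sphere) : Prop :=
  ∀ z : ℂ, (z : Sphere) ∈ A → f z ∈ A

/-- Zero or full Lebesgue measure (the point `∞` has measure zero). -/
def HasZeroOrFullMeasure (A : Set Sphere) : Prop :=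
  volume (finitePart A) = 0 ∨ volume (finitePart A)ᶜ = 0

/-- Ergodicity with respect to the Lebesgue measure class: every (Lebesgue) measurable set `A` with
`f⁻¹(A) = A` has zero or full measure. -/
def IsErgodic (f : ℂ → Sphere) : Prop :=
  ∀ A : Set Sphere, NullMeasurableSet (finitePart A) volume →
    (∀ z : ℂ, f z ∈ A ↔ (z : Sphere) ∈ A) → HasZeroOrFullMeasure A

end MeroDyn

/-! The core is a zero-one law, proved by blowing up at density points. Let A be forward invariant
and meet J_r in positive measure, and let z in J_r be a density point of A. By compactness of the
sphere, infinitely many iterates have univalent branches from neighbourhoods of z onto one fixed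
coordinate disk (`mem_radialJuliaSet_iff`). Their domains shrink to z, since otherwise all iterates
would be defined and injective on one disk about z and z would be a Fatou point
(`mem_fatouSet_of_injOn`). Koebe distortion (`norm_deriv_mul_le_of_omits`) carries density forward,
so A has full measure in some disk containing a point f^N(z) (`exists_ball_diff_null`). Because z is
in the Julia set, the forward images of that disk cover almost all of the plane
(`mem_fatouSet_of_omits`); as f maps null sets to null sets, A has full measure
(`volume_compl_eq_zero_of_chartDisk`).

Two normality criteria take the place of Montel's theorem on three omitted values. If the iterates
omit a compact set K of positive area, compose them with the Cauchy transforms of subsets of K: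
these are continuous on the sphere, holomorphic off K and separate points, so the problem becomes
one about bounded holomorphic functions. If the iterates are injective on a disk, use two disjoint
pairs of points with equal values under f: every iterate omits a point of each pair, and a zero-free
univalent function satisfies a Harnack inequality. This needs f non-injective; an injective f is a
Möbius map whose Julia set has at most one point, which positive measure of J_r excludes.

J_r together with ∞ is forward invariant, so the law first gives J_r full measure, and then applies
to every forward invariant set of positive measure. Dense orbits follow by applying it to the set of
points whose orbit avoids a given open set. -/

namespace MeroDyn

/-! ### Univalent functions in the plane and a weak Koebe theorem. -/

open Metric

/-- A nonvanishing holomorphic function on a disk has a holomorphic logarithm. -/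
theorem exists_log_on_ball {k : ℂ → ℂ} {c : ℂ} {r : ℝ} (hk : DifferentiableOn ℂ k (ball c r))
    (h0 : ∀ z ∈ ball c r, k z ≠ 0) :
    ∃ L : ℂ → ℂ, (∀ z ∈ ball c r, HasDerivAt L (deriv k z / k z) z) ∧
      ∀ z ∈ ball c r, Complex.exp (L z) = k z := by
  rcases le_or_gt r 0 with hr | hr
  · have : ball c r = ∅ := ball_eq_empty.2 hr
    exact ⟨0, by simp [this], by simp [this]⟩
  have hc : c ∈ ball c r := mem_ball_self hr
  have hd : DifferentiableOn ℂ (fun z => deriv k z / k z) (ball c r) :=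
    (hk.deriv isOpen_ball).div hk h0
  obtain ⟨L, hLc, hL⟩ := (hd.isExactOn_ball).with_val_at c (Complex.log (k c))
  refine ⟨L, hL, fun z hz => ?_⟩
  have hq : ∀ w ∈ ball c r, HasDerivAt (fun w => k w * Complex.exp (-L w)) 0 w := by
    intro w hw
    have hkw : HasDerivAt k (deriv k w) w :=
      (hk.differentiableAt (isOpen_ball.mem_nhds hw)).hasDerivAt
    refine (hkw.mul (hL w hw).neg.cexp).congr_deriv ?_
    have := h0 w hw
    field_simp
    ring
  have hconst : k z * Complex.exp (-L z) = k c * Complex.exp (-L c) :=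
    (convex_ball c r).is_const_of_fderivWithin_eq_zero (𝕜 := ℂ)
      (fun w hw => (hq w hw).differentiableAt.differentiableWithinAt)
      (fun w hw => by
        rw [fderivWithin_of_isOpen isOpen_ball hw]
        ext; simp [(hq w hw).deriv])
      hz hc
  rw [hLc, Complex.exp_neg, Complex.exp_neg, Complex.exp_log (h0 c hc), mul_inv_cancel₀ (h0 c hc)] at hconst
  field_simp at hconst
  exact hconst.symm

/-- Local version of the open mapping theorem for injective holomorphic functions. -/
theorem nhds_le_map_nhds_of_injOn {g : ℂ → ℂ} {Ω : Set ℂ} (hΩ : IsOpen Ω)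
    (hd : DifferentiableOn ℂ g Ω) (hi : InjOn g Ω) {z : ℂ} (hz : z ∈ Ω) :
    𝓝 (g z) ≤ map g (𝓝 z) := by
  refine (hd.analyticAt (hΩ.mem_nhds hz)).eventually_constant_or_nhds_le_map_nhds.resolve_left ?_
  intro h
  have h1 : ∀ᶠ w in 𝓝 z, w = z := by
    filter_upwards [h, hΩ.mem_nhds hz] with w hw hwΩ using hi hwΩ hz hw
  have h2 : ∀ᶠ w in 𝓝[≠] z, w = z := h1.filter_mono nhdsWithin_le_nhds
  obtain ⟨w, hw, hw'⟩ := (h2.and self_mem_nhdsWithin).exists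
  exact hw' hw

theorem isOpen_image_of_injOn {g : ℂ → ℂ} {Ω : Set ℂ} (hΩ : IsOpen Ω)
    (hd : DifferentiableOn ℂ g Ω) (hi : InjOn g Ω) : IsOpen (g '' Ω) := by
  rw [isOpen_iff_mem_nhds]
  rintro _ ⟨z, hz, rfl⟩
  exact nhds_le_map_nhds_of_injOn hΩ hd hi hz (image_mem_map (hΩ.mem_nhds hz))

/-- The inverse of an injective holomorphic function is holomorphic. -/
theorem differentiableOn_of_leftInverse {g φ : ℂ → ℂ} {Ω : Set ℂ} (hΩ : IsOpen Ω)
    (hd : DifferentiableOn ℂ g Ω) (hφ : ∀ z ∈ Ω, φ (g z) = z) :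
    DifferentiableOn ℂ φ (g '' Ω) := by
  have hi : InjOn g Ω := fun x hx y hy h => by rw [← hφ x hx, h, hφ y hy]
  have hcont : ∀ z ∈ Ω, ContinuousAt φ (g z) := by
    intro z hz
    rw [ContinuousAt, hφ z hz]
    refine Tendsto.mono_left ?_ (nhds_le_map_nhds_of_injOn hΩ hd hi hz)
    rw [tendsto_map'_iff]
    refine tendsto_id.congr' ?_
    filter_upwards [hΩ.mem_nhds hz] with w hw using (hφ w hw).symm
  have hder : ∀ z ∈ Ω, deriv g z ≠ 0 → DifferentiableAt ℂ φ (g z) := by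
    intro z hz hne
    have hgz : HasDerivAt g (deriv g z) (φ (g z)) := by
      rw [hφ z hz]; exact (hd.differentiableAt (hΩ.mem_nhds hz)).hasDerivAt
    refine (hgz.of_local_left_inverse (hcont z hz) hne ?_).differentiableAt
    have := nhds_le_map_nhds_of_injOn hΩ hd hi hz (image_mem_map (hΩ.mem_nhds hz))
    filter_upwards [this] with y hy
    obtain ⟨x, hx, rfl⟩ := hy
    rw [hφ x hx]
  rintro _ ⟨z, hz, rfl⟩
  -- The inverse is continuous, and it is differentiable wherever the derivative of `g` is nonzero.
  -- Zeros of that derivative are isolated because `g` is injective, so they give removable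
  -- singularities.
  refine (Complex.analyticAt_of_differentiable_on_punctured_nhds_of_continuousAt ?_
    (hcont z hz)).differentiableAt.differentiableWithinAt
  have hda : AnalyticAt ℂ (deriv g) z := (hd.analyticAt (hΩ.mem_nhds hz)).deriv
  rcases hda.eventually_eq_zero_or_eventually_ne_zero with h | h
  · exfalso
    obtain ⟨r, hr, hball⟩ := Metric.mem_nhds_iff.1 (h.and (hΩ.mem_nhds hz))
    have hzb : z ∈ ball z r := mem_ball_self hr
    have hsub : ball z r ⊆ Ω := fun w hw => (hball hw).2
    have hconst : ∀ w ∈ ball z r, g w = g z := fun w hw =>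
      (convex_ball z r).is_const_of_fderivWithin_eq_zero (𝕜 := ℂ) (hd.mono hsub)
        (fun w hw => by
          rw [fderivWithin_of_isOpen isOpen_ball hw]
          ext; simpa using (hball hw).1)
        hw hzb
    have hw : z + (r / 2 : ℝ) ∈ ball z r := by
      simp [abs_of_pos hr]; linarith
    have := hi (hsub hw) hz (hconst _ hw)
    simp at this
    linarith
  · have h1 : ∀ᶠ w in 𝓝 z, w ∈ Ω ∧ (w ≠ z → deriv g w ≠ 0) :=
      (hΩ.eventually_mem hz).and (eventually_nhdsWithin_iff.1 h)
    have h2 := nhds_le_map_nhds_of_injOn hΩ hd hi hz (image_mem_map h1)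
    rw [eventually_nhdsWithin_iff]
    filter_upwards [h2] with y hy hne
    obtain ⟨x, ⟨hxΩ, hx⟩, rfl⟩ := hy
    exact hder x hxΩ (hx (fun h => hne (by simp [h])))

/-- Its main use is that the derivative of an injective holomorphic function never vanishes. -/
theorem deriv_leftInverse_mul {g φ : ℂ → ℂ} {Ω : Set ℂ} (hΩ : IsOpen Ω)
    (hd : DifferentiableOn ℂ g Ω) (hφ : ∀ z ∈ Ω, φ (g z) = z) {z : ℂ} (hz : z ∈ Ω) :
    deriv φ (g z) * deriv g z = 1 := by
  have hi : InjOn g Ω := fun x hx y hy h => by rw [← hφ x hx, h, hφ y hy]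
  have h1 : HasDerivAt φ (deriv φ (g z)) (g z) :=
    ((differentiableOn_of_leftInverse hΩ hd hφ).differentiableAt
      ((isOpen_image_of_injOn hΩ hd hi).mem_nhds (mem_image_of_mem g hz))).hasDerivAt
  have h2 : HasDerivAt g (deriv g z) z := (hd.differentiableAt (hΩ.mem_nhds hz)).hasDerivAt
  have h3 := h1.comp z h2
  have h4 : HasDerivAt (φ ∘ g) 1 z := by
    refine (hasDerivAt_id z).congr_of_eventuallyEq ?_
    filter_upwards [hΩ.mem_nhds hz] with w hw using hφ w hw
  exact h3.unique h4

/-- A weak form of the Koebe one-quarter theorem: an injective holomorphic function on a disk of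
radius `R` takes all values at distance less than `‖φ' c‖ R / 24` from its central value. -/
theorem norm_deriv_mul_le_of_omits {φ : ℂ → ℂ} {c a : ℂ} {R : ℝ} (hR : 0 < R)
    (hd : DifferentiableOn ℂ φ (ball c R)) (hi : InjOn φ (ball c R))
    (ha : ∀ z ∈ ball c R, φ z ≠ a) : ‖deriv φ c‖ * R ≤ 24 * ‖φ c - a‖ := by
  set B := ball c R with hB
  have hc : c ∈ B := mem_ball_self hR
  have hVo : IsOpen (φ '' B) := isOpen_image_of_injOn isOpen_ball hd hi
  have haV : a ∈ (φ '' B)ᶜ := by rintro ⟨z, hz, h⟩; exact ha z hz h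
  -- Passing to the nearest omitted point only strengthens the claim, and it puts the whole disk
  -- about `φ c` with `a₀` on its boundary inside the image.
  obtain ⟨a₀, ha₀V, ha₀⟩ := hVo.isClosed_compl.exists_infDist_eq_dist ⟨a, haV⟩ (φ c)
  have hda : dist (φ c) a₀ ≤ dist (φ c) a := ha₀ ▸ infDist_le_dist_of_mem haV
  have hne : φ c - a₀ ≠ 0 := by
    intro h
    exact ha₀V ⟨c, hc, sub_eq_zero.1 h⟩
  have hball : ∀ w, dist w (φ c) < dist (φ c) a₀ → w ∈ φ '' B := by
    intro w hw
    by_contra hwV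
    have := infDist_le_dist_of_mem (x := φ c) (show w ∈ (φ '' B)ᶜ from hwV)
    rw [ha₀, dist_comm (φ c) w] at this
    linarith
  set u : ℂ → ℂ := fun z => (φ z - a₀) / (φ c - a₀) with hu
  have hud : DifferentiableOn ℂ u B := (hd.sub_const a₀).div_const _
  have hu0 : ∀ z ∈ B, u z ≠ 0 := fun z hz =>
    div_ne_zero (fun h => ha₀V ⟨z, hz, sub_eq_zero.1 h⟩) hne
  obtain ⟨L, hL, hLu⟩ := exists_log_on_ball hud hu0
  have huc : u c = 1 := div_self hne
  -- A square root of `u`. Injectivity of `u` makes `h` injective and forbids both `v` and `-v` as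
  -- values.
  set h : ℂ → ℂ := fun z => Complex.exp ((L z - L c) / 2) with hh
  have hhc : h c = 1 := by simp [hh]
  have hsq : ∀ z ∈ B, h z * h z = u z := by
    intro z hz
    rw [hh]
    simp only
    rw [← Complex.exp_add, show (L z - L c) / 2 + (L z - L c) / 2 = L z - L c by ring,
      Complex.exp_sub, hLu z hz, hLu c hc, huc, div_one]
  have hhder : ∀ z ∈ B, HasDerivAt h (h z * (deriv u z / u z / 2)) z := fun z hz =>
    (((hL z hz).sub_const _).div_const 2).cexp
  have hhcont : ContinuousOn h B := fun z hz => (hhder z hz).continuousAt.continuousWithinAt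
  have hhi : InjOn h B := by
    intro x hx y hy hxy
    have : u x = u y := by rw [← hsq x hx, ← hsq y hy, hxy]
    apply hi hx hy
    have := (div_left_inj' hne).1 this
    exact sub_left_injective this
  have hanti : ∀ x ∈ B, ∀ y ∈ B, h x ≠ -h y := by
    intro x hx y hy hxy
    have h1 : u x = u y := by rw [← hsq x hx, ← hsq y hy, hxy]; ring
    have h2 : x = y := hi hx hy (sub_left_injective ((div_left_inj' hne).1 h1))
    subst h2
    have : h x = 0 := by
      have h3 : (2 : ℂ) * h x = 0 := by linear_combination hxy
      simpa using h3
    exact hu0 x hx (by rw [← hsq x hx, this]; ring)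
  have hhdo : DifferentiableOn ℂ h B := fun z hz =>
    (hhder z hz).differentiableAt.differentiableWithinAt
  have hho : IsOpen (h '' B) := isOpen_image_of_injOn isOpen_ball hhdo hhi
  -- The radius 2/5 satisfies 2·(2/5) + (2/5)² = 24/25 < 1, so squares of points of this disk lie in
  -- the unit disk about 1, which `u` covers. Connectedness then fixes the sign, and the opposite
  -- disk about -1 is omitted by `h`.
  have hcover : ∀ v ∈ ball (1 : ℂ) (2 / 5), v ∈ h '' B ∨ -v ∈ h '' B := by
    intro v hv
    set s := v - 1
    have hs : ‖s‖ < 2 / 5 := by simpa [dist_eq_norm] using hv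
    have hv2 : v * v - 1 = 2 * s + s * s := by simp only [s]; ring
    have hlt : ‖v * v - 1‖ < 1 := by
      rw [hv2]
      calc ‖2 * s + s * s‖ ≤ 2 * ‖s‖ + ‖s‖ * ‖s‖ := by
            refine (norm_add_le _ _).trans ?_
            simp
        _ < 1 := by nlinarith [norm_nonneg s]
    obtain ⟨z, hz, hzv⟩ := hball (a₀ + v * v * (φ c - a₀)) (by
      rw [dist_eq_norm, dist_eq_norm,
        show a₀ + v * v * (φ c - a₀) - φ c = (v * v - 1) * (φ c - a₀) by ring, norm_mul]
      have := norm_pos_iff.2 hne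
      nlinarith)
    have huz : u z = v * v := by
      rw [hu]; simp only; rw [hzv]; field_simp; ring
    have : (h z - v) * (h z + v) = 0 := by
      have := hsq z hz
      rw [huz] at this
      linear_combination this
    rcases mul_eq_zero.1 this with h1 | h1
    · left; exact ⟨z, hz, sub_eq_zero.1 h1⟩
    · right; exact ⟨z, hz, eq_neg_of_add_eq_zero_left h1⟩
  have hsub : ball (1 : ℂ) (2 / 5) ⊆ h '' B := by
    refine (convex_ball (1 : ℂ) (2 / 5)).isPreconnected.subset_left_of_subset_union hho
      (hho.preimage continuous_neg) ?_ (fun v hv => hcover v hv) ?_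
    · rw [Set.disjoint_left]
      rintro _ ⟨x, hx, rfl⟩ ⟨y, hy, hxy⟩
      exact hanti x hx y hy (by rw [hxy]; ring)
    · exact ⟨1, mem_ball_self (by norm_num), c, hc, hhc⟩
  have hfar : ∀ z ∈ B, 2 / 5 ≤ ‖h z + 1‖ := by
    intro z hz
    by_contra hlt
    push Not at hlt
    obtain ⟨x, hx, hxz⟩ := hsub (show -h z ∈ ball (1 : ℂ) (2 / 5) by
      rw [mem_ball, dist_eq_norm, show -h z - 1 = -(h z + 1) by ring, norm_neg]; exact hlt)
    exact hanti x hx z hz hxz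
  have hne1 : ∀ z ∈ B, h z + 1 ≠ 0 := fun z hz h0 => by
    have := hfar z hz
    rw [h0, norm_zero] at this
    norm_num at this
  -- Since `h` stays away from -1, `k` is bounded and Cauchy's estimate applies. With `k' = -h' / 4
  -- = -u' / 8` at `c` and oscillation at most 3, the constant is 8 · 3 = 24.
  set k : ℂ → ℂ := fun z => (h z + 1)⁻¹ with hk
  have hkd : DifferentiableOn ℂ k B := (hhdo.add_const 1).inv hne1
  have hkb : ∀ z ∈ B, ‖k z‖ ≤ 5 / 2 := by
    intro z hz
    rw [hk]; simp only
    rw [norm_inv]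
    calc ‖h z + 1‖⁻¹ ≤ (2 / 5 : ℝ)⁻¹ := inv_anti₀ (by norm_num) (hfar z hz)
      _ = 5 / 2 := by norm_num
  have hkc : ‖k c‖ ≤ 1 / 2 := by
    rw [hk]; simp only [hhc]; norm_num
  have hmaps : MapsTo k (ball c R) (closedBall (k c) 3) := by
    intro z hz
    rw [mem_closedBall, dist_eq_norm]
    calc ‖k z - k c‖ ≤ ‖k z‖ + ‖k c‖ := norm_sub_le _ _
      _ ≤ 3 := by linarith [hkb z hz]
  have hcauchy := Complex.norm_deriv_le_div_of_mapsTo_ball hkd hmaps hR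
  have huder : deriv u c = deriv φ c / (φ c - a₀) := by
    have h1 : HasDerivAt φ (deriv φ c) c := (hd.differentiableAt (isOpen_ball.mem_nhds hc)).hasDerivAt
    exact ((h1.sub_const a₀).div_const _).deriv
  have hkder : deriv k c = -(deriv φ c / (φ c - a₀)) / 8 := by
    have h1 := ((hhder c hc).add_const 1).inv (hne1 c hc)
    have h2 : deriv k c = _ := h1.deriv
    rw [h2, huc, hhc, huder]
    norm_num
    ring
  rw [hkder, norm_div, norm_neg, norm_div] at hcauchy
  have hpos : 0 < ‖φ c - a₀‖ := norm_pos_iff.2 hne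
  have h8 : ‖(8 : ℂ)‖ = 8 := by norm_num
  rw [h8, div_div, div_le_div_iff₀ (by positivity) hR] at hcauchy
  rw [dist_eq_norm, dist_eq_norm] at hda
  linarith

end MeroDyn

/-! ### The Riemann sphere: coordinates, the spherical metric, connectedness of disks. -/

namespace MeroDyn

open Metric

/-- The coordinate `x ↦ 1 / (x - Q)` of the sphere, with value `0` at `∞`
(and a junk value at `Q`). -/
noncomputable def tau (Q : ℂ) : Sphere → ℂ
  | OnePoint.infty => 0
  | OnePoint.some z => (z - Q)⁻¹

/-- The parametrization `t ↦ Q + 1 / t` of the sphere minus the point `Q`. -/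
noncomputable def iota (Q t : ℂ) : Sphere :=
  open Classical in if t = 0 then OnePoint.infty else ((Q + t⁻¹ : ℂ) : Sphere)

@[simp] theorem tau_infty (Q : ℂ) : tau Q OnePoint.infty = 0 := rfl

@[simp] theorem tau_coe (Q z : ℂ) : tau Q (z : Sphere) = (z - Q)⁻¹ := rfl

@[simp] theorem iota_zero (Q : ℂ) : iota Q 0 = OnePoint.infty := by simp [iota]

theorem iota_of_ne {t : ℂ} (Q : ℂ) (ht : t ≠ 0) : iota Q t = ((Q + t⁻¹ : ℂ) : Sphere) := by
  simp [iota, ht]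

@[simp] theorem tau_iota (Q t : ℂ) : tau Q (iota Q t) = t := by
  by_cases ht : t = 0
  · simp [ht]
  · simp [iota_of_ne Q ht]

theorem iota_tau {Q : ℂ} {x : Sphere} (hx : x ≠ (Q : Sphere)) : iota Q (tau Q x) = x := by
  induction x using OnePoint.rec with
  | infty => simp
  | coe z =>
    have : z - Q ≠ 0 := fun h => hx (by rw [sub_eq_zero.1 h])
    rw [tau_coe, iota_of_ne Q (inv_ne_zero this)]
    simp

theorem iota_ne (Q t : ℂ) : iota Q t ≠ (Q : Sphere) := by
  by_cases ht : t = 0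
  · simp [ht]
  · rw [iota_of_ne Q ht]
    simp [ht]

theorem iota_injective (Q : ℂ) : Function.Injective (iota Q) :=
  Function.LeftInverse.injective (tau_iota Q)

theorem tendsto_coe_cobounded :
    Tendsto ((↑) : ℂ → Sphere) (Bornology.cobounded ℂ) (𝓝 OnePoint.infty) := by
  rw [Metric.cobounded_eq_cocompact, ← coclosedCompact_eq_cocompact]
  exact OnePoint.tendsto_coe_infty

theorem tendsto_add_inv_nhdsNE_zero (Q : ℂ) :
    Tendsto (fun t : ℂ => Q + t⁻¹) (𝓝[≠] 0) (Bornology.cobounded ℂ) :=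
  (tendsto_const_add_cobounded Q).comp tendsto_inv₀_nhdsNE_zero

theorem continuous_iota (Q : ℂ) : Continuous (iota Q) := by
  rw [continuous_iff_continuousAt]
  intro t
  by_cases ht : t = 0
  · subst ht
    rw [continuousAt_iff_punctured_nhds, iota_zero]
    refine (tendsto_coe_cobounded.comp (tendsto_add_inv_nhdsNE_zero Q)).congr' ?_
    filter_upwards [self_mem_nhdsWithin] with t ht using (iota_of_ne Q ht).symm
  · have h : ContinuousAt (fun t : ℂ => ((Q + t⁻¹ : ℂ) : Sphere)) t :=
      OnePoint.continuous_coe.continuousAt.comp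
        (f := fun t : ℂ => Q + t⁻¹) (continuousAt_const.add (continuousAt_inv₀ ht))
    refine h.congr ?_
    filter_upwards [isOpen_ne.mem_nhds ht] with s hs using (iota_of_ne Q hs).symm

theorem continuousAt_tau {Q : ℂ} {x : Sphere} (hx : x ≠ (Q : Sphere)) :
    ContinuousAt (tau Q) x := by
  induction x using OnePoint.rec with
  | infty =>
    rw [OnePoint.continuousAt_infty', tau_infty, coclosedCompact_eq_cocompact,
      ← Metric.cobounded_eq_cocompact]
    exact tendsto_inv₀_cobounded.comp
      (by simp [sub_eq_add_neg])
  | coe z =>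
    rw [OnePoint.continuousAt_coe]
    have : z - Q ≠ 0 := fun h => hx (by rw [sub_eq_zero.1 h])
    exact ContinuousAt.inv₀ (continuousAt_id.sub continuousAt_const) this

theorem isOpenEmbedding_iota (Q : ℂ) : IsOpenEmbedding (iota Q) := by
  refine IsOpenEmbedding.of_continuous_injective_isOpenMap (continuous_iota Q) (iota_injective Q) ?_
  intro s hs
  have h : iota Q '' s = {(Q : Sphere)}ᶜ ∩ tau Q ⁻¹' s := by
    ext x
    constructor
    · rintro ⟨t, ht, rfl⟩
      exact ⟨iota_ne Q t, by simpa using ht⟩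
    · rintro ⟨hx, hxs⟩
      exact ⟨tau Q x, hxs, iota_tau hx⟩
  rw [h]
  exact ContinuousOn.isOpen_inter_preimage
    (fun x hx => (continuousAt_tau hx).continuousWithinAt) isOpen_compl_singleton hs

theorem sphInv_coe (z : ℂ) : sphInv (z : Sphere) = iota 0 z := by
  change (open Classical in if z = 0 then OnePoint.infty else ((z⁻¹ : ℂ) : Sphere)) = _
  simp [iota]

theorem sphInv_infty : sphInv OnePoint.infty = ((0 : ℂ) : Sphere) := rfl

theorem sphInv_sphInv (x : Sphere) : sphInv (sphInv x) = x := by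
  induction x using OnePoint.rec with
  | infty => rw [sphInv_infty, sphInv_coe, iota_zero]
  | coe z =>
    by_cases hz : z = 0
    · simp [hz, sphInv_coe, sphInv_infty]
    · rw [sphInv_coe, iota_of_ne 0 hz, sphInv_coe, iota_of_ne _ (by simpa using hz)]
      simp

theorem continuous_sphInv : Continuous sphInv := by
  rw [continuous_iff_continuousAt]
  intro x
  induction x using OnePoint.rec with
  | infty =>
    rw [OnePoint.continuousAt_infty', sphInv_infty]
    have h : Tendsto (fun z : ℂ => ((z⁻¹ : ℂ) : Sphere)) (Bornology.cobounded ℂ)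
        (𝓝 ((0 : ℂ) : Sphere)) :=
      (OnePoint.continuous_coe.tendsto (0 : ℂ)).comp tendsto_inv₀_cobounded
    rw [coclosedCompact_eq_cocompact, ← Metric.cobounded_eq_cocompact]
    refine h.congr' ?_
    filter_upwards [(Metric.hasBasis_cobounded_compl_closedBall (0 : ℂ)).mem_of_mem
      (i := 0) trivial] with z hz
    have : z ≠ 0 := by rintro rfl; simp at hz
    simp [Function.comp, sphInv_coe, iota_of_ne 0 this]
  | coe z =>
    rw [OnePoint.continuousAt_coe]
    exact (continuous_iota 0).continuousAt.congr (Eventually.of_forall fun w => (sphInv_coe w).symm)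

/-- The stereographic embedding of the sphere. -/
noncomputable def stereo : Sphere → ℂ × ℝ
  | OnePoint.infty => (0, 1)
  | OnePoint.some z => (2 * z / ((1 + ‖z‖ ^ 2 : ℝ) : ℂ), 1 - 2 / (1 + ‖z‖ ^ 2))

theorem stereo_infty : stereo OnePoint.infty = (0, 1) := rfl

theorem stereo_coe (z : ℂ) :
    stereo (z : Sphere) = (2 * z / ((1 + ‖z‖ ^ 2 : ℝ) : ℂ), 1 - 2 / (1 + ‖z‖ ^ 2)) := rfl

theorem continuous_stereo : Continuous stereo := by
  rw [continuous_iff_continuousAt]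
  intro x
  have hsq : Tendsto (fun z : ℂ => 1 + ‖z‖ ^ 2) (Bornology.cobounded ℂ) atTop :=
    tendsto_atTop_add_const_left _ _
      ((tendsto_pow_atTop two_ne_zero).comp tendsto_norm_cobounded_atTop)
  induction x using OnePoint.rec with
  | infty =>
    rw [OnePoint.continuousAt_infty', stereo_infty, coclosedCompact_eq_cocompact,
      ← Metric.cobounded_eq_cocompact]
    refine Tendsto.prodMk_nhds ?_ ?_
    · rw [tendsto_zero_iff_norm_tendsto_zero]
      have h0 : Tendsto (fun z : ℂ => 2 * ‖z‖⁻¹) (Bornology.cobounded ℂ) (𝓝 0) := by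
        simpa using (tendsto_inv_atTop_zero.comp
          (tendsto_norm_cobounded_atTop (E := ℂ))).const_mul (2 : ℝ)
      refine squeeze_zero (fun z => norm_nonneg _) (fun z => ?_) h0
      rw [norm_div, Complex.norm_real, norm_mul, Real.norm_of_nonneg (by positivity)]
      rcases eq_or_ne z 0 with rfl | hz
      · simp
      · have hz' : 0 < ‖z‖ := norm_pos_iff.2 hz
        have h2 : ‖(2 : ℂ)‖ = 2 := by norm_num
        rw [h2, ← div_eq_mul_inv, div_le_div_iff₀ (by positivity) hz']
        nlinarith
    · have h0 : Tendsto (fun z : ℂ => 2 / (1 + ‖z‖ ^ 2)) (Bornology.cobounded ℂ) (𝓝 0) :=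
        tendsto_const_nhds.div_atTop hsq
      simpa using h0.const_sub (1 : ℝ)
  | coe z =>
    rw [OnePoint.continuousAt_coe]
    refine ContinuousAt.prodMk ?_ ?_
    · refine ContinuousAt.div (by fun_prop) (by fun_prop) ?_
      exact_mod_cast (by positivity : (1 + ‖z‖ ^ 2 : ℝ) ≠ 0)
    · refine ContinuousAt.sub continuousAt_const (ContinuousAt.div (by fun_prop) (by fun_prop) ?_)
      positivity

/-- The chordal distance is the Euclidean distance of stereographic images, so its continuity, also
at `∞`, reduces to that of `stereo`. -/
theorem chordalDist_eq (x y : Sphere) :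
    chordalDist x y =
      √(‖(stereo x).1 - (stereo y).1‖ ^ 2 + ((stereo x).2 - (stereo y).2) ^ 2) := by
  have key : ∀ z : ℂ, 2 / √(1 + ‖z‖ ^ 2) =
      √(‖2 * z / ((1 + ‖z‖ ^ 2 : ℝ) : ℂ)‖ ^ 2 + (2 / (1 + ‖z‖ ^ 2)) ^ 2) := by
    intro z
    have hp : (0 : ℝ) < 1 + ‖z‖ ^ 2 := by positivity
    symm
    rw [Real.sqrt_eq_iff_mul_self_eq (by positivity) (by positivity), norm_div, Complex.norm_real,
      Real.norm_of_nonneg hp.le, norm_mul, div_mul_div_comm, Real.mul_self_sqrt hp.le]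
    have h2 : ‖(2 : ℂ)‖ = 2 := by norm_num
    rw [h2]
    field_simp
    ring
  induction x using OnePoint.rec with
  | infty =>
    induction y using OnePoint.rec with
    | infty => simp [chordalDist]
    | coe w =>
      rw [stereo_infty, stereo_coe]
      simp only [zero_sub, norm_neg, sub_sub_cancel]
      exact key w
  | coe z =>
    induction y using OnePoint.rec with
    | infty =>
      rw [stereo_infty, stereo_coe]
      simp only [sub_zero, sub_sub_cancel_left, neg_sq]
      exact key z
    | coe w =>
      rw [stereo_coe, stereo_coe]
      change 2 * ‖z - w‖ / (√(1 + ‖z‖ ^ 2) * √(1 + ‖w‖ ^ 2)) = _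
      have hp : (0 : ℝ) < 1 + ‖z‖ ^ 2 := by positivity
      have hq : (0 : ℝ) < 1 + ‖w‖ ^ 2 := by positivity
      symm
      rw [Real.sqrt_eq_iff_mul_self_eq (by positivity) (by positivity), div_mul_div_comm,
        mul_mul_mul_comm (√(1 + ‖z‖ ^ 2)), Real.mul_self_sqrt hp.le, Real.mul_self_sqrt hq.le,
        mul_mul_mul_comm, ← sq ‖z - w‖]
      simp only [← Complex.normSq_eq_norm_sq] at hp hq ⊢
      have e1 : (2 * z / ((1 + Complex.normSq z : ℝ) : ℂ)) = (⟨2 * z.re / (1 + Complex.normSq z),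
          2 * z.im / (1 + Complex.normSq z)⟩ : ℂ) := by
        apply Complex.ext <;>
          simp only [Complex.div_ofReal_re, Complex.div_ofReal_im] <;> simp
      have e2 : (2 * w / ((1 + Complex.normSq w : ℝ) : ℂ)) = (⟨2 * w.re / (1 + Complex.normSq w),
          2 * w.im / (1 + Complex.normSq w)⟩ : ℂ) := by
        apply Complex.ext <;>
          simp only [Complex.div_ofReal_re, Complex.div_ofReal_im] <;> simp
      rw [e1, e2]
      simp only [Complex.normSq_apply, Complex.sub_re, Complex.sub_im] at hp hq ⊢
      field_simp
      ring

theorem continuous_chordalDist : Continuous fun p : Sphere × Sphere => chordalDist p.1 p.2 := by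
  simp only [chordalDist_eq]
  have h1 : Continuous fun p : Sphere × Sphere => stereo p.1 := continuous_stereo.comp continuous_fst
  have h2 : Continuous fun p : Sphere × Sphere => stereo p.2 := continuous_stereo.comp continuous_snd
  fun_prop

theorem chordalDist_self (x : Sphere) : chordalDist x x = 0 := by
  simp [chordalDist_eq]

theorem chordalDist_pos {x y : Sphere} (h : x ≠ y) : 0 < chordalDist x y := by
  induction x using OnePoint.rec with
  | infty =>
    induction y using OnePoint.rec with
    | infty => exact absurd rfl h
    | coe w => change 0 < 2 / √(1 + ‖w‖ ^ 2); positivity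
  | coe z =>
    induction y using OnePoint.rec with
    | infty => change 0 < 2 / √(1 + ‖z‖ ^ 2); positivity
    | coe w =>
      change 0 < 2 * ‖z - w‖ / (√(1 + ‖z‖ ^ 2) * √(1 + ‖w‖ ^ 2))
      have : 0 < ‖z - w‖ := norm_pos_iff.2 (sub_ne_zero.2 fun e => h (by rw [e]))
      positivity

theorem sphDist_self (x : Sphere) : sphDist x x = 0 := by
  simp [sphDist, chordalDist_self]

theorem sphDist_pos {x y : Sphere} (h : x ≠ y) : 0 < sphDist x y := by
  have := chordalDist_pos h
  have : 0 < Real.arcsin (chordalDist x y / 2) := Real.arcsin_pos.2 (by positivity)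
  unfold sphDist
  positivity

theorem continuous_sphDist : Continuous fun p : Sphere × Sphere => sphDist p.1 p.2 := by
  unfold sphDist
  exact continuous_const.mul (Real.continuous_arcsin.comp (continuous_chordalDist.div_const 2))

theorem isOpen_sphDisk (x : Sphere) (δ : ℝ) : IsOpen (sphDisk x δ) := by
  have h : Continuous fun y : Sphere => (y, x) := by fun_prop
  have h2 : Continuous fun y => sphDist y x := by
    have := continuous_sphDist.comp h
    simpa only [Function.comp_def] using this
  have h3 : IsOpen {y | sphDist y x < δ} := isOpen_lt h2 continuous_const
  exact h3

theorem mem_sphDisk_self (x : Sphere) {δ : ℝ} (hδ : 0 < δ) : x ∈ sphDisk x δ := by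
  simpa [sphDisk, sphDist_self] using hδ

theorem setOf_sphDist_lt_mem_nhdsSet {ε : ℝ} (hε : 0 < ε) :
    {p : Sphere × Sphere | sphDist p.1 p.2 < ε} ∈ 𝓝ˢ (diagonal Sphere) := by
  have ho : IsOpen {p : Sphere × Sphere | sphDist p.1 p.2 < ε} :=
    isOpen_lt continuous_sphDist continuous_const
  refine ho.mem_nhdsSet.2 ?_
  intro p hp
  change sphDist p.1 p.2 < ε
  rw [mem_diagonal_iff.1 hp, sphDist_self]
  exact hε

theorem stereo_inv_fst {z : ℂ} (hz : z ≠ 0) :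
    2 * z⁻¹ / ((1 + ‖z⁻¹‖ ^ 2 : ℝ) : ℂ) = starRingEnd ℂ (2 * z / ((1 + ‖z‖ ^ 2 : ℝ) : ℂ)) := by
  have hz' : 0 < ‖z‖ := norm_pos_iff.2 hz
  have h1 : ((1 + ‖z‖ ^ 2 : ℝ) : ℂ) ≠ 0 := by
    exact_mod_cast (by positivity : (1 + ‖z‖ ^ 2 : ℝ) ≠ 0)
  have h2 : ((1 + ‖z⁻¹‖ ^ 2 : ℝ) : ℂ) ≠ 0 := by
    exact_mod_cast (by positivity : (1 + ‖z⁻¹‖ ^ 2 : ℝ) ≠ 0)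
  have h3 : z * starRingEnd ℂ z = (‖z‖ : ℂ) ^ 2 := Complex.mul_conj' z
  have h4 : (‖z‖ : ℂ) ≠ 0 := by exact_mod_cast hz'.ne'
  have h5 : starRingEnd ℂ (2 * z / ((1 + ‖z‖ ^ 2 : ℝ) : ℂ)) =
      2 * starRingEnd ℂ z / ((1 + ‖z‖ ^ 2 : ℝ) : ℂ) := by
    rw [map_div₀, map_mul, Complex.conj_ofReal, map_ofNat]
  rw [h5, div_eq_div_iff h2 h1]
  rw [norm_inv]
  push_cast
  have h6 : starRingEnd ℂ z = (‖z‖ : ℂ) ^ 2 * z⁻¹ := by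
    rw [← h3]; field_simp
  rw [h6]
  generalize (‖z‖ : ℂ) = r at *
  field_simp
  ring

theorem stereo_inv_snd {z : ℂ} (hz : z ≠ 0) :
    1 - 2 / (1 + ‖z⁻¹‖ ^ 2) = -(1 - 2 / (1 + ‖z‖ ^ 2)) := by
  have hz' : 0 < ‖z‖ := norm_pos_iff.2 hz
  rw [norm_inv]
  generalize ‖z‖ = r at *
  field_simp
  ring

theorem stereo_coe_zero : stereo ((0 : ℂ) : Sphere) = (0, -1) := by
  rw [stereo_coe]; norm_num

/-- The inversion is a half-turn of the round sphere, hence an isometry. This reduces questions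
about spherical disks to centres in the closed unit disk. -/
theorem stereo_sphInv (x : Sphere) :
    stereo (sphInv x) = (starRingEnd ℂ (stereo x).1, -(stereo x).2) := by
  induction x using OnePoint.rec with
  | infty => rw [sphInv_infty, stereo_coe_zero, stereo_infty, map_zero]
  | coe z =>
    by_cases hz : z = 0
    · rw [hz, sphInv_coe, iota_zero, stereo_coe_zero, stereo_infty, map_zero, neg_neg]
    · rw [sphInv_coe, iota_of_ne 0 hz, stereo_coe, stereo_coe, zero_add, stereo_inv_fst hz,
        stereo_inv_snd hz]

theorem chordalDist_sphInv (x y : Sphere) : chordalDist (sphInv x) (sphInv y) = chordalDist x y := by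
  rw [chordalDist_eq, chordalDist_eq, stereo_sphInv, stereo_sphInv]
  simp only [← map_sub, RCLike.norm_conj]
  congr 2
  ring

theorem sphDisk_sphInv (x : Sphere) (δ : ℝ) :
    sphDisk (sphInv x) δ = sphInv '' sphDisk x δ := by
  have h : ∀ y, sphDist (sphInv y) (sphInv x) = sphDist y x := fun y => by
    simp [sphDist, chordalDist_sphInv]
  ext y
  constructor
  · intro hy
    refine ⟨sphInv y, ?_, sphInv_sphInv y⟩
    change sphDist (sphInv y) x < δ
    rw [← h, sphInv_sphInv]
    exact hy
  · rintro ⟨y, hy, rfl⟩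
    change sphDist _ _ < δ
    rw [h]
    exact hy

/-- Such a disk is a Euclidean disk not containing `∞`. Membership reads |w - z|² < k(1 + |w|²) with
k = s²(1 + |z|²), s = sin(δ/2); here s ≤ 1/2 gives k ≤ 1/2, and completing the square yields centre
z/(1 - k). -/
theorem isPreconnected_sphDisk_coe {z : ℂ} (hz : ‖z‖ ≤ 1) {δ : ℝ} (hδ : δ ≤ 1) :
    IsPreconnected (sphDisk (z : Sphere) δ) := by
  rcases le_or_gt δ 0 with h0 | h0
  · have : sphDisk (z : Sphere) δ = ∅ := by
      ext y
      simp only [mem_empty_iff_false, iff_false]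
      intro hy
      have h1 : sphDist y z < δ := hy
      have h2 : 0 ≤ sphDist y z := by
        by_cases h : y = z
        · rw [h, sphDist_self]
        · exact (sphDist_pos h).le
      linarith
    rw [this]; exact isPreconnected_empty
  set s := Real.sin (δ / 2) with hs
  have hs0 : 0 < s := Real.sin_pos_of_pos_of_lt_pi (by linarith) (by linarith [Real.pi_gt_three])
  have hs1 : s ≤ 1 / 2 := (Real.sin_le (by linarith)).trans (by linarith)
  have hmem : ∀ y : Sphere, y ∈ sphDisk (z : Sphere) δ ↔ chordalDist y z < 2 * s := by
    intro y
    change 2 * Real.arcsin (chordalDist y z / 2) < δ ↔ _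
    rw [← lt_div_iff₀' (by norm_num : (0 : ℝ) < 2), Real.arcsin_lt_iff_lt_sin'
      ⟨by linarith [Real.pi_gt_three], by linarith [Real.pi_gt_three]⟩, div_lt_iff₀' two_pos]
  set a : ℝ := 1 + ‖z‖ ^ 2 with ha
  have ha1 : 1 ≤ a := by rw [ha]; nlinarith [norm_nonneg z]
  have ha2 : a ≤ 2 := by rw [ha]; nlinarith [norm_nonneg z]
  set k : ℝ := s ^ 2 * a with hk
  have hk1 : 0 < 1 - k := by rw [hk]; nlinarith
  have hset : sphDisk (z : Sphere) δ = (↑) '' ball (z / ((1 - k : ℝ) : ℂ))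
      √((k + k * ‖z‖ ^ 2 / (1 - k)) / (1 - k)) := by
    ext y
    rw [hmem]
    induction y using OnePoint.rec with
    | infty =>
      change 2 / √a < 2 * s ↔ _
      simp only [mem_image, OnePoint.coe_ne_infty, and_false, exists_false, iff_false, not_lt]
      have h2 : √a ≤ 2 := by
        rw [Real.sqrt_le_left (by norm_num)]; linarith
      rw [le_div_iff₀ (by positivity)]
      nlinarith [Real.sqrt_nonneg a]
    | coe w =>
      rw [OnePoint.coe_injective.mem_set_image]
      change 2 * ‖w - z‖ / (√(1 + ‖w‖ ^ 2) * √a) < 2 * s ↔ _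
      rw [div_lt_iff₀ (by positivity), mul_assoc, mul_lt_mul_iff_right₀ two_pos,
        ← Real.sqrt_mul (by positivity), ← Real.sqrt_sq hs0.le, ← Real.sqrt_mul (by positivity),
        Real.lt_sqrt (norm_nonneg _), mem_ball, dist_eq_norm, Real.lt_sqrt (norm_nonneg _),
        lt_div_iff₀ hk1]
      have e : ‖w - z / ((1 - k : ℝ) : ℂ)‖ ^ 2 * (1 - k) =
          ‖w - z‖ ^ 2 - k * ‖w‖ ^ 2 + k * ‖z‖ ^ 2 / (1 - k) := by
        simp only [← Complex.normSq_eq_norm_sq, Complex.normSq_apply, Complex.sub_re,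
          Complex.sub_im, Complex.div_ofReal_re, Complex.div_ofReal_im]
        field_simp
        ring
      rw [e]
      constructor <;> intro h <;> nlinarith
  rw [hset]
  exact (convex_ball _ _).isPreconnected.image _ OnePoint.continuous_coe.continuousOn

/-- Small spherical disks are connected. -/
theorem isPreconnected_sphDisk (x : Sphere) {δ : ℝ} (hδ : δ ≤ 1) :
    IsPreconnected (sphDisk x δ) := by
  have hinv : ∀ y : Sphere, IsPreconnected (sphDisk y δ) → IsPreconnected (sphDisk (sphInv y) δ) :=
    fun y hy => by
      rw [sphDisk_sphInv]
      exact hy.image _ continuous_sphInv.continuousOn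
  rw [← sphInv_sphInv x]
  induction x using OnePoint.rec with
  | infty =>
    apply hinv
    rw [sphInv_infty]
    exact isPreconnected_sphDisk_coe (by simp) hδ
  | coe z =>
    rcases le_or_gt ‖z‖ 1 with h | h
    · rw [sphInv_sphInv]; exact isPreconnected_sphDisk_coe h hδ
    · have hz : z ≠ 0 := by rintro rfl; simp at h; linarith
      apply hinv
      rw [sphInv_coe, iota_of_ne 0 hz, zero_add]
      exact isPreconnected_sphDisk_coe (by rw [norm_inv]; exact inv_le_one_of_one_le₀ h.le) hδ

instance : TopologicalSpace.MetrizableSpace Sphere :=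
  (onePointEquivSphereOfFinrankEq (ι := Fin 3) (V := ℂ)
    (by simp [Complex.finrank_real_complex])).isEmbedding.metrizableSpace

/-- Needed so that components of open sets, and thus pullbacks, are open. -/
theorem locallyConnectedSpace_sphere : LocallyConnectedSpace Sphere := by
  have e := onePointEquivSphereOfFinrankEq (ι := Fin 3) (V := ℂ)
    (by simp [Complex.finrank_real_complex])
  have : Fact (Module.finrank ℝ (EuclideanSpace ℝ (Fin 3)) = 2 + 1) := ⟨by simp⟩
  have := ChartedSpace.locallyConnectedSpace (EuclideanSpace ℝ (Fin 2))
    (sphere (0 : EuclideanSpace ℝ (Fin 3)) 1)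
  exact e.isOpenEmbedding.locallyConnectedSpace

end MeroDyn

/-! ### Meromorphic maps into the sphere and their iterates. -/

namespace MeroDyn

open Metric

/-- `F` is meromorphic at `u`, expressed through all the coordinates `tau Q` of the sphere. -/
def MeroAt (F : ℂ → Sphere) (u : ℂ) : Prop :=
  ContinuousAt F u ∧ ∀ Q : ℂ, F u ≠ (Q : Sphere) → AnalyticAt ℂ (fun w => tau Q (F w)) u

theorem exists_coe_ne (x : Sphere) : ∃ Q : ℂ, x ≠ (Q : Sphere) := by
  induction x using OnePoint.rec with
  | infty => exact ⟨0, OnePoint.infty_ne_coe 0⟩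
  | coe z => exact ⟨z + 1, by simp⟩

theorem MeroAt.congr {F G : ℂ → Sphere} {u : ℂ} (hF : MeroAt F u) (h : F =ᶠ[𝓝 u] G) :
    MeroAt G u := by
  refine ⟨hF.1.congr h, fun Q hQ => ?_⟩
  refine (hF.2 Q (h.eq_of_nhds ▸ hQ)).congr ?_
  filter_upwards [h] with w hw
  rw [hw]

theorem MeroAt.comp_analyticAt {F : ℂ → Sphere} {g : ℂ → ℂ} {u : ℂ} (hF : MeroAt F (g u))
    (hg : AnalyticAt ℂ g u) : MeroAt (fun w => F (g w)) u :=
  ⟨hF.1.comp (f := g) hg.continuousAt, fun Q hQ => (hF.2 Q hQ).fun_comp hg⟩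

theorem meroAt_coe (u : ℂ) : MeroAt (fun z : ℂ => (z : Sphere)) u := by
  refine ⟨OnePoint.continuous_coe.continuousAt, fun Q hQ => ?_⟩
  have h : u - Q ≠ 0 := fun h => hQ (by rw [sub_eq_zero.1 h])
  exact (analyticAt_id.sub analyticAt_const).inv h

theorem meroAt_iota (Q u : ℂ) : MeroAt (iota Q) u := by
  refine ⟨(continuous_iota Q).continuousAt, fun Q' hQ => ?_⟩
  have h : ∀ t, tau Q' (iota Q t) = t / (1 + (Q - Q') * t) := by
    intro t
    by_cases ht : t = 0
    · simp [ht]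
    · rw [iota_of_ne Q ht, tau_coe, show 1 + (Q - Q') * t = (Q + t⁻¹ - Q') * t by field_simp; ring]
      field_simp
  have h2 : 1 + (Q - Q') * u ≠ 0 := by
    intro h0
    have hu : u ≠ 0 := by rintro rfl; simp at h0
    apply hQ
    rw [iota_of_ne Q hu]
    congr 1
    field_simp
    linear_combination h0
  simp only [h]
  have : AnalyticAt ℂ (fun t : ℂ => 1 + (Q - Q') * t) u := by fun_prop
  exact analyticAt_id.div this h2

theorem IsMeromorphic.meroAt {f : ℂ → Sphere} (hf : IsMeromorphic f) (z : ℂ) : MeroAt f z := by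
  rcases hf z with ⟨g, hg, h⟩ | ⟨g, hg, h⟩
  · exact ((meroAt_coe (g z)).comp_analyticAt hg).congr (h.mono fun w hw => hw.symm)
  · refine ((meroAt_iota 0 (g z)).comp_analyticAt hg).congr (h.mono fun w hw => ?_)
    simp only
    rw [← sphInv_coe, ← hw, sphInv_sphInv]

/-- The total extension of the partial map `sphereExt f`. -/
noncomputable def sphMap (f : ℂ → Sphere) (x : Sphere) : Sphere :=
  (sphereExt f x).getD OnePoint.infty

/-- The domain of the partial map `sphereExt f`. -/
def sphDom (f : ℂ → Sphere) : Set Sphere := {x | sphereExt f x ≠ none}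

/-- The `n`-th iterate is defined at `x`. -/
def IterDefined (f : ℂ → Sphere) (n : ℕ) (x : Sphere) : Prop :=
  ∀ k < n, (sphMap f)^[k] x ∈ sphDom f

variable {f : ℂ → Sphere}

@[simp] theorem sphMap_coe (z : ℂ) : sphMap f (z : Sphere) = f z := rfl

theorem coe_mem_sphDom (z : ℂ) : (z : Sphere) ∈ sphDom f := by
  change some (f z) ≠ none
  simp

theorem sphereExt_infty_of_tendsto (h : ∃ a : Sphere, Tendsto f (cocompact ℂ) (𝓝 a)) :
    sphereExt f OnePoint.infty = some h.choose := by
  change (open Classical in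
      if h : ∃ a : Sphere, Tendsto f (cocompact ℂ) (𝓝 a) then some h.choose else none) = _
  rw [dif_pos h]

theorem infty_mem_sphDom_iff :
    OnePoint.infty ∈ sphDom f ↔ ∃ a : Sphere, Tendsto f (cocompact ℂ) (𝓝 a) := by
  constructor
  · intro h
    by_contra hn
    apply h
    change (open Classical in
      if h : ∃ a : Sphere, Tendsto f (cocompact ℂ) (𝓝 a) then some h.choose else none) = _
    rw [dif_neg hn]
  · intro h
    change sphereExt f _ ≠ none
    rw [sphereExt_infty_of_tendsto h]
    simp

theorem tendsto_sphMap_infty (h : OnePoint.infty ∈ sphDom f) :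
    Tendsto f (cocompact ℂ) (𝓝 (sphMap f OnePoint.infty)) := by
  have h' := infty_mem_sphDom_iff.1 h
  have : sphMap f OnePoint.infty = h'.choose := by
    unfold sphMap
    rw [sphereExt_infty_of_tendsto h', Option.getD_some]
  rw [this]
  exact h'.choose_spec

theorem sphereExt_eq_some {x : Sphere} (h : x ∈ sphDom f) : sphereExt f x = some (sphMap f x) := by
  obtain ⟨y, hy⟩ := Option.ne_none_iff_exists'.1 h
  simp [sphMap, hy]

theorem iterDefined_succ {n : ℕ} {x : Sphere} :
    IterDefined f (n + 1) x ↔ IterDefined f n x ∧ (sphMap f)^[n] x ∈ sphDom f := by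
  unfold IterDefined
  exact Nat.forall_lt_succ_right

theorem IterDefined.mono {m n : ℕ} {x : Sphere} (h : IterDefined f n x) (hmn : m ≤ n) :
    IterDefined f m x := fun k hk => h k (hk.trans_le hmn)

/-- Dictionary between partial iterates and iterates of the total map `sphMap`; the junk value of
`sphMap` is harmless as long as `IterDefined` is carried along. -/
theorem iter_eq_some_iff {n : ℕ} {x y : Sphere} :
    iter f n x = some y ↔ IterDefined f n x ∧ (sphMap f)^[n] x = y := by
  induction n generalizing y with
  | zero => simp [iter, IterDefined]
  | succ n ih =>
    rw [iterDefined_succ, Function.iterate_succ_apply', iter, Option.bind_eq_some_iff]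
    constructor
    · rintro ⟨a, ha, hay⟩
      obtain ⟨h1, rfl⟩ := ih.1 ha
      have hd : (sphMap f)^[n] x ∈ sphDom f := by
        change sphereExt f _ ≠ none
        rw [hay]; simp
      refine ⟨⟨h1, hd⟩, ?_⟩
      rw [sphereExt_eq_some hd] at hay
      exact Option.some_injective _ hay
    · rintro ⟨⟨h1, hd⟩, rfl⟩
      exact ⟨_, ih.2 ⟨h1, rfl⟩, sphereExt_eq_some hd⟩

theorem isOpen_sphDom : IsOpen (sphDom f) := by
  by_cases h : OnePoint.infty ∈ sphDom f
  · have : sphDom f = univ := by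
      ext x
      induction x using OnePoint.rec with
      | infty => simpa using h
      | coe z => simpa using coe_mem_sphDom z
    rw [this]; exact isOpen_univ
  · have : sphDom f = range ((↑) : ℂ → Sphere) := by
      ext x
      induction x using OnePoint.rec with
      | infty => simpa using h
      | coe z => simpa using coe_mem_sphDom z
    rw [this]; exact OnePoint.isOpen_range_coe

theorem meroAt_sphMap_iota (hf : IsMeromorphic f) {Q t : ℂ} (h : iota Q t ∈ sphDom f) :
    MeroAt (fun s => sphMap f (iota Q s)) t := by
  have hne : ∀ s : ℂ, s ≠ 0 → MeroAt (fun s => sphMap f (iota Q s)) s := by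
    intro s hs
    have h1 : MeroAt (fun s => f (Q + s⁻¹)) s :=
      (hf.meroAt (Q + s⁻¹)).comp_analyticAt (g := fun s => Q + s⁻¹)
        (analyticAt_const.add (analyticAt_id.inv hs))
    refine h1.congr ?_
    filter_upwards [isOpen_ne.mem_nhds hs] with w hw
    rw [iota_of_ne Q hw, sphMap_coe]
  by_cases ht : t = 0
  · subst ht
    rw [iota_zero] at h
    have hc : ContinuousAt (fun s => sphMap f (iota Q s)) 0 := by
      rw [continuousAt_iff_punctured_nhds, iota_zero]
      have h2 := (tendsto_sphMap_infty h)
      rw [← Metric.cobounded_eq_cocompact] at h2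
      refine (h2.comp (tendsto_add_inv_nhdsNE_zero Q)).congr' ?_
      filter_upwards [self_mem_nhdsWithin] with w hw
      rw [iota_of_ne Q hw, sphMap_coe]
      rfl
    -- At `t = 0`, which is the point `∞`, the existence of the limit of `f` makes the singularity
    -- removable.
    refine ⟨hc, fun Q' hQ' => ?_⟩
    refine Complex.analyticAt_of_differentiable_on_punctured_nhds_of_continuousAt ?_
      (ContinuousAt.comp (g := tau Q') (continuousAt_tau hQ') hc)
    rw [eventually_nhdsWithin_iff]
    filter_upwards [hc.eventually_ne hQ'] with s hs hs0
    exact ((hne s hs0).2 Q' hs).differentiableAt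
  · exact hne t ht

theorem MeroAt.sphMap_comp (hf : IsMeromorphic f) {F : ℂ → Sphere} {u : ℂ} (hF : MeroAt F u)
    (h : F u ∈ sphDom f) : MeroAt (fun w => sphMap f (F w)) u := by
  obtain ⟨Q, hQ⟩ := exists_coe_ne (F u)
  have h1 : MeroAt (fun s => sphMap f (iota Q s)) (tau Q (F u)) :=
    meroAt_sphMap_iota hf (by rwa [iota_tau hQ])
  refine (h1.comp_analyticAt (g := fun w => tau Q (F w)) (hF.2 Q hQ)).congr ?_
  filter_upwards [hF.1.eventually_ne hQ] with w hw
  rw [iota_tau hw]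

theorem MeroAt.iterate_comp (hf : IsMeromorphic f) {F : ℂ → Sphere} {u : ℂ} (hF : MeroAt F u)
    {n : ℕ} (h : IterDefined f n (F u)) : MeroAt (fun w => (sphMap f)^[n] (F w)) u := by
  induction n with
  | zero => exact hF
  | succ n ih =>
    rw [iterDefined_succ] at h
    simp only [Function.iterate_succ_apply']
    exact (ih h.1).sphMap_comp hf h.2

/-- Identity theorem: the set of points near which `f` is identically `c` is open, and closed
because zeros of a non-constant analytic function are isolated. -/
theorem not_eventually_const (hf : IsMeromorphic f) (hconst : ¬ IsConst f) (z : ℂ) (c : Sphere) :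
    ¬ ∀ᶠ w in 𝓝 z, f w = c := by
  intro hz
  set S : Set ℂ := {z | ∀ᶠ w in 𝓝 z, f w = c} with hS
  have hSo : IsOpen S := isOpen_setOfPred_eventually_nhds
  have hSc : IsClosed S := by
    rw [← closure_subset_iff_isClosed]
    intro y hy
    have hfr : ∃ᶠ w in 𝓝 y, f w = c := (mem_closure_iff_frequently.1 hy).mono fun w hw => hw.self_of_nhds
    have hyc : f y = c := by
      have hcl : IsClosed {x : Sphere | x = c} := isClosed_singleton
      by_contra hne
      exact (hfr.and_eventually ((hf.meroAt y).1.eventually_ne hne)).exists.elim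
        fun w hw => hw.2 hw.1
    by_cases hyS : y ∈ S
    · exact hyS
    obtain ⟨Q, hQ⟩ := exists_coe_ne (f y)
    have han := (hf.meroAt y).2 Q hQ
    have hfr' : ∃ᶠ w in 𝓝[≠] y, tau Q (f w) = tau Q c := by
      rw [frequently_nhdsWithin_iff]
      refine (mem_closure_iff_frequently.1 hy).mono fun w hw => ⟨?_, ?_⟩
      · rw [hw.self_of_nhds]
      · rintro rfl; exact hyS hw
    have := (han.frequently_eq_iff_eventually_eq analyticAt_const).1 hfr'
    filter_upwards [this, (hf.meroAt y).1.eventually_ne hQ] with w hw hwQ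
    rw [← iota_tau hwQ, hw, iota_tau (hyc ▸ hQ)]
  have : S = univ := (isClopen_iff.1 ⟨hSc, hSo⟩).resolve_left (nonempty_iff_ne_empty.1 ⟨z, hz⟩)
  exact hconst ⟨c, fun w => (this ▸ mem_univ w : w ∈ S).self_of_nhds⟩

theorem MeroAt.nhds_le_map_nhds {F : ℂ → Sphere} {u : ℂ} (hF : MeroAt F u)
    (h : ¬ ∀ᶠ w in 𝓝 u, F w = F u) : 𝓝 (F u) ≤ map F (𝓝 u) := by
  obtain ⟨Q, hQ⟩ := exists_coe_ne (F u)
  have hev : ∀ᶠ w in 𝓝 u, iota Q (tau Q (F w)) = F w := by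
    filter_upwards [hF.1.eventually_ne hQ] with w hw using iota_tau hw
  have h1 := (hF.2 Q hQ).eventually_constant_or_nhds_le_map_nhds.resolve_left (by
    intro hc
    apply h
    filter_upwards [hev, hc] with w hw hcw
    rw [← hw, hcw, iota_tau hQ])
  calc 𝓝 (F u) = map (iota Q) (𝓝 (tau Q (F u))) := by
        rw [(isOpenEmbedding_iota Q).map_nhds_eq, iota_tau hQ]
    _ ≤ map (iota Q) (map (fun w => tau Q (F w)) (𝓝 u)) := map_mono h1
    _ = map F (𝓝 u) := by
        rw [map_map]
        exact map_congr hev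

theorem continuousAt_sphMap (hf : IsMeromorphic f) {x : Sphere} (hx : x ∈ sphDom f) :
    ContinuousAt (sphMap f) x := by
  obtain ⟨Q, hQ⟩ := exists_coe_ne x
  rw [← iota_tau hQ] at hx ⊢
  exact (isOpenEmbedding_iota Q).continuousAt_iff.1 (meroAt_sphMap_iota hf hx).1

theorem nhds_le_map_sphMap (hf : IsMeromorphic f) (hconst : ¬ IsConst f) {x : Sphere}
    (hx : x ∈ sphDom f) : 𝓝 (sphMap f x) ≤ map (sphMap f) (𝓝 x) := by
  obtain ⟨Q, hQ⟩ := exists_coe_ne x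
  rw [← iota_tau hQ] at hx ⊢
  set t := tau Q x
  have h := (meroAt_sphMap_iota hf hx).nhds_le_map_nhds ?_
  · rwa [← (isOpenEmbedding_iota Q).map_nhds_eq, map_map]
  · intro hc
    -- If the map is constant near a point, possibly `∞`, it is constant near some finite point as
    -- well, where `not_eventually_const` applies.
    obtain ⟨s, hs0, hs⟩ : ∃ s : ℂ, s ≠ 0 ∧
        ∀ᶠ r in 𝓝 s, sphMap f (iota Q r) = sphMap f (iota Q t) := by
      have h1 : ∀ᶠ s in 𝓝 t, ∀ᶠ r in 𝓝 s, sphMap f (iota Q r) = sphMap f (iota Q t) :=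
        hc.eventually_nhds
      have h2 : ∃ᶠ s in 𝓝 t, s ≠ 0 := by
        exact mem_closure_iff_frequently.1 ((dense_compl_singleton (0 : ℂ)) t)
      obtain ⟨s, hs⟩ := (h2.and_eventually h1).exists
      exact ⟨s, hs.1, hs.2⟩
    refine not_eventually_const hf hconst (Q + s⁻¹) (sphMap f (iota Q t)) ?_
    have hmap : 𝓝 ((Q + s⁻¹ : ℂ) : Sphere) = map (iota Q) (𝓝 s) := by
      rw [(isOpenEmbedding_iota Q).map_nhds_eq, iota_of_ne Q hs0]
    have h3 : ∀ᶠ y in 𝓝 ((Q + s⁻¹ : ℂ) : Sphere), sphMap f y = sphMap f (iota Q t) := by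
      rw [hmap, eventually_map]; exact hs
    exact OnePoint.continuous_coe.continuousAt.eventually h3

theorem continuousAt_iterate (hf : IsMeromorphic f) {n : ℕ} {x : Sphere}
    (hx : IterDefined f n x) : ContinuousAt (sphMap f)^[n] x := by
  induction n with
  | zero => exact continuousAt_id
  | succ n ih =>
    rw [iterDefined_succ] at hx
    rw [Function.iterate_succ']
    exact (continuousAt_sphMap hf hx.2).comp (ih hx.1)

theorem nhds_le_map_iterate (hf : IsMeromorphic f) (hconst : ¬ IsConst f) {n : ℕ} {x : Sphere}
    (hx : IterDefined f n x) : 𝓝 ((sphMap f)^[n] x) ≤ map (sphMap f)^[n] (𝓝 x) := by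
  induction n with
  | zero => simp
  | succ n ih =>
    rw [iterDefined_succ] at hx
    rw [Function.iterate_succ', ← map_map]
    exact (nhds_le_map_sphMap hf hconst hx.2).trans (map_mono (ih hx.1))

theorem isOpen_iterDefined (hf : IsMeromorphic f) (n : ℕ) : IsOpen {x | IterDefined f n x} := by
  induction n with
  | zero => simp [IterDefined]
  | succ n ih =>
    have : {x | IterDefined f (n + 1) x} =
        {x | IterDefined f n x} ∩ (sphMap f)^[n] ⁻¹' sphDom f := by
      ext x; exact iterDefined_succ
    rw [this]
    exact ContinuousOn.isOpen_inter_preimage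
      (fun x hx => (continuousAt_iterate hf hx).continuousWithinAt) ih isOpen_sphDom

theorem isOpen_iterDefined_inter_preimage (hf : IsMeromorphic f) (n : ℕ) {D : Set Sphere}
    (hD : IsOpen D) : IsOpen {x | IterDefined f n x ∧ (sphMap f)^[n] x ∈ D} :=
  ContinuousOn.isOpen_inter_preimage
      (fun _ hx => (continuousAt_iterate hf hx).continuousWithinAt) (isOpen_iterDefined hf n) hD

theorem isOpen_image_iterate (hf : IsMeromorphic f) (hconst : ¬ IsConst f) {n : ℕ} {U : Set Sphere}
    (hU : IsOpen U) (hd : ∀ x ∈ U, IterDefined f n x) : IsOpen ((sphMap f)^[n] '' U) := by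
  rw [isOpen_iff_mem_nhds]
  rintro _ ⟨x, hx, rfl⟩
  exact nhds_le_map_iterate hf hconst (hd x hx) (image_mem_map (hU.mem_nhds hx))

end MeroDyn

/-! ### Equicontinuity and normal families of sphere-valued maps. -/

namespace MeroDyn

open Metric

/-- Equicontinuity at a point of a family of maps into the sphere. -/
def SphEquicontAt {ι : Type*} (F : ι → ℂ → Sphere) (z : ℂ) : Prop :=
  ∀ W ∈ 𝓝ˢ (diagonal Sphere), ∀ᶠ w in 𝓝 z, ∀ i, (F i z, F i w) ∈ W

/-- The complement of an open neighbourhood of the diagonal is compact, so finitely many sets on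
which one `H k` differs by a definite amount cover it. Equicontinuity of the compositions keeps
pairs out of each of them. -/
theorem sphEquicontAt_of_separating {ι κ : Type*} {H : κ → Sphere → ℂ}
    (hc : ∀ k, Continuous (H k)) (hsep : ∀ x y, x ≠ y → ∃ k, H k x ≠ H k y)
    {F : ι → ℂ → Sphere} {z : ℂ}
    (h : ∀ k, ∀ ε > 0, ∀ᶠ w in 𝓝 z, ∀ i, ‖H k (F i z) - H k (F i w)‖ < ε) :
    SphEquicontAt F z := by
  intro W hW
  obtain ⟨W', hW'o, hW'd, hW'W⟩ := mem_nhdsSet_iff_exists.1 hW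
  have hK : IsCompact W'ᶜ := hW'o.isClosed_compl.isCompact
  have key : ∀ᶠ w in 𝓝 z, ∀ i, (F i z, F i w) ∉ W'ᶜ := by
    refine hK.induction_on (p := fun S => ∀ᶠ w in 𝓝 z, ∀ i, (F i z, F i w) ∉ S) ?_ ?_ ?_ ?_
    · simp
    · intro S T hST hT
      filter_upwards [hT] with w hw i hi using hw i (hST hi)
    · intro S T hS hT
      filter_upwards [hS, hT] with w hw1 hw2 i hi
      exact hi.elim (hw1 i) (hw2 i)
    · intro p hp
      have hne : p.1 ≠ p.2 := fun e => hp (hW'd e)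
      obtain ⟨k, hk⟩ := hsep _ _ hne
      have hcont : Continuous fun q : Sphere × Sphere => ‖H k q.1 - H k q.2‖ :=
        (((hc k).comp continuous_fst).sub ((hc k).comp continuous_snd)).norm
      have hpos : 0 < ‖H k p.1 - H k p.2‖ := norm_pos_iff.2 (sub_ne_zero.2 hk)
      refine ⟨{q | ‖H k p.1 - H k p.2‖ / 2 < ‖H k q.1 - H k q.2‖}, mem_nhdsWithin_of_mem_nhds
        (hcont.continuousAt.eventually_const_lt (half_lt_self hpos)), ?_⟩
      filter_upwards [h k _ (half_pos hpos)] with w hw i hi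
      exact lt_asymm (hw i) hi
  filter_upwards [key] with w hw i
  exact hW'W (not_not.1 (hw i))

theorem dist_le_of_bounded {b : ℂ → ℂ} {z w : ℂ} {r C : ℝ}
    (hb : DifferentiableOn ℂ b (ball z r)) (hC : ∀ w ∈ ball z r, ‖b w‖ ≤ C) (hw : w ∈ ball z r) :
    dist (b w) (b z) ≤ 2 * C / r * dist w z := by
  have hz : z ∈ ball z r := mem_ball_self (pos_of_mem_ball hw)
  refine Complex.dist_le_div_mul_dist_of_mapsTo_ball hb (fun x hx => ?_) hw
  rw [mem_closedBall, dist_eq_norm]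
  calc ‖b x - b z‖ ≤ ‖b x‖ + ‖b z‖ := norm_sub_le _ _
    _ ≤ 2 * C := by linarith [hC x hx, hC z hz]

theorem eventually_dist_lt_of_bounded {ι : Type*} {b : ι → ℂ → ℂ} {z : ℂ} {r C : ℝ} (hr : 0 < r)
    (hb : ∀ i, DifferentiableOn ℂ (b i) (ball z r)) (hC : ∀ i, ∀ w ∈ ball z r, ‖b i w‖ ≤ C)
    {ε : ℝ} (hε : 0 < ε) : ∀ᶠ w in 𝓝 z, ∀ i, dist (b i w) (b i z) < ε := by
  have h1 : ContinuousAt (fun w => 2 * C / r * dist w z) z := by fun_prop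
  have h2 : ∀ᶠ w in 𝓝 z, 2 * C / r * dist w z < ε :=
    h1.eventually_lt_const (by simpa using hε)
  filter_upwards [h2, ball_mem_nhds z hr] with w hw hwb i
  exact (dist_le_of_bounded (hb i) (hC i) hwb).trans_lt hw

/-- The bounded holomorphic factors are equicontinuous by Cauchy's estimate, and the finitely many
outer maps are uniformly continuous on the compact disk of radius `C`. -/
theorem sphEquicontAt_of_factor {ι κ : Type*} [Finite κ] {Ψ : κ → ℂ → Sphere}
    (hΨ : ∀ k, Continuous (Ψ k)) {F : ι → ℂ → Sphere} {b : ι → ℂ → ℂ} {j : ι → κ} {z : ℂ}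
    {r C : ℝ} (hr : 0 < r) (hb : ∀ i, DifferentiableOn ℂ (b i) (ball z r))
    (hC : ∀ i, ∀ w ∈ ball z r, ‖b i w‖ ≤ C)
    (hF : ∀ i, ∀ w ∈ ball z r, F i w = Ψ (j i) (b i w)) : SphEquicontAt F z := by
  intro W hW
  -- Any compatible metric serves: on a compact space the entourages are exactly the neighbourhoods
  -- of the diagonal.
  let _ := TopologicalSpace.metrizableSpaceMetric Sphere
  rw [nhdsSet_diagonal_eq_uniformity] at hW
  obtain ⟨ε, hε, hεW⟩ := Metric.mem_uniformity_dist.1 hW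
  have hη : ∀ k, ∃ η > 0, ∀ s ∈ closedBall (0 : ℂ) C, ∀ t ∈ closedBall (0 : ℂ) C,
      dist s t < η → dist (Ψ k s) (Ψ k t) < ε := by
    intro k
    have := (isCompact_closedBall (0 : ℂ) C).uniformContinuousOn_of_continuous (hΨ k).continuousOn
    obtain ⟨η, hη, h⟩ := Metric.uniformContinuousOn_iff.1 this ε hε
    exact ⟨η, hη, h⟩
  choose η hη hηΨ using hη
  have hev : ∀ᶠ w in 𝓝 z, ∀ k, ∀ i, dist (b i w) (b i z) < η k := by
    rw [eventually_all]
    exact fun k => eventually_dist_lt_of_bounded hr hb hC (hη k)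
  filter_upwards [hev, ball_mem_nhds z hr] with w hw hwb i
  have hz : z ∈ ball z r := mem_ball_self hr
  apply hεW
  rw [hF i z hz, hF i w hwb]
  refine hηΨ _ _ (by simpa using hC i z hz) _ (by simpa using hC i w hwb) ?_
  rw [dist_comm]
  exact hw _ _

theorem SphEquicontAt.of_tail {F : ℕ → ℂ → Sphere} {z : ℂ} {N : ℕ}
    (hc : ∀ n < N, ContinuousAt (F n) z) (h : SphEquicontAt (fun n => F (n + N)) z) :
    SphEquicontAt F z := by
  intro W hW
  have h1 : ∀ᶠ w in 𝓝 z, ∀ n ∈ Finset.range N, (F n z, F n w) ∈ W := by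
    rw [eventually_all_finset]
    intro n hn
    have hWn : W ∈ 𝓝 (F n z, F n z) := mem_nhdsSet_iff_forall.1 hW _ rfl
    exact (continuousAt_const.prodMk (hc n (Finset.mem_range.1 hn))).eventually_mem hWn
  filter_upwards [h1, h W hW] with w hw1 hw2 n
  rcases lt_or_ge n N with hn | hn
  · exact hw1 n (Finset.mem_range.2 hn)
  · simpa [Nat.sub_add_cancel hn] using hw2 (n - N)

/-- The Arzelà–Ascoli theorem for sequences of maps into the sphere. -/
theorem isNormalOn_of_sphEquicontAt {U : Set ℂ} {F : ℕ → ℂ → Sphere}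
    (h : ∀ z ∈ U, SphEquicontAt F z) : IsNormalOn U (range F) := by
  intro G hG
  choose m hm using hG
  let _ := TopologicalSpace.metrizableSpaceMetric Sphere
  have heq : EquicontinuousOn G U := by
    intro z hz
    refine EquicontinuousAt.equicontinuousWithinAt ?_ U
    intro W hW
    rw [← nhdsSet_diagonal_eq_uniformity] at hW
    filter_upwards [h z hz W hW] with w hw j
    rw [← hm j]
    exact hw (m j)
  rcases U.eq_empty_or_nonempty with rfl | hne
  · refine ⟨id, strictMono_id, fun _ => OnePoint.infty, fun K _ hKU ε _ => ?_⟩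
    have : K = ∅ := subset_empty_iff.1 hKU
    simp [this]
  have : Nonempty U := hne.to_subtype
  obtain ⟨d, hd⟩ := TopologicalSpace.exists_dense_seq U
  -- Sequential compactness of a countable power of the sphere replaces the diagonal argument.
  obtain ⟨v, φ, hφ, hv⟩ := CompactSpace.tendsto_subseq (fun j => fun i => G j (d i) : ℕ → ℕ → Sphere)
  have hpt : ∀ i, Tendsto (fun j => G (φ j) (d i)) atTop (𝓝 (v i)) := fun i =>
    (tendsto_pi_nhds.1 hv) i
  have hE : Equicontinuous fun j => U.domRestrict (G (φ j)) :=
    ((equicontinuous_restrict_iff _).2 heq).comp φ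
  -- Equicontinuity spreads convergence from the dense sequence to all of `U`.
  have hlim : ∀ x : U, ∃ y, Tendsto (fun j => G (φ j) x) atTop (𝓝 y) := by
    intro x
    apply cauchySeq_tendsto_of_complete
    rw [Metric.cauchySeq_iff]
    intro ε hε
    have h1 := Metric.equicontinuousAt_iff_right.1 (hE x) (ε / 3) (by positivity)
    obtain ⟨_, hi, i, rfl⟩ := mem_closure_iff_nhds.1 (hd x) _ h1
    have hcs := (hpt i).cauchySeq
    obtain ⟨N, hN⟩ := Metric.cauchySeq_iff.1 hcs (ε / 3) (by positivity)
    refine ⟨N, fun a ha b hb => ?_⟩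
    have e1 : dist (G (φ a) x) (G (φ a) (d i)) < ε / 3 := hi a
    have e2 : dist (G (φ b) x) (G (φ b) (d i)) < ε / 3 := hi b
    have e3 := hN a ha b hb
    rw [dist_comm] at e2
    calc dist (G (φ a) x) (G (φ b) x) ≤ _ := dist_triangle4 _ (G (φ a) (d i)) (G (φ b) (d i)) _
      _ < ε := by linarith
  choose g hg using hlim
  classical
  refine ⟨φ, hφ, fun z => if hz : z ∈ U then g ⟨z, hz⟩ else OnePoint.infty, ?_⟩
  intro K hK hKU ε hε
  have hKc : CompactSpace K := isCompact_iff_compactSpace.1 hK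
  have hEK : Equicontinuous fun j => K.domRestrict (G (φ j)) :=
    ((equicontinuous_restrict_iff _).2 (heq.mono hKU)).comp φ
  have hunif := (hEK.tendsto_uniformFun_iff_pi atTop (fun x : K => g ⟨x, hKU x.2⟩)).2
    (tendsto_pi_nhds.2 fun x => hg ⟨x, hKU x.2⟩)
  rw [UniformFun.tendsto_iff_tendstoUniformly] at hunif
  have hW := setOf_sphDist_lt_mem_nhdsSet hε
  rw [nhdsSet_diagonal_eq_uniformity] at hW
  have hW' := symm_le_uniformity hW
  filter_upwards [hunif _ hW'] with j hj z hz
  rw [dif_pos (hKU hz)]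
  exact hj ⟨z, hz⟩

end MeroDyn

/-! ### Cauchy transforms of planar sets as test functions on the sphere. -/

namespace MeroDyn

open Metric

theorem integrableOn_inv_ball (r : ℝ) : IntegrableOn (fun ζ : ℂ => ζ⁻¹) (ball 0 r) := by
  refine integrableOn_ball_of_norm_le_rpow (C := 1) (α := 1) (by simp) (by simp) ?_
    measurable_inv.aestronglyMeasurable
  exact Eventually.of_forall fun x => by simp [Real.rpow_neg_one]

theorem integrableOn_inv_sub {E : Set ℂ} (hE : Bornology.IsBounded E) (w : ℂ) :
    IntegrableOn (fun ζ : ℂ => (ζ - w)⁻¹) E := by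
  obtain ⟨r, hr⟩ := (hE.sub (Bornology.isBounded_singleton (x := w))).subset_ball 0
  have h1 := (measurePreserving_sub_right (volume : Measure ℂ) w).integrableOn_comp_preimage
    (MeasurableEquiv.subRight w).measurableEmbedding (f := fun ζ : ℂ => ζ⁻¹) (s := ball 0 r)
  refine (h1.2 (integrableOn_inv_ball r)).mono_set ?_
  intro ζ hζ
  exact hr (sub_mem_sub hζ (mem_singleton w))

/-- The Cauchy transform of the indicator of `E`, as a function on the sphere. -/
noncomputable def cauchyTransform (E : Set ℂ) : Sphere → ℂ
  | OnePoint.infty => 0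
  | OnePoint.some w => ∫ ζ in E, (ζ - w)⁻¹

theorem cauchyTransform_coe (E : Set ℂ) (w : ℂ) :
    cauchyTransform E (w : Sphere) = ∫ ζ in E, (ζ - w)⁻¹ := rfl

theorem cauchyTransform_infty (E : Set ℂ) : cauchyTransform E OnePoint.infty = 0 := rfl

/-- A continuous truncation of the Cauchy kernel. -/
noncomputable def truncKernel (ε : ℝ) (ζ : ℂ) : ℂ :=
  starRingEnd ℂ ζ / ((max (‖ζ‖ ^ 2) (ε ^ 2) : ℝ) : ℂ)

theorem continuous_truncKernel {ε : ℝ} (hε : 0 < ε) : Continuous (truncKernel ε) := by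
  unfold truncKernel
  refine Continuous.div (by fun_prop) (by fun_prop) fun ζ => ?_
  have : 0 < max (‖ζ‖ ^ 2) (ε ^ 2) := lt_max_of_lt_right (by positivity)
  exact_mod_cast this.ne'

theorem norm_truncKernel_le {ε : ℝ} (hε : 0 < ε) (ζ : ℂ) : ‖truncKernel ε ζ‖ ≤ ε⁻¹ := by
  have hpos : 0 < max (‖ζ‖ ^ 2) (ε ^ 2) := lt_max_of_lt_right (by positivity)
  rw [truncKernel, norm_div, Complex.norm_real, RCLike.norm_conj, Real.norm_of_nonneg hpos.le,
    div_le_iff₀ hpos, inv_mul_eq_div, le_div_iff₀ hε]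
  rcases le_total ‖ζ‖ ε with h | h
  · exact le_max_of_le_right (by nlinarith)
  · exact le_max_of_le_left (by nlinarith [norm_nonneg ζ])

theorem inv_sub_truncKernel_of_le {ε : ℝ} {ζ : ℂ} (hε : 0 < ε) (h : ε ≤ ‖ζ‖) :
    ζ⁻¹ - truncKernel ε ζ = 0 := by
  rw [truncKernel, max_eq_left (pow_le_pow_left₀ hε.le h 2), Complex.inv_def,
    Complex.normSq_eq_norm_sq, div_eq_mul_inv, Complex.ofReal_inv, sub_self]

theorem norm_inv_sub_truncKernel_le {ε : ℝ} (ζ : ℂ) :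
    ‖ζ⁻¹ - truncKernel ε ζ‖ ≤ ‖ζ⁻¹‖ := by
  rcases eq_or_ne ζ 0 with rfl | h
  · simp [truncKernel]
  have hz : 0 < ‖ζ‖ ^ 2 := by have := norm_pos_iff.2 h; positivity
  set m := max (‖ζ‖ ^ 2) (ε ^ 2) with hm
  have hm1 : ‖ζ‖ ^ 2 ≤ m := le_max_left _ _
  have hm0 : 0 < m := hz.trans_le hm1
  have e : ζ⁻¹ - truncKernel ε ζ = ζ⁻¹ * ((1 - ‖ζ‖ ^ 2 / m : ℝ) : ℂ) := by
    have h3 : ζ * starRingEnd ℂ ζ = (‖ζ‖ : ℂ) ^ 2 := Complex.mul_conj' ζ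
    have hmc : (m : ℂ) ≠ 0 := by exact_mod_cast hm0.ne'
    rw [truncKernel, ← hm]
    push_cast
    rw [← h3]
    field_simp
  rw [e, norm_mul, Complex.norm_real]
  refine mul_le_of_le_one_right (norm_nonneg _) ?_
  rw [Real.norm_eq_abs, abs_le]
  have h1 : ‖ζ‖ ^ 2 / m ≤ 1 := (div_le_one hm0).2 hm1
  have h2 : 0 ≤ ‖ζ‖ ^ 2 / m := by positivity
  constructor <;> linarith

theorem tendsto_setIntegral_norm_inv_ball :
    Tendsto (fun ε : ℝ => ∫ ζ in ball (0 : ℂ) ε, ‖ζ⁻¹‖) (𝓝[>] 0) (𝓝 0) := by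
  have hint : IntegrableOn (fun ζ : ℂ => ‖ζ⁻¹‖) (ball 0 1) := (integrableOn_inv_ball 1).norm
  have hm : Tendsto (fun ε : ℝ => (volume.restrict (ball (0 : ℂ) 1)) (ball (0 : ℂ) ε)) (𝓝[>] 0)
      (𝓝 0) := by
    have h1 : Tendsto (fun ε : ℝ => volume (ball (0 : ℂ) ε)) (𝓝[>] 0) (𝓝 0) := by
      simp only [Complex.volume_ball]
      have : Tendsto (fun ε : ℝ => ENNReal.ofReal ε ^ 2 * NNReal.pi) (𝓝 0)
          (𝓝 (ENNReal.ofReal 0 ^ 2 * NNReal.pi)) := by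
        refine ENNReal.Tendsto.mul_const ?_ (Or.inr ENNReal.coe_ne_top)
        exact (ENNReal.continuous_pow 2).continuousAt.tendsto.comp
          (ENNReal.continuous_ofReal.tendsto 0)
      simpa using this.mono_left nhdsWithin_le_nhds
    exact tendsto_of_tendsto_of_tendsto_of_le_of_le tendsto_const_nhds h1 (fun _ => zero_le)
      fun ε => Measure.restrict_apply_le _ _
  have h := hint.tendsto_setIntegral_nhds_zero hm
  refine h.congr' ?_
  filter_upwards [Ioc_mem_nhdsGT (zero_lt_one : (0 : ℝ) < 1)] with ε hε
  rw [Measure.restrict_restrict measurableSet_ball, inter_eq_self_of_subset_left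
    (ball_subset_ball hε.2)]

/-- The two kernels differ only on `ball w ε`, by at most |ζ - w|⁻¹. The bound does not depend on
`w`, so the truncated transforms converge uniformly and the limit is continuous. -/
theorem norm_cauchyTransform_sub_le {E : Set ℂ} (hE : Bornology.IsBounded E)
    {ε : ℝ} (hε : 0 < ε) (w : ℂ) :
    ‖(∫ ζ in E, (ζ - w)⁻¹) - ∫ ζ in E, truncKernel ε (ζ - w)‖ ≤ ∫ ζ in ball (0 : ℂ) ε, ‖ζ⁻¹‖ := by
  have hfin : volume E < ⊤ := hE.measure_lt_top
  have hE2 : IntegrableOn (fun ζ => truncKernel ε (ζ - w)) E := by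
    refine Measure.integrableOn_of_bounded (M := ε⁻¹) hfin.ne ?_ ?_
    · exact ((continuous_truncKernel hε).comp (continuous_id.sub continuous_const)).aestronglyMeasurable
    · exact Eventually.of_forall fun ζ => norm_truncKernel_le hε _
  rw [← integral_sub (integrableOn_inv_sub hE w) hE2]
  have hball : IntegrableOn (fun ζ : ℂ => ‖(ζ - w)⁻¹‖) (ball w ε) :=
    (integrableOn_inv_sub isBounded_ball w).norm
  calc ‖∫ ζ in E, ((ζ - w)⁻¹ - truncKernel ε (ζ - w))‖
      ≤ ∫ ζ in E, ‖(ζ - w)⁻¹ - truncKernel ε (ζ - w)‖ := norm_integral_le_integral_norm _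
    _ ≤ ∫ ζ in E, (ball w ε).indicator (fun ζ => ‖(ζ - w)⁻¹‖) ζ := by
        refine integral_mono_of_nonneg (Eventually.of_forall fun _ => norm_nonneg _) ?_ ?_
        · exact ((integrable_indicator_iff measurableSet_ball).2 hball).restrict
        · refine Eventually.of_forall fun ζ => ?_
          simp only
          by_cases hζ : ζ ∈ ball w ε
          · rw [indicator_of_mem hζ]; exact norm_inv_sub_truncKernel_le _
          · rw [indicator_of_notMem hζ, inv_sub_truncKernel_of_le hε, norm_zero]
            rwa [mem_ball, dist_eq_norm, not_lt] at hζ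
    _ ≤ ∫ ζ, (ball w ε).indicator (fun ζ => ‖(ζ - w)⁻¹‖) ζ := by
        refine setIntegral_le_integral ((integrable_indicator_iff measurableSet_ball).2 hball) ?_
        exact Eventually.of_forall fun ζ => indicator_nonneg (fun _ _ => norm_nonneg _) _
    _ = ∫ ζ in ball w ε, ‖(ζ - w)⁻¹‖ := integral_indicator measurableSet_ball
    _ = ∫ ζ in ball (0 : ℂ) ε, ‖ζ⁻¹‖ := by
        have := (measurePreserving_sub_right (volume : Measure ℂ) w).setIntegral_preimage_emb
          (MeasurableEquiv.subRight w).measurableEmbedding (fun ζ : ℂ => ‖ζ⁻¹‖) (ball 0 ε)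
        rw [← this]
        congr 2
        ext ζ
        simp [dist_eq_norm]

theorem continuous_integral_truncKernel {E : Set ℂ} (hE : Bornology.IsBounded E) {ε : ℝ}
    (hε : 0 < ε) : Continuous fun w => ∫ ζ in E, truncKernel ε (ζ - w) := by
  have hfin : volume E < ⊤ := hE.measure_lt_top
  have : IsFiniteMeasure (volume.restrict E) := ⟨by simpa using hfin⟩
  refine continuous_of_dominated (bound := fun _ => ε⁻¹) (fun w => ?_) (fun w => ?_)
    (integrable_const _) ?_
  · exact ((continuous_truncKernel hε).comp (continuous_id.sub continuous_const)).aestronglyMeasurable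
  · exact Eventually.of_forall fun ζ => norm_truncKernel_le hε _
  · exact Eventually.of_forall fun ζ => (continuous_truncKernel hε).comp
      (continuous_const.sub continuous_id)

theorem continuous_integral_inv_sub {E : Set ℂ} (hE : Bornology.IsBounded E) :
    Continuous fun w => ∫ ζ in E, (ζ - w)⁻¹ := by
  refine continuous_of_uniform_approx_of_continuous fun W hW => ?_
  obtain ⟨η, hη, hηW⟩ := Metric.mem_uniformity_dist.1 hW
  obtain ⟨ε, hε, hεpos⟩ := ((tendsto_setIntegral_norm_inv_ball.eventually_lt_const hη).and
    self_mem_nhdsWithin).exists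
  refine ⟨_, continuous_integral_truncKernel hE hεpos, fun w => hηW ?_⟩
  rw [dist_eq_norm]
  exact (norm_cauchyTransform_sub_le hE hεpos w).trans_lt hε

theorem continuous_cauchyTransform {E : Set ℂ} (hE : Bornology.IsBounded E) :
    Continuous (cauchyTransform E) := by
  rw [continuous_iff_continuousAt]
  intro x
  induction x using OnePoint.rec with
  | coe w =>
    rw [OnePoint.continuousAt_coe]
    exact (continuous_integral_inv_sub hE).continuousAt
  | infty =>
    rw [OnePoint.continuousAt_infty', cauchyTransform_infty, coclosedCompact_eq_cocompact,
      ← Metric.cobounded_eq_cocompact]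
    obtain ⟨R, hR⟩ := hE.subset_ball 0
    have hlim : Tendsto (fun w : ℂ => (‖w‖ - R)⁻¹ * (volume.real E)) (Bornology.cobounded ℂ)
        (𝓝 0) := by
      have h1 : Tendsto (fun w : ℂ => ‖w‖ - R) (Bornology.cobounded ℂ) atTop :=
        tendsto_atTop_add_const_right _ (-R) tendsto_norm_cobounded_atTop
      simpa using (tendsto_inv_atTop_zero.comp h1).mul_const (volume.real E)
    refine squeeze_zero_norm' ?_ hlim
    filter_upwards [tendsto_norm_cobounded_atTop.eventually_gt_atTop R] with w hw
    refine norm_setIntegral_le_of_norm_le_const hE.measure_lt_top fun ζ hζ => ?_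
    have hζR : ‖ζ‖ < R := by simpa using hR hζ
    rw [norm_inv]
    refine inv_anti₀ (by linarith) ?_
    have := norm_sub_norm_le w ζ
    rw [norm_sub_rev]
    linarith

theorem differentiableAt_integral_inv_sub {E K : Set ℂ} (hK : IsCompact K) (hEK : E ⊆ K)
    (hEm : MeasurableSet E) {w : ℂ} (hw : w ∉ K) :
    DifferentiableAt ℂ (fun w => ∫ ζ in E, (ζ - w)⁻¹) w := by
  have hE : Bornology.IsBounded E := hK.isBounded.subset hEK
  have hfin : volume E < ⊤ := hE.measure_lt_top
  have : IsFiniteMeasure (volume.restrict E) := ⟨by simpa using hfin⟩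
  obtain ⟨r, hr, hball⟩ := Metric.isOpen_iff.1 hK.isClosed.isOpen_compl w hw
  have hfar : ∀ ζ ∈ E, ∀ x ∈ ball w (r / 2), r / 2 ≤ ‖ζ - x‖ := by
    intro ζ hζ x hx
    by_contra hlt
    push Not at hlt
    refine hball (show ζ ∈ ball w r from ?_) (hEK hζ)
    rw [mem_ball, dist_eq_norm] at hx ⊢
    calc ‖ζ - w‖ = ‖(ζ - x) + (x - w)‖ := by ring_nf
      _ ≤ ‖ζ - x‖ + ‖x - w‖ := norm_add_le _ _
      _ < r := by linarith
  have hne : ∀ ζ ∈ E, ∀ x ∈ ball w (r / 2), ζ - x ≠ 0 := fun ζ hζ x hx h0 => by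
    have := hfar ζ hζ x hx
    rw [h0, norm_zero] at this
    linarith
  refine (hasDerivAt_integral_of_dominated_loc_of_deriv_le (μ := volume.restrict E)
    (F := fun w ζ => (ζ - w)⁻¹) (F' := fun w ζ => ((ζ - w) ^ 2)⁻¹)
    (bound := fun _ => ((r / 2) ^ 2)⁻¹) (ball_mem_nhds w (half_pos hr)) ?_
    (integrableOn_inv_sub hE w) ?_ ?_ (integrable_const _) ?_).2.differentiableAt
  · exact Eventually.of_forall fun x => (integrableOn_inv_sub hE x).aestronglyMeasurable
  · exact (by fun_prop : Measurable fun ζ : ℂ => ((ζ - w) ^ 2)⁻¹).aestronglyMeasurable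
  · refine (ae_restrict_iff' hEm).2 (Eventually.of_forall fun ζ hζ x hx => ?_)
    rw [norm_inv, norm_pow]
    exact inv_anti₀ (by positivity) (pow_le_pow_left₀ (by positivity) (hfar ζ hζ x hx) 2)
  · refine (ae_restrict_iff' hEm).2 (Eventually.of_forall fun ζ hζ x hx => ?_)
    have := ((hasDerivAt_id x).const_sub ζ).inv (hne ζ hζ x hx)
    exact this.congr_deriv (by simp)

theorem MeroAt.exists_analyticAt {F : ℂ → Sphere} {u : ℂ} (hF : MeroAt F u)
    (h : F u ≠ OnePoint.infty) :
    ∃ g : ℂ → ℂ, AnalyticAt ℂ g u ∧ ∀ᶠ w in 𝓝 u, F w = ((g w : ℂ) : Sphere) := by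
  obtain ⟨Q, hQ⟩ := exists_coe_ne (F u)
  have hne : ∀ x : Sphere, x ≠ (Q : Sphere) → x ≠ OnePoint.infty →
      tau Q x ≠ 0 ∧ x = ((Q + (tau Q x)⁻¹ : ℂ) : Sphere) := by
    intro x hx hx'
    have h0 : tau Q x ≠ 0 := by
      intro h0
      apply hx'
      rw [← iota_tau hx, h0, iota_zero]
    exact ⟨h0, by rw [← iota_of_ne Q h0, iota_tau hx]⟩
  refine ⟨fun w => Q + (tau Q (F w))⁻¹, analyticAt_const.add ((hF.2 Q hQ).inv (hne _ hQ h).1), ?_⟩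
  filter_upwards [hF.1.eventually_ne hQ, hF.1.eventually_ne h] with w h1 h2
  exact (hne _ h1 h2).2

/-- Where `F` is finite it avoids `K`, and one may differentiate under the integral. Poles of `F`
are isolated, or `F` is locally `∞`; isolated ones are removable because the transform is continuous
on the whole sphere. -/
theorem MeroAt.analyticAt_cauchyTransform {E K : Set ℂ} (hK : IsCompact K) (hEK : E ⊆ K)
    (hEm : MeasurableSet E) {F : ℂ → Sphere} {u : ℂ} (hF : ∀ᶠ w in 𝓝 u, MeroAt F w)
    (hFK : ∀ᶠ w in 𝓝 u, ∀ ζ ∈ K, F w ≠ (ζ : Sphere)) :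
    AnalyticAt ℂ (fun w => cauchyTransform E (F w)) u := by
  have hE : Bornology.IsBounded E := hK.isBounded.subset hEK
  have hfinite : ∀ w, MeroAt F w → (∀ ζ ∈ K, F w ≠ (ζ : Sphere)) → F w ≠ OnePoint.infty →
      DifferentiableAt ℂ (fun w => cauchyTransform E (F w)) w := by
    intro w hw hwK hwi
    obtain ⟨g, hg, hFg⟩ := hw.exists_analyticAt hwi
    have hgK : g w ∉ K := fun hgK => hwK _ hgK hFg.self_of_nhds
    have h1 : DifferentiableAt ℂ (fun w => ∫ ζ in E, (ζ - g w)⁻¹) w :=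
      (differentiableAt_integral_inv_sub hK hEK hEm hgK).comp w hg.differentiableAt
    refine h1.congr_of_eventuallyEq ?_
    filter_upwards [hFg] with x hx
    rw [hx, cauchyTransform_coe]
  have hFu := hF.self_of_nhds
  have hcont : ContinuousAt (fun w => cauchyTransform E (F w)) u :=
    (continuous_cauchyTransform hE).continuousAt.comp hFu.1
  refine Complex.analyticAt_of_differentiable_on_punctured_nhds_of_continuousAt ?_ hcont
  by_cases hui : F u = OnePoint.infty
  · have h0 : F u ≠ ((0 : ℂ) : Sphere) := by rw [hui]; exact OnePoint.infty_ne_coe 0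
    rcases (hFu.2 0 h0).eventually_eq_zero_or_eventually_ne_zero with hz | hz
    · have hconst : ∀ᶠ w in 𝓝 u, F w = OnePoint.infty := by
        filter_upwards [hz, hFu.1.eventually_ne h0] with w hw hw0
        rw [← iota_tau hw0, hw, iota_zero]
      refine Eventually.filter_mono nhdsWithin_le_nhds ?_
      filter_upwards [hconst.eventually_nhds] with w hw
      refine (differentiableAt_const (0 : ℂ)).congr_of_eventuallyEq ?_
      filter_upwards [hw] with x hx
      rw [hx, cauchyTransform_infty]
    · filter_upwards [hz, nhdsWithin_le_nhds hF, nhdsWithin_le_nhds hFK] with w hw h1 h2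
      refine hfinite w h1 h2 fun hwi => hw ?_
      rw [hwi, tau_infty]
  · refine Eventually.filter_mono nhdsWithin_le_nhds ?_
    filter_upwards [hF, hFK, hFu.1.eventually_ne hui] with w h1 h2 h3 using hfinite w h1 h2 h3

/-- Cauchy transforms of subsets of a set of positive area separate the points of the sphere. -/
theorem exists_cauchyTransform_ne {K : Set ℂ} (hK : IsCompact K) (hpos : 0 < volume K)
    {x y : Sphere} (hxy : x ≠ y) :
    ∃ E : {E : Set ℂ // MeasurableSet E ∧ E ⊆ K},
      cauchyTransform E.1 x ≠ cauchyTransform E.1 y := by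
  by_contra! hall
  have hrep : ∀ x : Sphere, ∃ k : ℂ → ℂ, IntegrableOn k K ∧
      (∀ E : Set ℂ, cauchyTransform E x = ∫ ζ in E, k ζ) ∧
      ((x = OnePoint.infty ∧ k = 0) ∨ ∃ w : ℂ, x = (w : Sphere) ∧ k = fun ζ => (ζ - w)⁻¹) := by
    intro x
    induction x using OnePoint.rec with
    | infty => exact ⟨0, integrableOn_zero, fun E => by simp [cauchyTransform_infty],
        Or.inl ⟨rfl, rfl⟩⟩
    | coe w => exact ⟨fun ζ => (ζ - w)⁻¹, integrableOn_inv_sub hK.isBounded w, fun E => rfl,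
        Or.inr ⟨w, rfl, rfl⟩⟩
  obtain ⟨k, hk, hkE, hk'⟩ := hrep x
  obtain ⟨l, hl, hlE, hl'⟩ := hrep y
  -- Equal integrals over all measurable subsets of `K` force the kernels to agree almost everywhere
  -- on `K`. Kernels of distinct points agree at no more than one ζ, which contradicts positive
  -- area.
  have hz : (fun ζ => k ζ - l ζ) =ᵐ[volume.restrict K] 0 := by
    refine Integrable.ae_eq_zero_of_forall_setIntegral_eq_zero (hk.sub hl) fun s hs _ => ?_
    rw [Measure.restrict_restrict hs,
      integral_sub (hk.mono_set inter_subset_right) (hl.mono_set inter_subset_right),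
      ← hkE, ← hlE, sub_eq_zero]
    exact hall ⟨s ∩ K, hs.inter hK.measurableSet, inter_subset_right⟩
  have hfin : ∀ᵐ ζ ∂(volume.restrict K), False := by
    have hne : ∀ w : ℂ, ∀ᵐ ζ ∂(volume.restrict K), ζ ≠ w := fun w =>
      ae_restrict_of_ae (by simp [ae_iff, measure_singleton])
    rcases hk' with ⟨rfl, rfl⟩ | ⟨a, rfl, rfl⟩ <;> rcases hl' with ⟨rfl, rfl⟩ | ⟨b, rfl, rfl⟩
    · exact absurd rfl hxy
    · filter_upwards [hz, hne b] with ζ h1 h2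
      simp at h1
      exact h2 (sub_eq_zero.1 h1)
    · filter_upwards [hz, hne a] with ζ h1 h2
      simp at h1
      exact h2 (sub_eq_zero.1 h1)
    · filter_upwards [hz] with ζ h1
      have h2 : (ζ - a)⁻¹ = (ζ - b)⁻¹ := sub_eq_zero.1 h1
      have h3 := inv_injective h2
      exact hxy (by rw [sub_right_injective h3])
  rw [ae_iff] at hfin
  simp at hfin
  exact hpos.ne' hfin

end MeroDyn

/-! ### Two criteria for membership in the Fatou set. -/

namespace MeroDyn

open Metric

variable {f : ℂ → Sphere}

theorem mem_fatouSet_of_sphEquicontAt {U : Set ℂ} (hU : IsOpen U) {z : ℂ} (hz : z ∈ U)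
    (hd : ∀ n, ∀ w ∈ U, IterDefined f n (w : Sphere))
    (he : ∀ w ∈ U, SphEquicontAt (fun n (u : ℂ) => (sphMap f)^[n] (u : Sphere)) w) :
    z ∈ fatouSet f :=
  ⟨U, hU, hz, _, fun n w hw => iter_eq_some_iff.2 ⟨hd n w hw, rfl⟩, isNormalOn_of_sphEquicontAt he⟩

theorem exists_norm_cauchyTransform_le {E : Set ℂ} (hE : Bornology.IsBounded E) :
    ∃ C, ∀ x, ‖cauchyTransform E x‖ ≤ C := by
  obtain ⟨C, hC⟩ := (isCompact_range (continuous_cauchyTransform hE)).isBounded.exists_norm_le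
  exact ⟨C, fun x => hC _ (mem_range_self x)⟩

/-- A meromorphic function that omits a set of positive area near `∞` has a limit at `∞`. -/
theorem exists_tendsto_of_omits (hf : IsMeromorphic f) {K : Set ℂ} (hK : IsCompact K)
    (hpos : 0 < volume K)
    (h : ∀ᶠ w in Bornology.cobounded ℂ, ∀ ζ ∈ K, f w ≠ (ζ : Sphere)) :
    ∃ a : Sphere, Tendsto f (cocompact ℂ) (𝓝 a) := by
  -- Each Cauchy transform of `f` is bounded and holomorphic near `∞`, so Riemann's removable
  -- singularity theorem provides a limit.
  have hlim : ∀ E : {E : Set ℂ // MeasurableSet E ∧ E ⊆ K}, ∃ l : ℂ,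
      Tendsto (fun w => cauchyTransform E.1 (f w)) (Bornology.cobounded ℂ) (𝓝 l) := by
    rintro ⟨E, hEm, hEK⟩
    have hEb := hK.isBounded.subset hEK
    obtain ⟨C, hC⟩ := exists_norm_cauchyTransform_le hEb
    have hev : ∀ᶠ w in Bornology.cobounded ℂ,
        DifferentiableAt ℂ (fun w => cauchyTransform E (f w)) w := by
      obtain ⟨R, -, hR⟩ := (Metric.hasBasis_cobounded_compl_closedBall (0 : ℂ)).mem_iff.1 h
      filter_upwards [(Metric.hasBasis_cobounded_compl_closedBall (0 : ℂ)).mem_of_mem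
        (i := R) trivial] with w hw
      refine (MeroAt.analyticAt_cauchyTransform hK hEK hEm
        (Eventually.of_forall fun w => hf.meroAt w) ?_).differentiableAt
      filter_upwards [isClosed_closedBall.isOpen_compl.mem_nhds hw] with x hx using hR hx
    have hd : ∀ᶠ s in 𝓝[≠] (0 : ℂ), DifferentiableAt ℂ (fun s => cauchyTransform E (f s⁻¹)) s := by
      filter_upwards [tendsto_inv₀_nhdsNE_zero.eventually hev, self_mem_nhdsWithin] with s hs hs0
      exact hs.comp s (differentiableAt_inv hs0)
    have hb : IsBoundedUnder (· ≤ ·) (𝓝[≠] (0 : ℂ))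
        fun s => ‖cauchyTransform E (f s⁻¹) - cauchyTransform E (f (0 : ℂ)⁻¹)‖ :=
      isBoundedUnder_of ⟨C + C, fun s => (norm_sub_le _ _).trans (add_le_add (hC _) (hC _))⟩
    have ht := Complex.tendsto_limUnder_of_differentiable_on_punctured_nhds_of_bounded_under hd hb
    refine ⟨_, (ht.comp tendsto_inv₀_cobounded').congr fun w => ?_⟩
    simp
  choose l hl using hlim
  -- All cluster values of `f` at `∞` have the same Cauchy transforms, hence coincide; compactness
  -- of the sphere turns this into convergence.
  have hcl : ∀ x, ClusterPt x (map f (Bornology.cobounded ℂ)) → ∀ E, cauchyTransform E.1 x = l E := by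
    intro x hx E
    have hcont := continuous_cauchyTransform (hK.isBounded.subset E.2.2)
    have h1 : ClusterPt (cauchyTransform E.1 x)
        (map (cauchyTransform E.1) (map f (Bornology.cobounded ℂ))) :=
      hx.map hcont.continuousAt tendsto_map
    exact eq_of_nhds_neBot (h1.mono (hl E))
  obtain ⟨a, ha⟩ := exists_clusterPt_of_compactSpace (map f (Bornology.cobounded ℂ))
  refine ⟨a, ?_⟩
  rw [← Metric.cobounded_eq_cocompact]
  refine le_nhds_of_unique_clusterPt fun x hx => ?_
  by_contra hne
  obtain ⟨E, hE⟩ := exists_cauchyTransform_ne hK hpos hne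
  exact hE ((hcl x hx E).trans (hcl a ha E).symm)

/-- A version of Montel's theorem: if all but finitely many iterates omit a fixed set of positive
area near `z`, then `z` is in the Fatou set. -/
theorem mem_fatouSet_of_omits (hf : IsMeromorphic f) (hconst : ¬ IsConst f) {z : ℂ}
    (hz : ∀ n, IterDefined f n (z : Sphere)) {U : Set ℂ} (hU : IsOpen U) (hzU : z ∈ U)
    {K : Set ℂ} (hK : IsCompact K) (hpos : 0 < volume K) {N : ℕ}
    (h : ∀ n ≥ N, ∀ u ∈ U, IterDefined f n (u : Sphere) →
      ∀ ζ ∈ K, (sphMap f)^[n] (u : Sphere) ≠ (ζ : Sphere)) :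
    z ∈ fatouSet f := by
  set V : Set ℂ := U ∩ (↑) ⁻¹' {x | IterDefined f N x} with hV
  have hVo : IsOpen V := hU.inter ((isOpen_iterDefined hf N).preimage OnePoint.continuous_coe)
  -- An iterate can first fail to be defined only after reaching `∞` when `f` has no limit there.
  -- But `fⁿ` is open at `u`, so every finite point near `∞` is some `fⁿ v` with `v ∈ U`, and its
  -- image under `f` avoids `K`; then `f` does have a limit.
  have hdef : ∀ n, ∀ u ∈ V, IterDefined f n (u : Sphere) := by
    intro n u hu
    induction n with
    | zero => intro k hk; omega
    | succ n ih =>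
      rcases lt_or_ge n N with hn | hn
      · exact IterDefined.mono hu.2 hn
      rw [iterDefined_succ]
      refine ⟨ih, ?_⟩
      by_contra hnd
      have hinf : (sphMap f)^[n] (u : Sphere) = OnePoint.infty := by
        by_contra hne
        obtain ⟨y, hy⟩ := OnePoint.ne_infty_iff_exists.1 hne
        exact hnd (hy ▸ coe_mem_sphDom y)
      rw [hinf] at hnd
      apply hnd
      rw [infty_mem_sphDom_iff]
      refine exists_tendsto_of_omits hf hK hpos ?_
      have hW : ((↑) '' U ∩ {x | IterDefined f n x} : Set Sphere) ∈ 𝓝 (u : Sphere) :=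
        inter_mem ((OnePoint.isOpen_image_coe.2 hU).mem_nhds (mem_image_of_mem _ hu.1))
          ((isOpen_iterDefined hf n).mem_nhds ih)
      have himg := nhds_le_map_iterate hf hconst ih (image_mem_map hW)
      rw [hinf] at himg
      filter_upwards [tendsto_coe_cobounded himg] with w hw ζ hζ
      obtain ⟨_, ⟨⟨v, hv, rfl⟩, hvd⟩, hvw⟩ := hw
      have := h (n + 1) (by omega) v hv (iterDefined_succ.2 ⟨hvd, hvw ▸ coe_mem_sphDom w⟩) ζ hζ
      rwa [Function.iterate_succ_apply', hvw, sphMap_coe] at this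
  have hmero : ∀ n, ∀ u ∈ V, MeroAt (fun w : ℂ => (sphMap f)^[n] (w : Sphere)) u := fun n u hu =>
    (meroAt_coe u).iterate_comp hf (hdef n u hu)
  refine mem_fatouSet_of_sphEquicontAt hVo ⟨hzU, hz N⟩ hdef fun w hw => ?_
  refine SphEquicontAt.of_tail (N := N) (fun n _ => (hmero n w hw).1) ?_
  refine sphEquicontAt_of_separating
    (H := fun E : {E : Set ℂ // MeasurableSet E ∧ E ⊆ K} => cauchyTransform E.1)
    (fun E => continuous_cauchyTransform (hK.isBounded.subset E.2.2))
    (fun x y hxy => exists_cauchyTransform_ne hK hpos hxy) ?_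
  rintro ⟨E, hEm, hEK⟩ ε hε
  obtain ⟨C, hC⟩ := exists_norm_cauchyTransform_le (hK.isBounded.subset hEK)
  obtain ⟨r, hr, hball⟩ := Metric.isOpen_iff.1 hVo w hw
  have := eventually_dist_lt_of_bounded (C := C) hr
    (b := fun n u => cauchyTransform E ((sphMap f)^[n + N] (u : Sphere)))
    (fun n u hu => (MeroAt.analyticAt_cauchyTransform hK hEK hEm
      (by filter_upwards [hVo.mem_nhds (hball hu)] with x hx using hmero _ x hx)
      (by filter_upwards [hVo.mem_nhds (hball hu)] with x hx using
            h _ (by omega) x hx.1 (hdef _ x hx))).differentiableAt.differentiableWithinAt)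
    (fun n u _ => hC _) hε
  filter_upwards [this] with u hu n
  rw [← dist_eq_norm, dist_comm]
  exact hu n

/-- A Harnack inequality. The weak Koebe theorem with omitted value 0, on disks of radius `r / 2`,
bounds the logarithmic derivative by 48/r; integrating over a length of at most `r / 2` gives 24. -/
theorem norm_le_of_injOn_of_ne_zero {k : ℂ → ℂ} {z : ℂ} {r : ℝ}
    (hk : DifferentiableOn ℂ k (ball z r)) (hi : InjOn k (ball z r))
    (h0 : ∀ w ∈ ball z r, k w ≠ 0) {w : ℂ} (hw : w ∈ ball z (r / 2)) :
    ‖k w‖ ≤ Real.exp 24 * ‖k z‖ ∧ ‖k z‖ ≤ Real.exp 24 * ‖k w‖ := by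
  have hr : 0 < r := by have := pos_of_mem_ball hw; linarith
  have hsub : ball z (r / 2) ⊆ ball z r := ball_subset_ball (by linarith)
  obtain ⟨L, hL, hLk⟩ := exists_log_on_ball hk h0
  have hbound : ∀ x ∈ ball z (r / 2), ‖deriv k x / k x‖ ≤ 48 / r := by
    intro x hx
    have hsubx : ball x (r / 2) ⊆ ball z r := fun y hy => by
      rw [mem_ball] at *
      calc dist y z ≤ dist y x + dist x z := dist_triangle _ _ _
        _ < r := by linarith
    have := norm_deriv_mul_le_of_omits (half_pos hr) (hk.mono hsubx) (hi.mono hsubx)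
      (a := 0) fun y hy => h0 y (hsubx hy)
    rw [sub_zero] at this
    have hkx : 0 < ‖k x‖ := norm_pos_iff.2 (h0 x (hsub hx))
    rw [norm_div, div_le_div_iff₀ hkx hr]
    linarith
  have hz : z ∈ ball z (r / 2) := mem_ball_self (by linarith)
  have hLw : ‖L w - L z‖ ≤ 24 := by
    have h1 := (convex_ball z (r / 2)).norm_image_sub_le_of_norm_hasDerivWithin_le
      (fun x hx => (hL x (hsub hx)).hasDerivWithinAt) hbound hz hw
    have h2 : ‖w - z‖ ≤ r / 2 := by
      rw [← dist_eq_norm]; exact (mem_ball.1 hw).le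
    calc ‖L w - L z‖ ≤ 48 / r * ‖w - z‖ := h1
      _ ≤ 48 / r * (r / 2) := by gcongr
      _ = 24 := by field_simp; norm_num
  have key : ∀ x y, x ∈ ball z r → y ∈ ball z r → ‖L x - L y‖ ≤ 24 →
      ‖k x‖ ≤ Real.exp 24 * ‖k y‖ := by
    intro x y hx hy hxy
    rw [← hLk x hx, ← hLk y hy, Complex.norm_exp, Complex.norm_exp, ← Real.exp_add,
      Real.exp_le_exp]
    have := (le_abs_self _).trans ((Complex.abs_re_le_norm (L x - L y)).trans hxy)
    rw [Complex.sub_re] at this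
    linarith
  exact ⟨key w z (hsub hw) (hsub hz) hLw, key z w (hsub hz) (hsub hw) (by rwa [norm_sub_rev])⟩

theorem injOn_tau (Q : ℂ) : InjOn (tau Q) {x | x ≠ (Q : Sphere)} := fun x hx y hy h => by
  rw [← iota_tau hx, h, iota_tau hy]

/-- Change of coordinate between the two omitted points: `(P - Q)⁻¹` is the value of `tau Q` at `P`,
so the difference is zero-free away from `P`, and `tau P` is affine in its reciprocal. -/
theorem tau_eq_of_ne {P Q : ℂ} {x : Sphere} (hP : x ≠ (P : Sphere)) (hQ : x ≠ (Q : Sphere))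
    (hPQ : P ≠ Q) : tau Q x - (P - Q)⁻¹ ≠ 0 ∧
      tau P x = -(P - Q)⁻¹ - (P - Q)⁻¹ ^ 2 * (tau Q x - (P - Q)⁻¹)⁻¹ := by
  have h0 : P - Q ≠ 0 := sub_ne_zero.2 hPQ
  induction x using OnePoint.rec with
  | infty =>
    refine ⟨by simpa using h0, ?_⟩
    rw [tau_infty, tau_infty]
    field_simp
    ring
  | coe w =>
    have h1 : w - P ≠ 0 := fun h => hP (by rw [sub_eq_zero.1 h])
    have h2 : w - Q ≠ 0 := fun h => hQ (by rw [sub_eq_zero.1 h])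
    rw [tau_coe, tau_coe]
    have e : (w - Q)⁻¹ - (P - Q)⁻¹ = -(w - P) / ((w - Q) * (P - Q)) := by
      field_simp; ring
    rw [e]
    refine ⟨div_ne_zero (neg_ne_zero.2 h1) (mul_ne_zero h2 h0), ?_⟩
    field_simp
    ring

/-- The function `k` below is univalent and zero-free, so it has comparable size on the half disk.
If it is small at the centre the coordinate at `Q` is bounded, otherwise its reciprocal, and with it
the coordinate at `P`, is. The bound depends only on `m`. -/
theorem exists_norm_tau_le_of_injOn {F : ℂ → Sphere} {z P Q : ℂ} {r m : ℝ} (hr : 0 < r)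
    (hF : ∀ w ∈ ball z r, MeroAt F w) (hi : InjOn F (ball z r))
    (hP : ∀ w ∈ ball z r, F w ≠ (P : Sphere)) (hQ : ∀ w ∈ ball z r, F w ≠ (Q : Sphere))
    (hPQ : P ≠ Q) (hm : ‖(P - Q)⁻¹‖ ≤ m) :
    ∃ R, (R = P ∨ R = Q) ∧ ∀ w ∈ ball z (r / 2),
      ‖tau R (F w)‖ ≤ m + (1 + m ^ 2) * Real.exp 24 := by
  have hm0 : 0 ≤ m := (norm_nonneg _).trans hm
  have hexp := Real.exp_pos 24
  set k : ℂ → ℂ := fun w => tau Q (F w) - (P - Q)⁻¹ with hk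
  have hsub : ball z (r / 2) ⊆ ball z r := ball_subset_ball (by linarith)
  have hkd : DifferentiableOn ℂ k (ball z r) := fun w hw =>
    (((hF w hw).2 Q (hQ w hw)).sub analyticAt_const).differentiableAt.differentiableWithinAt
  have hki : InjOn k (ball z r) := fun x hx y hy hxy =>
    hi hx hy (injOn_tau Q (hQ x hx) (hQ y hy) (sub_left_injective hxy))
  have hk0 : ∀ w ∈ ball z r, k w ≠ 0 := fun w hw => (tau_eq_of_ne (hP w hw) (hQ w hw) hPQ).1
  rcases le_or_gt ‖k z‖ 1 with h | h
  · refine ⟨Q, Or.inr rfl, fun w hw => ?_⟩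
    have h1 := (norm_le_of_injOn_of_ne_zero hkd hki hk0 hw).1
    calc ‖tau Q (F w)‖ = ‖k w + (P - Q)⁻¹‖ := by simp [hk]
      _ ≤ ‖k w‖ + ‖(P - Q)⁻¹‖ := norm_add_le _ _
      _ ≤ m + (1 + m ^ 2) * Real.exp 24 := by nlinarith [mul_nonneg (sq_nonneg m) hexp.le]
  · refine ⟨P, Or.inl rfl, fun w hw => ?_⟩
    have h1 := (norm_le_of_injOn_of_ne_zero hkd hki hk0 hw).2
    have hkw : 0 < ‖k w‖ := norm_pos_iff.2 (hk0 w (hsub hw))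
    have h2 : ‖(k w)⁻¹‖ ≤ Real.exp 24 := by
      rw [norm_inv, inv_le_iff_one_le_mul₀ hkw]
      linarith
    rw [(tau_eq_of_ne (hP w (hsub hw)) (hQ w (hsub hw)) hPQ).2]
    calc ‖-(P - Q)⁻¹ - (P - Q)⁻¹ ^ 2 * (k w)⁻¹‖ ≤ ‖(P - Q)⁻¹‖ + ‖(P - Q)⁻¹‖ ^ 2 * ‖(k w)⁻¹‖ := by
          refine (norm_sub_le _ _).trans ?_
          rw [norm_neg, norm_mul, norm_pow]
      _ ≤ m + m ^ 2 * Real.exp 24 := by gcongr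
      _ ≤ m + (1 + m ^ 2) * Real.exp 24 := by nlinarith

/-- Openness of `f` near `a` and `b` gives further coincidences of values. If `fⁿ⁺¹` is injective on
a set, then `fⁿ` omits there a point of each pair; disjointness of the pairs makes the two omitted
points distinct. -/
theorem exists_two_pairs (hf : IsMeromorphic f) (hconst : ¬ IsConst f)
    (hni : ¬ Function.Injective f) :
    ∃ a b a' b' : ℂ, f a = f b ∧ f a' = f b' ∧ a ≠ b ∧ a' ≠ b' ∧
      a ≠ a' ∧ a ≠ b' ∧ b ≠ a' ∧ b ≠ b' := by
  obtain ⟨a, b, hab, hne⟩ : ∃ a b, f a = f b ∧ a ≠ b := by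
    simpa [Function.Injective] using hni
  obtain ⟨U, V, hU, hV, haU, hbV, hUV⟩ := t2_separation hne
  have hopen : ∀ z : ℂ, 𝓝 (f z) ≤ map f (𝓝 z) := fun z =>
    (hf.meroAt z).nhds_le_map_nhds (not_eventually_const hf hconst z (f z))
  have h1 : f '' U ∈ 𝓝 (f a) := hopen a (image_mem_map (hU.mem_nhds haU))
  have h2 : f '' V ∈ 𝓝 (f a) := hab ▸ hopen b (image_mem_map (hV.mem_nhds hbV))
  have h3 : ∃ y, y ∈ f '' U ∩ f '' V ∧ y ≠ f a := by
    have : (f '' U ∩ f '' V) ∩ {f a}ᶜ ∈ 𝓝[≠] (f a) :=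
      inter_mem (nhdsWithin_le_nhds (inter_mem h1 h2)) self_mem_nhdsWithin
    obtain ⟨y, hy⟩ := Filter.nonempty_of_mem this
    exact ⟨y, hy.1, hy.2⟩
  obtain ⟨y, ⟨⟨a', ha', rfl⟩, ⟨b', hb', hab'⟩⟩, hya⟩ := h3
  refine ⟨a, b, a', b', hab, hab'.symm, hne, ?_, ?_, ?_, ?_, ?_⟩
  · rintro rfl; exact disjoint_left.1 hUV ha' hb'
  · rintro rfl; exact hya rfl
  · rintro rfl; exact hya hab'.symm
  · rintro rfl; exact hya hab.symm
  · rintro rfl; exact hya (hab'.symm.trans hab.symm)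

theorem not_mem_image_or_of_injOn {n : ℕ} {B : Set Sphere} (hi : InjOn (sphMap f)^[n + 1] B)
    {a b : ℂ} (hab : f a = f b) (hne : a ≠ b) :
    ∃ Q, (Q = a ∨ Q = b) ∧ ∀ x ∈ B, (sphMap f)^[n] x ≠ (Q : Sphere) := by
  by_contra! hcon
  obtain ⟨x, hx, hxa⟩ := hcon a (Or.inl rfl)
  obtain ⟨y, hy, hyb⟩ := hcon b (Or.inr rfl)
  have hxy : x = y := hi hx hy (by
    rw [Function.iterate_succ_apply', Function.iterate_succ_apply', hxa, hyb, sphMap_coe,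
      sphMap_coe, hab])
  subst hxy
  exact hne (OnePoint.coe_injective (hxa.symm.trans hyb))

/-- If all iterates of a non-injective function are defined and injective on a disk, then the
center of the disk is in the Fatou set. -/
theorem mem_fatouSet_of_injOn (hf : IsMeromorphic f) (hconst : ¬ IsConst f)
    (hni : ¬ Function.Injective f) {z : ℂ} {r : ℝ} (hr : 0 < r)
    (hd : ∀ n, ∀ w ∈ ball z r, IterDefined f n (w : Sphere))
    (hi : ∀ n, InjOn (sphMap f)^[n] ((↑) '' ball z r)) : z ∈ fatouSet f := by
  obtain ⟨a, b, a', b', hab, hab', h1, h2, h3, h4, h5, h6⟩ := exists_two_pairs hf hconst hni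
  -- One constant covering all four possible pairs of omitted points, so that the bounds are uniform
  -- in `n`.
  set m : ℝ := ‖(a - a')⁻¹‖ + ‖(a - b')⁻¹‖ + ‖(b - a')⁻¹‖ + ‖(b - b')⁻¹‖ with hm
  have hfac : ∀ n, ∃ R : ({a, b, a', b'} : Set ℂ), (∀ w ∈ ball z r,
      (sphMap f)^[n] (w : Sphere) ≠ ((R : ℂ) : Sphere)) ∧ ∀ w ∈ ball z (r / 2),
      ‖tau R ((sphMap f)^[n] (w : Sphere))‖ ≤ m + (1 + m ^ 2) * Real.exp 24 := by
    intro n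
    obtain ⟨P, hP, hPo⟩ := not_mem_image_or_of_injOn (hi (n + 1)) hab h1
    obtain ⟨Q, hQ, hQo⟩ := not_mem_image_or_of_injOn (hi (n + 1)) hab' h2
    have hPQ : P ≠ Q := by
      rcases hP with rfl | rfl <;> rcases hQ with rfl | rfl <;> assumption
    have hPQm : ‖(P - Q)⁻¹‖ ≤ m := by
      have n1 := norm_nonneg (a - a')⁻¹
      have n2 := norm_nonneg (a - b')⁻¹
      have n3 := norm_nonneg (b - a')⁻¹
      have n4 := norm_nonneg (b - b')⁻¹
      rcases hP with rfl | rfl <;> rcases hQ with rfl | rfl <;> linarith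
    have hPo' : ∀ w ∈ ball z r, (sphMap f)^[n] (w : Sphere) ≠ (P : Sphere) := fun w hw =>
      hPo _ (mem_image_of_mem _ hw)
    have hQo' : ∀ w ∈ ball z r, (sphMap f)^[n] (w : Sphere) ≠ (Q : Sphere) := fun w hw =>
      hQo _ (mem_image_of_mem _ hw)
    obtain ⟨R, hR, hRb⟩ := exists_norm_tau_le_of_injOn hr
      (F := fun w : ℂ => (sphMap f)^[n] (w : Sphere))
      (fun w hw => (meroAt_coe w).iterate_comp hf (hd n w hw))
      (fun x hx y hy hxy => OnePoint.coe_injective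
        (hi n (mem_image_of_mem _ hx) (mem_image_of_mem _ hy) hxy)) hPo' hQo' hPQ hPQm
    refine ⟨⟨R, ?_⟩, ?_, hRb⟩
    · rcases hR with rfl | rfl
      · rcases hP with rfl | rfl <;> simp
      · rcases hQ with rfl | rfl <;> simp
    · rcases hR with rfl | rfl
      · exact hPo'
      · exact hQo'
  choose R hRo hRb using hfac
  have hsub : ball z (r / 4) ⊆ ball z r := ball_subset_ball (by linarith)
  refine mem_fatouSet_of_sphEquicontAt (isOpen_ball (x := z) (ε := r / 4))
    (mem_ball_self (by linarith)) (fun n w hw => hd n w (hsub hw)) fun w hw => ?_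
  have hsubw : ball w (r / 4) ⊆ ball z (r / 2) := fun y hy => by
    rw [mem_ball] at *
    calc dist y z ≤ dist y w + dist w z := dist_triangle _ _ _
      _ < r / 2 := by linarith
  have hsub2 : ball z (r / 2) ⊆ ball z r := ball_subset_ball (by linarith)
  have : Finite ({a, b, a', b'} : Set ℂ) := Set.toFinite _
  refine sphEquicontAt_of_factor (κ := ({a, b, a', b'} : Set ℂ)) (Ψ := fun R => iota R)
    (b := fun n u => tau (R n) ((sphMap f)^[n] (u : Sphere))) (j := R)
    (fun R => continuous_iota R) (r := r / 4) (by linarith) (fun n u hu => ?_)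
    (fun n u hu => hRb n u (hsubw hu)) (fun n u hu => ?_)
  · have hu' := hsub2 (hsubw hu)
    exact (((meroAt_coe u).iterate_comp hf (hd n u hu')).2 _
      (hRo n u hu')).differentiableAt.differentiableWithinAt
  · exact (iota_tau (hRo n u (hsub2 (hsubw hu)))).symm

end MeroDyn

/-! ### Injective functions: Möbius maps with at most one Julia point. -/

namespace MeroDyn

open Metric

variable {f : ℂ → Sphere}

/-- An injective entire function with a pole at infinity is affine. -/
theorem exists_affine_of_injective {g : ℂ → ℂ} (hg : Differentiable ℂ g)
    (hi : Function.Injective g)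
    (hinf : Tendsto g (Bornology.cobounded ℂ) (Bornology.cobounded ℂ)) :
    ∃ A B : ℂ, A ≠ 0 ∧ ∀ z, g z = A * z + B := by
  have hg0 : deriv g 0 ≠ 0 := by
    have := deriv_leftInverse_mul isOpen_univ hg.differentiableOn
      (φ := Function.invFun g) (fun z _ => Function.leftInverse_invFun hi z) (mem_univ 0)
    exact right_ne_zero_of_mul_eq_one this
  set q := dslope g 0 with hq
  have hqd : Differentiable ℂ q := by
    rw [← differentiableOn_univ]
    exact (Complex.differentiableOn_dslope univ_mem).2 hg.differentiableOn
  have hqz : ∀ z, z * q z = g z - g 0 := fun z => by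
    have := sub_smul_dslope g 0 z
    simpa using this
  have hq0 : ∀ z, q z ≠ 0 := by
    intro z
    by_cases hz : z = 0
    · rw [hz, hq, dslope_same]; exact hg0
    · intro h
      have := hqz z
      rw [h, mul_zero] at this
      exact hz (hi (sub_eq_zero.1 this.symm))
  set G : ℂ → ℂ := fun s => if s = 0 then 0 else (g s⁻¹ - g 0)⁻¹ with hG
  have hGne : ∀ s, s ≠ 0 → G s = (g s⁻¹ - g 0)⁻¹ := fun s hs => by simp [hG, hs]
  have hG0 : G 0 = 0 := by simp [hG]
  have hGc : ContinuousAt G 0 := by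
    rw [continuousAt_iff_punctured_nhds, hG0]
    have h1 : Tendsto (fun s : ℂ => (g s⁻¹ - g 0)⁻¹) (𝓝[≠] 0) (𝓝 0) := by
      refine tendsto_inv₀_cobounded.comp ?_
      have := (tendsto_add_const_cobounded (-g 0)).comp (hinf.comp tendsto_inv₀_nhdsNE_zero)
      simpa [Function.comp_def, sub_eq_add_neg] using this
    refine h1.congr' ?_
    filter_upwards [self_mem_nhdsWithin] with s hs using (hGne s hs).symm
  have hGa : AnalyticAt ℂ G 0 := by
    refine Complex.analyticAt_of_differentiable_on_punctured_nhds_of_continuousAt ?_ hGc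
    filter_upwards [self_mem_nhdsWithin] with s hs
    have hs' : s ≠ 0 := hs
    have h1 : DifferentiableAt ℂ (fun s : ℂ => (g s⁻¹ - g 0)⁻¹) s := by
      refine DifferentiableAt.inv ?_ ?_
      · exact ((hg s⁻¹).comp s (differentiableAt_inv hs')).sub_const _
      · intro h
        exact inv_ne_zero hs' (hi (sub_eq_zero.1 h))
    refine h1.congr_of_eventuallyEq ?_
    filter_upwards [isOpen_ne.mem_nhds hs'] with t ht using hGne t ht
  have hslope := hasDerivAt_iff_tendsto_slope_zero.1 hGa.differentiableAt.hasDerivAt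
  have hk : Tendsto (fun z => (q z)⁻¹) (cocompact ℂ) (𝓝 (deriv G 0)) := by
    rw [← Metric.cobounded_eq_cocompact]
    refine (hslope.comp tendsto_inv₀_cobounded').congr' ?_
    filter_upwards [(Metric.hasBasis_cobounded_compl_closedBall (0 : ℂ)).mem_of_mem
      (i := 0) trivial] with z hz
    have hz0 : z ≠ 0 := by rintro rfl; simp at hz
    simp only [Function.comp, zero_add, hG0, sub_zero, inv_inv, smul_eq_mul]
    rw [hGne _ (inv_ne_zero hz0), inv_inv, ← hqz z]
    field_simp
  have hconst : ∀ z, (q z)⁻¹ = deriv G 0 := fun z =>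
    (hqd.inv hq0).apply_eq_of_tendsto_cocompact z hk
  refine ⟨(deriv G 0)⁻¹, g 0, ?_, fun z => ?_⟩
  · rw [← hconst 0, inv_inv]; exact hq0 0
  · have := hqz z
    rw [← hconst z, inv_inv]
    linear_combination -this

theorem nhds_le_map (hf : IsMeromorphic f) (hconst : ¬ IsConst f) (z : ℂ) :
    𝓝 (f z) ≤ map f (𝓝 z) :=
  (hf.meroAt z).nhds_le_map_nhds (not_eventually_const hf hconst z (f z))

/-- The image of the unit disk contains a closed disk, which by injectivity is omitted outside the
unit disk. -/
theorem exists_tendsto_of_injective (hf : IsMeromorphic f) (hconst : ¬ IsConst f)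
    (hi : Function.Injective f) : ∃ a : Sphere, Tendsto f (cocompact ℂ) (𝓝 a) := by
  have hmem : f '' ball 0 1 ∈ 𝓝 (f 0) := nhds_le_map hf hconst 0 (image_mem_map (ball_mem_nhds 0 one_pos))
  obtain ⟨O, hO, hOo, hO0⟩ := mem_nhds_iff.1 hmem
  obtain ⟨w, hw⟩ := (OnePoint.denseRange_coe (X := ℂ)).exists_mem_open hOo ⟨_, hO0⟩
  obtain ⟨r, hr, hball⟩ := Metric.nhds_basis_closedBall.mem_iff.1
    ((hOo.preimage OnePoint.continuous_coe).mem_nhds hw)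
  refine exists_tendsto_of_omits hf (isCompact_closedBall w r)
    (measure_closedBall_pos volume w hr) ?_
  filter_upwards [(Metric.hasBasis_cobounded_compl_closedBall (0 : ℂ)).mem_of_mem
      (i := 1) trivial] with z hz ζ hζ h
  obtain ⟨y, hy, hyz⟩ := hO (hball hζ)
  have : y = z := hi (hyz.trans h.symm)
  subst this
  exact hz (ball_subset_closedBall hy)

/-- Otherwise values near `∞` would already be taken in a bounded disk about `z`, by openness. -/
theorem ne_sphMap_infty_of_injective (hf : IsMeromorphic f) (hconst : ¬ IsConst f)
    (hi : Function.Injective f) (hd : OnePoint.infty ∈ sphDom f) (z : ℂ) :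
    f z ≠ sphMap f OnePoint.infty := by
  intro h
  have hmem := nhds_le_map hf hconst z (image_mem_map (ball_mem_nhds z one_pos))
  rw [h] at hmem
  have hev := tendsto_sphMap_infty hd hmem
  rw [← Metric.cobounded_eq_cocompact] at hev
  have hev' : ∀ᶠ w in Bornology.cobounded ℂ, f w ∈ f '' ball z 1 := hev
  have hb : ∀ᶠ w in Bornology.cobounded ℂ, w ∈ (closedBall z 1)ᶜ :=
    (Metric.hasBasis_cobounded_compl_closedBall z).mem_of_mem (i := 1) trivial
  obtain ⟨w, ⟨y, hy, hyw⟩, hw⟩ := (hev'.and hb).exists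
  have : y = w := hi hyw
  subst this
  exact hw (ball_subset_closedBall hy)

/-- Applied with `X` a parametrization of the sphere minus the value of `f` at `∞`: it turns the
limit of `f` into a pole of the planar coordinate function. -/
theorem tendsto_cobounded_of_comp_tendsto {g : ℂ → ℂ} {X : ℂ → Sphere} (hX : Continuous X)
    {u : Sphere} (hu : ∀ t, X t ≠ u)
    (h : Tendsto (fun z => X (g z)) (Bornology.cobounded ℂ) (𝓝 u)) :
    Tendsto g (Bornology.cobounded ℂ) (Bornology.cobounded ℂ) := by
  rw [(Metric.hasBasis_cobounded_compl_closedBall (0 : ℂ)).tendsto_right_iff]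
  intro R _
  have hc : IsClosed (X '' closedBall 0 R) := ((isCompact_closedBall (0 : ℂ) R).image hX).isClosed
  have hmem : (X '' closedBall 0 R)ᶜ ∈ 𝓝 u := hc.isOpen_compl.mem_nhds (by
    rintro ⟨t, -, ht⟩; exact hu t ht)
  filter_upwards [h hmem] with z hz hzR
  exact hz ⟨g z, hzR, rfl⟩

/-- An injective nonlinear meromorphic function is a Möbius transformation with a finite value
at infinity. -/
theorem exists_moebius_of_injective (hf : IsMeromorphic f) (hconst : ¬ IsConst f)
    (hlin : ¬ IsLinear f) (hi : Function.Injective f) :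
    OnePoint.infty ∈ sphDom f ∧ ∃ u A B : ℂ, sphMap f OnePoint.infty = (u : Sphere) ∧ A ≠ 0 ∧
      ∀ z, f z = iota u (A * z + B) := by
  have hd : OnePoint.infty ∈ sphDom f :=
    infty_mem_sphDom_iff.2 (exists_tendsto_of_injective hf hconst hi)
  have hne := ne_sphMap_infty_of_injective hf hconst hi hd
  have hlim := tendsto_sphMap_infty hd
  rw [← Metric.cobounded_eq_cocompact] at hlim
  refine ⟨hd, ?_⟩
  generalize sphMap f OnePoint.infty = u at *
  induction u using OnePoint.rec with
  | infty =>
    exfalso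
    have hex : ∀ z, ∃ w : ℂ, (w : Sphere) = f z := fun z => OnePoint.ne_infty_iff_exists.1 (hne z)
    choose g hg using hex
    have hgd : Differentiable ℂ g := by
      intro z
      obtain ⟨h, hh, hfh⟩ := (hf.meroAt z).exists_analyticAt (hne z)
      refine hh.differentiableAt.congr_of_eventuallyEq ?_
      filter_upwards [hfh] with w hw
      exact OnePoint.coe_injective ((hg w).trans hw)
    have hgi : Function.Injective g := fun x y hxy => hi (by rw [← hg, ← hg, hxy])
    have hgt := tendsto_cobounded_of_comp_tendsto (g := g) OnePoint.continuous_coe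
      (fun t => OnePoint.coe_ne_infty t) (hlim.congr fun z => (hg z).symm)
    obtain ⟨A, B, -, h⟩ := exists_affine_of_injective hgd hgi hgt
    exact hlin ⟨A, B, fun z => by rw [← hg, h]⟩
  | coe u =>
    have hg : ∀ z, iota u (tau u (f z)) = f z := fun z => iota_tau (hne z)
    have hgd : Differentiable ℂ fun z => tau u (f z) := fun z =>
      ((hf.meroAt z).2 u (hne z)).differentiableAt
    have hgi : Function.Injective fun z => tau u (f z) := fun x y hxy =>
      hi (injOn_tau u (hne x) (hne y) hxy)
    have hgt := tendsto_cobounded_of_comp_tendsto (g := fun z => tau u (f z)) (continuous_iota u)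
      (iota_ne u) (hlim.congr fun z => (hg z).symm)
    obtain ⟨A, B, hA, h⟩ := exists_affine_of_injective hgd hgi hgt
    exact ⟨u, A, B, rfl, hA, fun z => by rw [← h, hg]⟩

/-- The two roots have product -1/A, so one of them satisfies |s|² ≥ 1/|A|. -/
theorem exists_repelling_root {A C : ℂ} (hA : A ≠ 0) :
    ∃ s : ℂ, A * s ^ 2 + C * s - 1 = 0 ∧ 1 ≤ ‖A‖ * ‖s‖ ^ 2 := by
  obtain ⟨d, hd⟩ := IsAlgClosed.exists_pow_nat_eq (discrim A C (-1)) (n := 2) two_pos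
  obtain ⟨s, hs⟩ := exists_quadratic_eq_zero hA (b := C) (c := -1) ⟨d, by rw [← hd, sq]⟩
  have hs0 : s ≠ 0 := by rintro rfl; simp at hs
  have hApos : 0 < ‖A‖ := norm_pos_iff.2 hA
  have hspos : 0 < ‖s‖ := norm_pos_iff.2 hs0
  rcases le_or_gt 1 (‖A‖ * ‖s‖ ^ 2) with h | h
  · exact ⟨s, by linear_combination hs, h⟩
  · refine ⟨-(A * s)⁻¹, ?_, ?_⟩
    · field_simp
      linear_combination -hs
    · rw [norm_neg, norm_inv, norm_mul, inv_pow, mul_pow, ← div_eq_mul_inv,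
        le_div_iff₀ (by positivity)]
      nlinarith

/-- With `f z = u + 1 / (A z + B)`, roots of the quadratic give fixed points `p = u + s` of
multiplier -A s², here of modulus at least 1. In the coordinate at `p` the map is affine with factor
of modulus at most 1, so the iterates are equicontinuous away from `p`. -/
theorem juliaSet_subset_singleton_of_injective (hf : IsMeromorphic f) (hconst : ¬ IsConst f)
    (hlin : ¬ IsLinear f) (hi : Function.Injective f) : ∃ p, juliaSet f ⊆ {p} := by
  obtain ⟨hd, u, A, B, hu, hA, hfz⟩ := exists_moebius_of_injective hf hconst hlin hi
  obtain ⟨s, hs, hs1⟩ := exists_repelling_root (C := A * u + B) hA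
  have hs0 : s ≠ 0 := by rintro rfl; simp at hs
  set p := u + s with hp
  set l : ℂ → ℂ := fun t => -(A * s ^ 2)⁻¹ * t + -s⁻¹ with hl
  have hstep : ∀ t, sphMap f (iota p t) = iota p (l t) := by
    intro t
    by_cases ht : t = 0
    · rw [ht, iota_zero, hu, hl]
      simp only [mul_zero, zero_add]
      rw [iota_of_ne p (neg_ne_zero.2 (inv_ne_zero hs0))]
      congr 1
      rw [hp, ← inv_neg, inv_inv]
      ring
    · have e1 : A * (p + t⁻¹) + B = (t + A * s) / (s * t) := by
        rw [hp]
        field_simp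
        linear_combination t * hs
      have e2 : l t = -(t + A * s) / (A * s ^ 2) := by
        rw [hl]
        field_simp
        ring
      rw [iota_of_ne p ht, sphMap_coe, hfz, e1, e2]
      by_cases h0 : t + A * s = 0
      · rw [h0]; simp
      · rw [iota_of_ne u (div_ne_zero h0 (mul_ne_zero hs0 ht)),
          iota_of_ne p (div_ne_zero (neg_ne_zero.2 h0) (mul_ne_zero hA (pow_ne_zero 2 hs0)))]
        congr 1
        rw [hp]
        field_simp
        ring
  have hiter : ∀ n t, (sphMap f)^[n] (iota p t) = iota p (l^[n] t) := by
    intro n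
    induction n with
    | zero => intro t; rfl
    | succ n ih => intro t; rw [Function.iterate_succ_apply, Function.iterate_succ_apply, hstep, ih]
  have hdl : ∀ x y, dist (l x) (l y) ≤ dist x y := by
    intro x y
    rw [dist_eq_norm, dist_eq_norm, hl]
    simp only [add_sub_add_right_eq_sub, ← mul_sub, norm_mul, norm_neg, norm_inv, norm_pow]
    refine mul_le_of_le_one_left (norm_nonneg _) (inv_le_one_of_one_le₀ hs1)
  have hdln : ∀ n x y, dist (l^[n] x) (l^[n] y) ≤ dist x y := by
    intro n
    induction n with
    | zero => intro x y; exact le_rfl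
    | succ n ih =>
      intro x y
      rw [Function.iterate_succ_apply, Function.iterate_succ_apply]
      exact (ih _ _).trans (hdl x y)
  have hdom : ∀ n x, IterDefined f n x := by
    intro n x k _
    generalize (sphMap f)^[k] x = y
    induction y using OnePoint.rec with
    | infty => exact hd
    | coe z => exact coe_mem_sphDom z
  refine ⟨p, fun z hz => ?_⟩
  by_contra hzp
  refine hz (mem_fatouSet_of_sphEquicontAt (isOpen_compl_singleton (x := p)) hzp
    (fun n w _ => hdom n w) fun w hw W hW => ?_)
  let _ := TopologicalSpace.metrizableSpaceMetric Sphere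
  have htend : Tendsto (iota p) (cocompact ℂ) (𝓝 (p : Sphere)) := by
    rw [← Metric.cobounded_eq_cocompact]
    have h1 : Tendsto (fun t : ℂ => p + t⁻¹) (Bornology.cobounded ℂ) (𝓝 (p + 0)) :=
      tendsto_inv₀_cobounded.const_add p
    rw [add_zero] at h1
    refine ((OnePoint.continuous_coe.tendsto p).comp h1).congr' ?_
    filter_upwards [(Metric.hasBasis_cobounded_compl_closedBall (0 : ℂ)).mem_of_mem
      (i := 0) trivial] with t ht
    have ht0 : t ≠ 0 := by rintro rfl; simp at ht
    exact (iota_of_ne p ht0).symm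
  -- Uniform continuity on the whole plane, thanks to the limit at infinity, is required because the
  -- affine iterates may be unbounded.
  have huc : UniformContinuous (iota p) :=
    (continuous_iota p).uniformContinuous_of_tendsto_cocompact htend
  rw [nhdsSet_diagonal_eq_uniformity] at hW
  obtain ⟨η, hη, hηW⟩ := Metric.mem_uniformity_dist.1 (huc hW)
  have hwp : (w : Sphere) ≠ (p : Sphere) := fun h => hw (OnePoint.coe_injective h)
  have hcont : ContinuousAt (fun v : ℂ => tau p (v : Sphere)) w :=
    (continuousAt_tau hwp).comp (f := fun v : ℂ => (v : Sphere))
      OnePoint.continuous_coe.continuousAt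
  filter_upwards [Metric.continuousAt_iff'.1 hcont η hη, isOpen_compl_singleton.mem_nhds hw]
    with v hv hvp n
  have hvp' : (v : Sphere) ≠ (p : Sphere) := fun h => hvp (OnePoint.coe_injective h)
  rw [← iota_tau hwp, ← iota_tau hvp', hiter, hiter]
  refine hηW ?_
  refine (hdln n _ _).trans_lt ?_
  rwa [dist_comm]

end MeroDyn

/-! ### Branches of iterates; measurability and invariance of the radial Julia set. -/

namespace MeroDyn

open Metric

variable {f : ℂ → Sphere}

theorem iterDefined_succ' {n : ℕ} {x : Sphere} :
    IterDefined f (n + 1) x ↔ x ∈ sphDom f ∧ IterDefined f n (sphMap f x) := by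
  unfold IterDefined
  constructor
  · exact fun h => ⟨h 0 n.succ_pos, fun k hk => h (k + 1) (Nat.succ_lt_succ hk)⟩
  · rintro ⟨h0, h⟩ k hk
    cases k with
    | zero => exact h0
    | succ k => exact h k (Nat.lt_of_succ_lt_succ hk)

/-! ### Univalent branches -/

/-- `U` is an open set which `fⁿ` maps bijectively onto `B`. -/
structure IsBranch (f : ℂ → Sphere) (n : ℕ) (U B : Set Sphere) : Prop where
  isOpen : IsOpen U
  iterDefined : ∀ x ∈ U, IterDefined f n x
  injOn : InjOn (sphMap f)^[n] U
  image_eq : (sphMap f)^[n] '' U = B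

theorem preimageIter_eq (n : ℕ) (D : Set Sphere) :
    preimageIter f n D = {x | IterDefined f n x ∧ (sphMap f)^[n] x ∈ D} := by
  ext x
  constructor
  · rintro ⟨y, hy, h⟩
    obtain ⟨h1, rfl⟩ := iter_eq_some_iff.1 h
    exact ⟨h1, hy⟩
  · rintro ⟨h1, h2⟩
    exact ⟨_, h2, iter_eq_some_iff.2 ⟨h1, rfl⟩⟩

/-- The branch is the part of the pullback lying over `B`. No connectedness of `B` is needed, which
lets a fixed disk replace the moving ones. -/
theorem exists_isBranch_of_pullsBackUnivalently (hf : IsMeromorphic f) {n : ℕ} {D B : Set Sphere}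
    (hD : IsOpen D) (hB : IsOpen B) (hBD : B ⊆ D) {z : Sphere} (hz : IterDefined f n z)
    (hzB : (sphMap f)^[n] z ∈ B) (h : PullsBackUnivalently f n D z) :
    ∃ U, z ∈ U ∧ IsBranch f n U B := by
  have hP : IsOpen (preimageIter f n D) := by
    rw [preimageIter_eq]
    exact isOpen_iterDefined_inter_preimage hf n hD
  have hsub : pullback f n D z ⊆ {x | IterDefined f n x ∧ (sphMap f)^[n] x ∈ D} := by
    rw [← preimageIter_eq]
    exact connectedComponentIn_subset _ _
  have hzP : z ∈ pullback f n D z :=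
    mem_connectedComponentIn (by rw [preimageIter_eq]; exact ⟨hz, hBD hzB⟩)
  have := locallyConnectedSpace_sphere
  have hiter : ∀ x ∈ pullback f n D z, iter f n x = some ((sphMap f)^[n] x) := fun x hx =>
    iter_eq_some_iff.2 ⟨(hsub hx).1, rfl⟩
  refine ⟨pullback f n D z ∩ {x | IterDefined f n x ∧ (sphMap f)^[n] x ∈ B}, ⟨hzP, hz, hzB⟩,
    hP.connectedComponentIn.inter (isOpen_iterDefined_inter_preimage hf n hB),
    fun x hx => hx.2.1, fun x hx y hy hxy => ?_, ?_⟩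
  · exact h.injOn hx.1 hy.1 (by rw [hiter x hx.1, hiter y hy.1, hxy])
  · apply Subset.antisymm
    · rintro _ ⟨x, hx, rfl⟩
      exact hx.2.2
    · intro y hy
      obtain ⟨x, hx, hxy⟩ := h.surjOn (mem_image_of_mem some (hBD hy))
      have h2 := iter_eq_some_iff.1 hxy
      exact ⟨x, ⟨hx, h2.1, by rw [h2.2]; exact hy⟩, h2.2⟩

theorem IsBranch.pullsBackUnivalently (hf : IsMeromorphic f) (hconst : ¬ IsConst f) {n : ℕ}
    {U B D : Set Sphere} (h : IsBranch f n U B) (hD : IsOpen D) (hDp : IsPreconnected D)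
    (hDB : D ⊆ B) {z : Sphere} (hzU : z ∈ U) (hzD : (sphMap f)^[n] z ∈ D) :
    PullsBackUnivalently f n D z := by
  set φ : Sphere → Sphere := Function.invFunOn (sphMap f)^[n] U with hφ
  have hφF : ∀ x ∈ U, φ ((sphMap f)^[n] x) = x := fun x hx => h.injOn.leftInvOn_invFunOn hx
  have hBφ : ∀ y ∈ B, φ y ∈ U ∧ (sphMap f)^[n] (φ y) = y := fun y hy => by
    rw [← h.image_eq] at hy
    exact ⟨Function.invFunOn_mem hy, Function.invFunOn_eq hy⟩
  have hφc : ∀ y ∈ B, ContinuousAt φ y := by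
    intro y hy
    obtain ⟨hxU, hxy⟩ := hBφ y hy
    have h1 := nhds_le_map_iterate hf hconst (h.iterDefined _ hxU)
    rw [hxy] at h1
    refine Tendsto.mono_left ?_ h1
    rw [tendsto_map'_iff]
    refine tendsto_id.congr' ?_
    filter_upwards [h.isOpen.mem_nhds hxU] with x hx using (hφF x hx).symm
  set W := U ∩ {x | IterDefined f n x ∧ (sphMap f)^[n] x ∈ D} with hW
  have hWo : IsOpen W := h.isOpen.inter (isOpen_iterDefined_inter_preimage hf n hD)
  have hWφ : W = φ '' D := by
    apply Subset.antisymm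
    · rintro x ⟨hxU, -, hxD⟩
      exact ⟨_, hxD, hφF x hxU⟩
    · rintro _ ⟨y, hy, rfl⟩
      obtain ⟨hxU, hxy⟩ := hBφ y (hDB hy)
      exact ⟨hxU, h.iterDefined _ hxU, by rw [hxy]; exact hy⟩
  have hWp : IsPreconnected W := by
    rw [hWφ]
    exact hDp.image φ fun y hy => (hφc y (hDB hy)).continuousWithinAt
  have hzW : z ∈ W := ⟨hzU, h.iterDefined z hzU, hzD⟩
  have hPW : pullback f n D z = W := by
    unfold pullback
    rw [preimageIter_eq]
    apply Subset.antisymm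
    · refine isPreconnected_connectedComponentIn.subset_of_closure_inter_subset hWo
        ⟨z, mem_connectedComponentIn ⟨hzW.2.1, hzD⟩, hzW⟩ ?_
      rintro y ⟨hyW, hyC⟩
      obtain ⟨hyd, hyD⟩ := connectedComponentIn_subset _ _ hyC
      have : (𝓝[W] y).NeBot := mem_closure_iff_nhdsWithin_neBot.1 hyW
      have h1 : Tendsto (fun x => φ ((sphMap f)^[n] x)) (𝓝[W] y) (𝓝 (φ ((sphMap f)^[n] y))) :=
        ((hφc _ (hDB hyD)).comp (continuousAt_iterate hf hyd)).mono_left nhdsWithin_le_nhds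
      have h2 : Tendsto (fun x => x) (𝓝[W] y) (𝓝 y) := tendsto_id.mono_left nhdsWithin_le_nhds
      have h3 : (fun x => x) =ᶠ[𝓝[W] y] fun x => φ ((sphMap f)^[n] x) := by
        filter_upwards [self_mem_nhdsWithin] with x hx using (hφF x hx.1).symm
      rw [tendsto_nhds_unique_of_eventuallyEq h2 h1 h3, hWφ]
      exact mem_image_of_mem φ hyD
    · exact hWp.subset_connectedComponentIn hzW inter_subset_right
  unfold PullsBackUnivalently
  rw [hPW]
  have hiter : ∀ x ∈ W, iter f n x = some ((sphMap f)^[n] x) := fun x hx =>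
    iter_eq_some_iff.2 ⟨hx.2.1, rfl⟩
  refine ⟨fun x hx => ⟨_, hx.2.2, (hiter x hx).symm⟩, fun x hx y hy hxy => ?_, ?_⟩
  · rw [hiter x hx, hiter y hy] at hxy
    exact h.injOn hx.1 hy.1 (Option.some_injective _ hxy)
  · rintro _ ⟨y, hy, rfl⟩
    have hyW : φ y ∈ W := by rw [hWφ]; exact mem_image_of_mem φ hy
    exact ⟨φ y, hyW, by rw [hiter _ hyW, (hBφ y (hDB hy)).2]⟩

theorem IsBranch.image_sphMap (hf : IsMeromorphic f) (hconst : ¬ IsConst f) {n : ℕ}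
    {U B : Set Sphere} (h : IsBranch f (n + 1) U B) : IsBranch f n (sphMap f '' U) B := by
  refine ⟨?_, ?_, ?_, ?_⟩
  · exact isOpen_image_iterate hf hconst (n := 1) h.isOpen fun x hx =>
      (h.iterDefined x hx).mono (by omega)
  · rintro _ ⟨x, hx, rfl⟩
    exact (iterDefined_succ'.1 (h.iterDefined x hx)).2
  · rintro _ ⟨x, hx, rfl⟩ _ ⟨y, hy, rfl⟩ hxy
    rw [h.injOn hx hy hxy]
  · rw [← h.image_eq, image_image]
    rfl

/-! ### Coordinate disks -/

/-- The centres of the two charts used. -/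
noncomputable def chartCenter (b : Bool) : ℂ := cond b 1 0

/-- A coordinate disk on the sphere. -/
noncomputable def chartDisk (Q c : ℂ) (ρ : ℝ) : Set Sphere := iota Q '' ball c ρ

theorem isOpen_chartDisk (Q c : ℂ) (ρ : ℝ) : IsOpen (chartDisk Q c ρ) :=
  (isOpenEmbedding_iota Q).isOpenMap _ isOpen_ball

/-- The point is that the family of disks is countable, which makes the radial Julia set measurable.
Each coordinate misses only its centre, so two of them suffice. -/
theorem exists_chartDisk_subset {w : Sphere} {N : Set Sphere} (hN : N ∈ 𝓝 w) :
    ∃ (b : Bool) (k m : ℕ),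
      w ∈ chartDisk (chartCenter b) (TopologicalSpace.denseSeq ℂ k) (1 / (m + 1) / 2) ∧
      chartDisk (chartCenter b) (TopologicalSpace.denseSeq ℂ k) (1 / (m + 1)) ⊆ N := by
  have hb : ∃ b, w ≠ (chartCenter b : Sphere) := by
    by_contra! h
    have h1 := (h true).symm.trans (h false)
    rw [OnePoint.coe_eq_coe] at h1
    simp [chartCenter] at h1
  obtain ⟨b, hb⟩ := hb
  have hpre : iota (chartCenter b) ⁻¹' N ∈ 𝓝 (tau (chartCenter b) w) :=
    (continuous_iota _).continuousAt (by rwa [iota_tau hb])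
  obtain ⟨ε, hε, hεN⟩ := Metric.mem_nhds_iff.1 hpre
  obtain ⟨m, hm⟩ := exists_nat_one_div_lt (half_pos hε)
  have hm0 : (0 : ℝ) < 1 / (m + 1) := by positivity
  obtain ⟨k, hk⟩ := (TopologicalSpace.denseRange_denseSeq ℂ).exists_dist_lt
    (tau (chartCenter b) w) (half_pos hm0)
  refine ⟨b, k, m, ⟨_, hk, iota_tau hb⟩, ?_⟩
  rintro _ ⟨t, ht, rfl⟩
  apply hεN
  rw [mem_ball] at ht ⊢
  rw [dist_comm] at hk
  linarith [dist_triangle t (TopologicalSpace.denseSeq ℂ k) (tau (chartCenter b) w)]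

/-- The points `z` such that `fⁿ` has a univalent branch near `z` with values in a chart disk, and
`fⁿ z` lies in the concentric disk of half the radius. -/
def branchSet (f : ℂ → Sphere) (Q c : ℂ) (ρ : ℝ) (n : ℕ) : Set ℂ :=
  {z | (sphMap f)^[n] (z : Sphere) ∈ chartDisk Q c (ρ / 2) ∧
    ∃ U, (z : Sphere) ∈ U ∧ IsBranch f n U (chartDisk Q c ρ)}

theorem isOpen_branchSet (hf : IsMeromorphic f) (Q c : ℂ) (ρ : ℝ) (n : ℕ) :
    IsOpen (branchSet f Q c ρ n) := by
  rw [isOpen_iff_mem_nhds]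
  rintro z ⟨hz, U, hzU, hU⟩
  have ho : IsOpen (U ∩ {x | IterDefined f n x ∧ (sphMap f)^[n] x ∈ chartDisk Q c (ρ / 2)}) :=
    hU.isOpen.inter (isOpen_iterDefined_inter_preimage hf n (isOpen_chartDisk _ _ _))
  filter_upwards [OnePoint.continuous_coe.continuousAt (ho.mem_nhds ⟨hzU, hU.iterDefined _ hzU, hz⟩)]
    with w hw using ⟨hw.2.2, U, hw.1, hU⟩

theorem exists_sphDisk_subset_chartDisk (Q c : ℂ) {ρ : ℝ} (hρ : 0 < ρ) :
    ∃ δ, 0 < δ ∧ δ ≤ 1 ∧ ∀ x ∈ chartDisk Q c (ρ / 2), sphDisk x δ ⊆ chartDisk Q c ρ := by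
  have hK : IsCompact ((iota Q '' closedBall c (ρ / 2)) ×ˢ (chartDisk Q c ρ)ᶜ) :=
    ((isCompact_closedBall c _).image (continuous_iota Q)).prod
      (isOpen_chartDisk Q c ρ).isClosed_compl.isCompact
  have hcont : Continuous fun p : Sphere × Sphere => sphDist p.2 p.1 := by
    simpa only [Function.comp_def, Prod.fst_swap, Prod.snd_swap] using
      continuous_sphDist.comp continuous_swap
  obtain ⟨a, ha, h⟩ := hK.exists_forall_le' hcont.continuousOn (a := 0) (by
    rintro ⟨x, y⟩ ⟨⟨t, ht, rfl⟩, hy⟩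
    refine sphDist_pos fun hyt => hy ?_
    rw [show y = iota Q t from hyt]
    exact (mem_image_of_mem _ (closedBall_subset_ball (by linarith) ht)))
  refine ⟨min a 1, lt_min ha one_pos, min_le_right _ _, ?_⟩
  rintro x ⟨t, ht, rfl⟩ y hy
  by_contra hy'
  exact (h (iota Q t, y) ⟨mem_image_of_mem _ (ball_subset_closedBall ht), hy'⟩).not_gt
    (lt_of_lt_of_le hy (min_le_left _ _))

/-- Forward, the images `fⁿ z` at good times accumulate somewhere, and a small chart disk there lies
inside the spherical disks about infinitely many of them. Backward, a uniform δ fits inside the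
chart disk around every point of the half-size disk; δ ≤ 1 keeps the spherical disks connected. -/
theorem mem_radialJuliaSet_iff (hf : IsMeromorphic f) (hconst : ¬ IsConst f) {z : ℂ} :
    z ∈ radialJuliaSet f ↔ z ∈ juliaSet f ∧ ∃ (b : Bool) (k m : ℕ),
      {n | z ∈ branchSet f (chartCenter b) (TopologicalSpace.denseSeq ℂ k)
        (1 / (m + 1)) n}.Infinite := by
  refine and_congr_right fun _ => ⟨?_, ?_⟩
  · rintro ⟨δ, hδ, hS⟩
    set S := {n : ℕ | ∃ x : Sphere, iter f n (z : Sphere) = some x ∧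
      PullsBackUnivalently f n (sphDisk x δ) (z : Sphere)} with hSdef
    have : (atTop ⊓ 𝓟 S : Filter ℕ).NeBot :=
      (frequently_mem_iff_neBot (s := S)).1 (Nat.frequently_atTop_iff_infinite.2 hS)
    obtain ⟨w, -, hw⟩ := (isCompact_univ (X := Sphere)).exists_mapClusterPt_of_frequently
      (l := atTop ⊓ 𝓟 S) (f := fun n => (sphMap f)^[n] (z : Sphere))
      (Filter.Eventually.of_forall fun _ => mem_univ _).frequently
    have hO : {p : Sphere × Sphere | sphDist p.1 p.2 < δ} ∈ 𝓝 (w, w) :=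
      nhds_le_nhdsSet (mem_diagonal w) (setOf_sphDist_lt_mem_nhdsSet hδ)
    rw [nhds_prod_eq, mem_prod_same_iff] at hO
    obtain ⟨N, hN, hNO⟩ := hO
    have hNδ : ∀ x ∈ N, N ⊆ sphDisk x δ := fun x hx y hy => by
      have := hNO (mk_mem_prod hy hx)
      simpa only [mem_ofPred_eq, sphDisk] using this
    obtain ⟨b, k, m, hwk, hk⟩ := exists_chartDisk_subset hN
    refine ⟨b, k, m, ?_⟩
    have hfr := mapClusterPt_iff_frequently.1 hw _ ((isOpen_chartDisk _ _ _).mem_nhds hwk)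
    rw [frequently_inf_principal] at hfr
    refine (Nat.frequently_atTop_iff_infinite.1 hfr).mono ?_
    rintro n ⟨hnS, hn⟩
    obtain ⟨x, hx, hpb⟩ := hnS
    obtain ⟨hd, rfl⟩ := iter_eq_some_iff.1 hx
    have hsub : chartDisk (chartCenter b) (TopologicalSpace.denseSeq ℂ k) (1 / (m + 1) / 2) ⊆
        chartDisk (chartCenter b) (TopologicalSpace.denseSeq ℂ k) (1 / (m + 1)) := by
      refine image_mono (ball_subset_ball ?_)
      have : (0 : ℝ) < 1 / (m + 1) := by positivity
      linarith
    exact ⟨hn, exists_isBranch_of_pullsBackUnivalently hf (isOpen_sphDisk _ _)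
      (isOpen_chartDisk _ _ _) (hk.trans (hNδ _ (hk (hsub hn)))) hd (hsub hn) hpb⟩
  · rintro ⟨b, k, m, hinf⟩
    obtain ⟨δ, hδ, hδ1, h⟩ := exists_sphDisk_subset_chartDisk (chartCenter b)
      (TopologicalSpace.denseSeq ℂ k) (ρ := 1 / (m + 1)) (by positivity)
    refine ⟨δ, hδ, hinf.mono ?_⟩
    rintro n ⟨hn, U, hzU, hU⟩
    exact ⟨_, iter_eq_some_iff.2 ⟨hU.iterDefined _ hzU, rfl⟩,
      hU.pullsBackUnivalently hf hconst (isOpen_sphDisk _ _) (isPreconnected_sphDisk _ hδ1)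
        (h _ hn) hzU (mem_sphDisk_self _ hδ)⟩

theorem isClosed_juliaSet : IsClosed (juliaSet f) := by
  refine isClosed_compl_iff.2 (isOpen_iff_mem_nhds.2 ?_)
  rintro z ⟨U, hU, hzU, F, hF⟩
  filter_upwards [hU.mem_nhds hzU] with w hw using ⟨U, hU, hw, F, hF⟩

theorem measurableSet_radialJuliaSet (hf : IsMeromorphic f) (hconst : ¬ IsConst f) :
    MeasurableSet (radialJuliaSet f) := by
  have : radialJuliaSet f = juliaSet f ∩ ⋃ (b : Bool) (k : ℕ) (m : ℕ),
      limsup (branchSet f (chartCenter b) (TopologicalSpace.denseSeq ℂ k) (1 / (m + 1))) atTop := by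
    ext z
    simp only [mem_radialJuliaSet_iff hf hconst, mem_inter_iff, mem_iUnion,
      mem_limsup_iff_frequently_mem, Nat.frequently_atTop_iff_infinite]
  rw [this]
  exact isClosed_juliaSet.measurableSet.inter (MeasurableSet.iUnion fun b =>
    MeasurableSet.iUnion fun k => MeasurableSet.iUnion fun m =>
      MeasurableSet.measurableSet_limsup fun n => (isOpen_branchSet hf _ _ _ n).measurableSet)

theorem mem_fatouSet_of_apply_mem (hf : IsMeromorphic f) {z w : ℂ} (hzw : f z = (w : Sphere))
    (hw : w ∈ fatouSet f) : z ∈ fatouSet f := by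
  obtain ⟨U, hU, hwU, F, hF, hnorm⟩ := hw
  have hfc : Continuous f := continuous_iff_continuousAt.2 fun u => (hf.meroAt u).1
  have hUo : IsOpen ((↑) '' U : Set Sphere) := OnePoint.isOpenEmbedding_coe.isOpenMap _ hU
  have hdef : ∀ n, ∀ u ∈ f ⁻¹' ((↑) '' U), IterDefined f n (u : Sphere) := by
    rintro n u ⟨v, hv, hvu⟩
    cases n with
    | zero => exact fun k hk => absurd hk (Nat.not_lt_zero k)
    | succ n =>
      refine iterDefined_succ'.2 ⟨coe_mem_sphDom u, ?_⟩
      rw [sphMap_coe, ← hvu]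
      exact (iter_eq_some_iff.1 (hF n v hv)).1
  refine ⟨f ⁻¹' ((↑) '' U), hUo.preimage hfc, ⟨w, hwU, hzw.symm⟩,
    fun n u => (sphMap f)^[n] (u : Sphere), fun n u hu => iter_eq_some_iff.2 ⟨hdef n u hu, rfl⟩, ?_⟩
  intro G hG
  choose N hN using hG
  -- Iterate `n` at `u` is iterate `n - 1` at `f u`, except for `n = 0`; a sequence using the
  -- identity infinitely often has a constant subsequence.
  by_cases h0 : ∃ᶠ j in atTop, N j = 0
  · obtain ⟨φ, hφ, hφ0⟩ := extraction_of_frequently_atTop h0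
    refine ⟨φ, hφ, fun u => (u : Sphere), fun K _ _ ε hε => Eventually.of_forall fun j u _ => ?_⟩
    simp only [← hN (φ j), hφ0 j, Function.iterate_zero, id, sphDist_self, hε]
  · rw [not_frequently] at h0
    obtain ⟨φ, hφ, hφ0⟩ := extraction_of_eventually_atTop h0
    obtain ⟨ψ, hψ, g, hg⟩ := hnorm (fun j => F (N (φ j) - 1)) fun j => mem_range_self _
    refine ⟨φ ∘ ψ, hφ.comp hψ, fun u => g (Function.invFun ((↑) : ℂ → Sphere) (f u)), ?_⟩
    intro K hK hKU ε hε
    have hr : f '' K ⊆ range ((↑) : ℂ → Sphere) := by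
      rintro _ ⟨u, hu, rfl⟩
      obtain ⟨v, -, hv⟩ := hKU hu
      exact ⟨v, hv⟩
    have hK' : IsCompact (((↑) : ℂ → Sphere) ⁻¹' (f '' K)) :=
      (OnePoint.isOpenEmbedding_coe.isInducing.isCompact_preimage_iff hr).2 (hK.image hfc)
    have hK'U : ((↑) : ℂ → Sphere) ⁻¹' (f '' K) ⊆ U := by
      rintro v ⟨u, hu, huv⟩
      obtain ⟨v', hv', hv⟩ := hKU hu
      rwa [← OnePoint.coe_injective (hv.trans huv)]
    filter_upwards [hg _ hK' hK'U ε hε] with j hj u hu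
    obtain ⟨v, hvU, hv⟩ := hKU hu
    have hj' := hj v ⟨u, hu, hv.symm⟩
    simp only [Function.comp_apply]
    rw [← hN, ← hv, Function.leftInverse_invFun OnePoint.coe_injective v]
    obtain ⟨p, hp⟩ := Nat.exists_eq_succ_of_ne_zero (hφ0 (ψ j))
    simp only [hp, Nat.succ_eq_add_one, Nat.add_sub_cancel] at hj' ⊢
    rwa [Function.iterate_succ_apply, sphMap_coe, ← hv, (iter_eq_some_iff.1 (hF p v hvU)).2]

theorem mem_radialJuliaSet_of_apply_eq (hf : IsMeromorphic f) (hconst : ¬ IsConst f) {z w : ℂ}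
    (hzw : f z = (w : Sphere)) (hz : z ∈ radialJuliaSet f) : w ∈ radialJuliaSet f := by
  rw [mem_radialJuliaSet_iff hf hconst] at hz ⊢
  obtain ⟨hzJ, b, k, m, hinf⟩ := hz
  refine ⟨fun hw => hzJ (mem_fatouSet_of_apply_mem hf hzw hw), b, k, m, fun hfin => hinf ?_⟩
  -- Good times for `z` shift down by one for `w`; only `n = 0` is lost.
  refine ((hfin.image Nat.succ).union (finite_singleton 0)).subset ?_
  rintro n ⟨hn, U, hzU, hU⟩
  cases n with
  | zero => exact Or.inr rfl
  | succ n =>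
    refine Or.inl (mem_image_of_mem Nat.succ ⟨?_, sphMap f '' U, ⟨(z : Sphere), hzU, hzw⟩,
      hU.image_sphMap hf hconst⟩)
    rwa [Function.iterate_succ_apply, sphMap_coe, hzw] at hn

end MeroDyn

namespace MeroDyn

open Metric

/-! ### Distortion and density points -/

/-- The weak Koebe theorem for the inverse map on the disk of radius `ρ / 2` about `G z`; hence 2 ·
24 = 48. -/
theorem ball_subset_of_image_eq_ball {G : ℂ → ℂ} {Ω : Set ℂ} {c z : ℂ} {ρ : ℝ} (hΩ : IsOpen Ω)
    (hd : DifferentiableOn ℂ G Ω) (hi : InjOn G Ω) (him : G '' Ω = ball c ρ) (hz : z ∈ Ω)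
    (hGz : G z ∈ ball c (ρ / 2)) :
    deriv G z ≠ 0 ∧ ball z (ρ / (48 * ‖deriv G z‖)) ⊆ Ω := by
  set φ := Function.invFunOn G Ω
  have hφ : ∀ t ∈ Ω, φ (G t) = t := fun t ht => hi.leftInvOn_invFunOn ht
  have hφd : DifferentiableOn ℂ φ (ball c ρ) := by
    rw [← him]
    exact differentiableOn_of_leftInverse hΩ hd hφ
  have hder := deriv_leftInverse_mul hΩ hd hφ hz
  have hne : deriv G z ≠ 0 := right_ne_zero_of_mul_eq_one hder
  have hρ : 0 < ρ / 2 := dist_nonneg.trans_lt hGz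
  have hsub : ball (G z) (ρ / 2) ⊆ ball c ρ := by
    refine ball_subset_ball' ?_
    rw [mem_ball] at hGz
    linarith
  have hφi : InjOn φ (ball c ρ) := by
    rw [← him]
    rintro _ ⟨x, hx, rfl⟩ _ ⟨y, hy, rfl⟩ h
    rw [hφ x hx, hφ y hy] at h
    rw [h]
  refine ⟨hne, fun a ha => ?_⟩
  by_contra haΩ
  have hk := norm_deriv_mul_le_of_omits hρ (hφd.mono hsub) (hφi.mono hsub) (a := a)
    fun t ht h => by
      obtain ⟨x, hx, rfl⟩ : t ∈ G '' Ω := by rw [him]; exact hsub ht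
      rw [hφ x hx] at h
      exact haΩ (h ▸ hx)
  rw [hφ z hz] at hk
  have hpos : 0 < ‖deriv G z‖ := norm_pos_iff.2 hne
  have h1 : ‖deriv φ (G z)‖ = ‖deriv G z‖⁻¹ := by
    rw [eq_inv_of_mul_eq_one_left hder, norm_inv]
  rw [h1] at hk
  rw [mem_ball, dist_comm, dist_eq_norm, lt_div_iff₀ (by positivity)] at ha
  have h2 : ‖deriv G z‖⁻¹ * (ρ / 2) * ‖deriv G z‖ = ρ / 2 := by field_simp
  nlinarith [mul_le_mul_of_nonneg_right hk hpos.le]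

theorem ball_subset_image_ball {G : ℂ → ℂ} {z : ℂ} {r : ℝ} (hr : 0 < r)
    (hd : DifferentiableOn ℂ G (ball z r)) (hi : InjOn G (ball z r)) :
    ball (G z) (‖deriv G z‖ * r / 24) ⊆ G '' ball z r := by
  intro a ha
  by_contra h
  have hk := norm_deriv_mul_le_of_omits hr hd hi (a := a) fun t ht hta => h ⟨t, ht, hta⟩
  rw [mem_ball, dist_comm, dist_eq_norm] at ha
  linarith

/-- `G` omits the boundary point `c + ρ`, which is at distance at most `2 ρ` from every value. -/
theorem norm_deriv_mul_le_of_mapsTo {G : ℂ → ℂ} {z c : ℂ} {r ρ : ℝ} (hr : 0 < r)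
    (hd : DifferentiableOn ℂ G (ball z (2 * r))) (hi : InjOn G (ball z (2 * r)))
    (hm : ∀ t ∈ ball z (2 * r), G t ∈ ball c ρ) {t : ℂ} (ht : t ∈ ball z r) :
    ‖deriv G t‖ * r ≤ 48 * ρ := by
  have hsub : ball t r ⊆ ball z (2 * r) := by
    refine ball_subset_ball' ?_
    rw [mem_ball] at ht
    linarith
  have hρ : 0 < ρ := dist_nonneg.trans_lt (hm t (hsub (mem_ball_self hr)))
  have hk := norm_deriv_mul_le_of_omits hr (hd.mono hsub) (hi.mono hsub) (a := c + ρ)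
    fun s hs h => by
      have := hm s (hsub hs)
      rw [h, mem_ball, dist_eq_norm, add_sub_cancel_left, Complex.norm_real, Real.norm_eq_abs,
        abs_of_pos hρ] at this
      exact lt_irrefl _ this
  have h1 : ‖G t - (c + ρ)‖ ≤ ‖G t - c‖ + ‖(ρ : ℂ)‖ := by
    rw [← sub_sub]
    exact norm_sub_le _ _
  have h2 := hm t (hsub (mem_ball_self hr))
  rw [mem_ball, dist_eq_norm] at h2
  rw [Complex.norm_real, Real.norm_eq_abs, abs_of_pos hρ] at h1
  linarith

theorem volume_image_le {G : ℂ → ℂ} {Ω S : Set ℂ} {K : ℝ} (hΩ : IsOpen Ω)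
    (hd : DifferentiableOn ℂ G Ω) (hSΩ : S ⊆ Ω) (hS : MeasurableSet S)
    (hK : ∀ t ∈ S, ‖deriv G t‖ ≤ K) : volume (G '' S) ≤ ENNReal.ofReal (K ^ 2) * volume S := by
  have h := addHaar_image_le_lintegral_abs_det_fderiv volume hS (f := G)
    (f' := fun t => (ContinuousLinearMap.toSpanSingleton ℂ (deriv G t)).restrictScalars ℝ)
    fun t ht => ((((hd t (hSΩ ht)).differentiableAt
      (hΩ.mem_nhds (hSΩ ht))).hasDerivAt.hasFDerivAt).restrictScalars ℝ).hasFDerivWithinAt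
  refine h.trans ?_
  rw [← setLIntegral_const]
  refine setLIntegral_mono' hS fun t ht => ENNReal.ofReal_le_ofReal ?_
  -- The real Jacobian of a holomorphic map is |G'|².
  have hdet : ((ContinuousLinearMap.toSpanSingleton ℂ (deriv G t)).restrictScalars ℝ).det
      = ‖deriv G t‖ ^ 2 := by
    simp [ContinuousLinearMap.det, LinearMap.det_restrictScalars,
      Algebra.norm_complex_eq, Complex.normSq_eq_norm_sq]
  rw [hdet, abs_of_nonneg (by positivity)]
  exact pow_le_pow_left₀ (norm_nonneg _) (hK t ht) 2

/-- Blowing up at a density point: if univalent maps take ever smaller neighbourhoods of a density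
point of `E` onto a fixed disk and map `E` into `E'`, then `E'` has full measure in some disk. -/
theorem exists_ball_diff_null {E E' : Set ℂ} (hE : MeasurableSet E) {z c : ℂ} {ρ : ℝ} (hρ : 0 < ρ)
    (hdens : Tendsto (fun r => volume (Eᶜ ∩ closedBall z r) / volume (closedBall z r))
      (𝓝[>] 0) (𝓝 0))
    {Ω : ℕ → Set ℂ} {G : ℕ → ℂ → ℂ} (hΩ : ∀ j, IsOpen (Ω j)) (hd : ∀ j, DifferentiableOn ℂ (G j) (Ω j))
    (hi : ∀ j, InjOn (G j) (Ω j)) (him : ∀ j, G j '' Ω j = ball c ρ) (hz : ∀ j, z ∈ Ω j)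
    (hGz : ∀ j, G j z ∈ ball c (ρ / 2)) (hEE : ∀ j, ∀ t ∈ Ω j ∩ E, G j t ∈ E')
    (hsmall : ∀ r > 0, {j | ball z r ⊆ Ω j}.Finite) :
    ∃ w, ∃ η > 0, (∃ j, G j z ∈ ball w η) ∧ volume (ball w η \ E') = 0 := by
  have hder : ∀ j, deriv (G j) z ≠ 0 := fun j =>
    (ball_subset_of_image_eq_ball (hΩ j) (hd j) (hi j) (him j) (hz j) (hGz j)).1
  set r : ℕ → ℝ := fun j => ρ / (48 * ‖deriv (G j) z‖) / 2 with hr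
  have hr2 : ∀ j, ball z (2 * r j) ⊆ Ω j := fun j => by
    have := (ball_subset_of_image_eq_ball (hΩ j) (hd j) (hi j) (him j) (hz j) (hGz j)).2
    rwa [hr, mul_div_cancel₀ _ (two_ne_zero' ℝ)]
  have hr0 : ∀ j, 0 < r j := fun j => by
    have := norm_pos_iff.2 (hder j)
    positivity
  have hr1 : ∀ j, ball z (r j) ⊆ ball z (2 * r j) := fun j =>
    ball_subset_ball (by linarith [hr0 j])
  have hrlim : Tendsto r atTop (𝓝[>] 0) := by
    refine tendsto_nhdsWithin_iff.2 ⟨?_, Eventually.of_forall hr0⟩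
    rw [Metric.tendsto_atTop]
    intro ε hε
    obtain ⟨N, hN⟩ := (hsmall (2 * ε) (by positivity)).bddAbove
    refine ⟨N + 1, fun n hn => ?_⟩
    rw [Real.dist_eq, sub_zero, abs_of_pos (hr0 n)]
    by_contra! h
    have := hN (show n ∈ {j | ball z (2 * ε) ⊆ Ω j} from
      (ball_subset_ball (by linarith)).trans (hr2 n))
    omega
  -- Equal to ‖G'‖ r / 24 with r = ρ / (96 ‖G'‖), hence independent of `j`.
  set η := ρ / 2304 with hη
  -- A value outside `E'` must come from a point outside `E`, and |G'| ≤ 48 ρ / r on the small disk.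
  -- The factor r⁻² cancels against the area of the disk, leaving a constant times the density of
  -- the complement of `E`.
  have himage : ∀ j, volume (ball (G j z) η \ E') ≤ ENNReal.ofReal ((48 * ρ) ^ 2) * NNReal.pi *
      (volume (Eᶜ ∩ closedBall z (r j)) / volume (closedBall z (r j))) := by
    intro j
    have hsub : ball (G j z) η \ E' ⊆ G j '' (ball z (r j) \ E) := by
      rintro a ⟨ha, haE⟩
      have h := ball_subset_image_ball (hr0 j) ((hd j).mono ((hr1 j).trans (hr2 j)))
        ((hi j).mono ((hr1 j).trans (hr2 j)))
      have hη' : ‖deriv (G j) z‖ * r j / 24 = η := by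
        have := norm_pos_iff.2 (hder j)
        rw [hr, hη]
        field_simp
        norm_num
      rw [hη'] at h
      obtain ⟨t, ht, rfl⟩ := h ha
      exact ⟨t, ⟨ht, fun htE => haE (hEE j t ⟨hr2 j (hr1 j ht), htE⟩)⟩, rfl⟩
    have hK : ∀ t ∈ ball z (r j) \ E, ‖deriv (G j) t‖ ≤ 48 * ρ / r j := by
      rintro t ⟨ht, -⟩
      rw [le_div_iff₀ (hr0 j)]
      refine norm_deriv_mul_le_of_mapsTo (c := c) (hr0 j) ((hd j).mono (hr2 j)) ((hi j).mono (hr2 j))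
        (fun s hs => ?_) ht
      rw [← him j]
      exact mem_image_of_mem _ (hr2 j hs)
    have hS : volume (ball z (r j) \ E) ≤ volume (Eᶜ ∩ closedBall z (r j)) :=
      measure_mono fun t ht => ⟨ht.2, ball_subset_closedBall ht.1⟩
    have hcb0 : volume (closedBall z (r j)) ≠ 0 := (measure_closedBall_pos volume z (hr0 j)).ne'
    have hcbt : volume (closedBall z (r j)) ≠ ⊤ := measure_closedBall_lt_top.ne
    calc volume (ball (G j z) η \ E') ≤ volume (G j '' (ball z (r j) \ E)) := measure_mono hsub
      _ ≤ ENNReal.ofReal ((48 * ρ / r j) ^ 2) * volume (ball z (r j) \ E) :=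
        volume_image_le (hΩ j) (hd j) (sdiff_subset.trans ((hr1 j).trans (hr2 j)))
          (measurableSet_ball.diff hE) hK
      _ ≤ ENNReal.ofReal ((48 * ρ / r j) ^ 2) * volume (Eᶜ ∩ closedBall z (r j)) := by gcongr
      _ = ENNReal.ofReal ((48 * ρ / r j) ^ 2) * volume (closedBall z (r j)) *
          (volume (Eᶜ ∩ closedBall z (r j)) / volume (closedBall z (r j))) := by
        rw [mul_assoc, ENNReal.mul_div_cancel hcb0 hcbt]
      _ = _ := by
        congr 1
        rw [Complex.volume_closedBall, ← mul_assoc, ← ENNReal.ofReal_pow (hr0 j).le,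
          ← ENNReal.ofReal_mul (by positivity)]
        congr 2
        have := (hr0 j).ne'
        field_simp
  have hlim : Tendsto (fun j => ENNReal.ofReal ((48 * ρ) ^ 2) * NNReal.pi *
      (volume (Eᶜ ∩ closedBall z (r j)) / volume (closedBall z (r j)))) atTop (𝓝 0) := by
    have h := ENNReal.Tendsto.const_mul (a := ENNReal.ofReal ((48 * ρ) ^ 2) * NNReal.pi)
      (hdens.comp hrlim)
      (Or.inr (ENNReal.mul_ne_top ENNReal.ofReal_ne_top ENNReal.coe_ne_top))
    simpa only [mul_zero, Function.comp_def] using h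
  -- The disks about `G j z` move, but at an accumulation point `w` one disk of half the radius lies
  -- in infinitely many of them.
  obtain ⟨w, -, φ, hφ, hw⟩ := (isCompact_closedBall c (ρ / 2)).tendsto_subseq
    fun j => ball_subset_closedBall (hGz j)
  have hnear := (Metric.tendsto_nhds.1 hw) (η / 2) (by positivity)
  refine ⟨w, η / 2, by positivity, ⟨_, hnear.exists.choose_spec⟩, le_antisymm ?_ zero_le⟩
  refine ge_of_tendsto (hlim.comp hφ.tendsto_atTop) ?_
  filter_upwards [hnear] with j hj
  refine (measure_mono (sdiff_subset_sdiff_left (ball_subset_ball' ?_))).trans (himage (φ j))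
  rw [dist_comm]
  simp only [Function.comp_apply] at hj
  linarith

end MeroDyn

/-! ### Blow-up along branches of iterates and spreading over the plane. -/

namespace MeroDyn

open Metric

variable {f : ℂ → Sphere}

/-- Provides a finite point outside each branch domain. Using it as centre of coordinates makes the
domain planar, even if the domain contains `∞`. -/
theorem IsBranch.coe_notMem {n : ℕ} {U B : Set Sphere} (h : IsBranch f (n + 1) U B) {a b : ℂ}
    (hab : f a = f b) (hne : a ≠ b) : (a : Sphere) ∉ U ∨ (b : Sphere) ∉ U := by
  by_contra! hU
  refine hne (OnePoint.coe_injective (h.injOn hU.1 hU.2 ?_))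
  rw [Function.iterate_succ_apply, Function.iterate_succ_apply, sphMap_coe, sphMap_coe, hab]

theorem iterate_mem_of_invariant {A : Set Sphere} (hA : ∀ x ∈ A, x ∈ sphDom f → sphMap f x ∈ A)
    {n : ℕ} {x : Sphere} (hx : x ∈ A) (hd : IterDefined f n x) : (sphMap f)^[n] x ∈ A := by
  induction n with
  | zero => exact hx
  | succ n ih =>
    rw [iterDefined_succ] at hd
    rw [Function.iterate_succ_apply']
    exact hA _ (ih hd.1) hd.2

theorem volume_image_add_inv_eq_zero (Q : ℂ) {N : Set ℂ} (hN : volume N = 0) :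
    volume ((fun t : ℂ => Q + t⁻¹) '' (N ∩ {0}ᶜ)) = 0 := by
  refine addHaar_image_eq_zero_of_differentiableOn_of_addHaar_eq_zero volume ?_
    (measure_mono_null inter_subset_left hN)
  intro t ht
  have h : DifferentiableAt ℂ (fun t : ℂ => Q + t⁻¹) t :=
    (differentiableAt_inv ht.2).const_add Q
  exact (h.restrictScalars ℝ).differentiableWithinAt

theorem ae_inv_sub (Q : ℂ) {p : ℂ → Prop} (hp : ∀ᵐ t, p t) : ∀ᵐ z : ℂ, z ≠ Q → p (z - Q)⁻¹ := by
  refine measure_mono_null ?_ (volume_image_add_inv_eq_zero Q hp)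
  intro z hz
  simp only [mem_compl_iff, mem_ofPred_eq, Classical.not_imp] at hz
  exact ⟨(z - Q)⁻¹, ⟨hz.2, inv_ne_zero (sub_ne_zero.2 hz.1)⟩, by simp⟩

/-- If infinitely many univalent branches near `z` onto a fixed chart disk omit the finite point
`Q`, their domains shrink to `z` in the coordinate centred at `Q`. -/
theorem finite_setOf_ball_subset (hf : IsMeromorphic f) (hconst : ¬ IsConst f)
    (hni : ¬ Function.Injective f) {z Q : ℂ} (hz : z ∈ juliaSet f) (hzQ : z ≠ Q) {N : ℕ → ℕ}
    (hN : StrictMono N) {U : ℕ → Set Sphere} {D : Set Sphere} (hU : ∀ j, IsBranch f (N j) (U j) D)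
    {r : ℝ} (hr : 0 < r) : {j | ball (tau Q z) r ⊆ iota Q ⁻¹' U j}.Finite := by
  by_contra hinf
  have hzQ' : (z : Sphere) ≠ (Q : Sphere) := fun h => hzQ (OnePoint.coe_injective h)
  have hc : ContinuousAt (fun u : ℂ => tau Q (u : Sphere)) z :=
    (continuousAt_tau hzQ').comp (f := ((↑) : ℂ → Sphere)) OnePoint.continuous_coe.continuousAt
  obtain ⟨s, hs, hsub⟩ := Metric.eventually_nhds_iff_ball.1
    ((hc.eventually (ball_mem_nhds _ hr)).and (eventually_ne_nhds hzQ))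
  have hmem : ∀ n, ∃ j, n ≤ N j ∧ ∀ u ∈ ball z s, (u : Sphere) ∈ U j := by
    intro n
    obtain ⟨j, hj, hnj⟩ := Set.Infinite.exists_gt hinf n
    refine ⟨j, hnj.le.trans hN.le_apply, fun u hu => ?_⟩
    have h := hj (hsub u hu).1
    rwa [mem_preimage, iota_tau fun h => (hsub u hu).2 (OnePoint.coe_injective h)] at h
  refine hz (mem_fatouSet_of_injOn hf hconst hni hs (fun n w hw => ?_) fun n => ?_)
  · obtain ⟨j, hj, hUj⟩ := hmem n
    exact ((hU j).iterDefined _ (hUj w hw)).mono hj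
  · obtain ⟨j, hj, hUj⟩ := hmem n
    rintro _ ⟨u, hu, rfl⟩ _ ⟨v, hv, rfl⟩ huv
    refine (hU j).injOn (hUj u hu) (hUj v hv) ?_
    obtain ⟨k, hk⟩ := Nat.exists_eq_add_of_le hj
    rw [hk, add_comm, Function.iterate_add_apply, Function.iterate_add_apply, huv]

/-- This is `exists_ball_diff_null` for the iterates read in the coordinate at `Q` near `z` and at
`P` in the target. -/
theorem exists_ball_diff_null_of_branches (hf : IsMeromorphic f) (hconst : ¬ IsConst f)
    (hni : ¬ Function.Injective f) {A : Set Sphere}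
    (hA : ∀ x ∈ A, x ∈ sphDom f → sphMap f x ∈ A) {z Q P c : ℂ} {ρ : ℝ} (hρ : 0 < ρ)
    (hz : z ∈ juliaSet f) (hzQ : z ≠ Q) {E : Set ℂ} (hE : MeasurableSet E)
    (hEA : ∀ t ∈ E, iota Q t ∈ A)
    (hdens : Tendsto (fun r => volume (Eᶜ ∩ closedBall (tau Q z) r) /
      volume (closedBall (tau Q z) r)) (𝓝[>] 0) (𝓝 0))
    (hinf : {n | (sphMap f)^[n] (z : Sphere) ∈ chartDisk P c (ρ / 2) ∧
      ∃ U, (z : Sphere) ∈ U ∧ (Q : Sphere) ∉ U ∧ IsBranch f n U (chartDisk P c ρ)}.Infinite) :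
    ∃ w, ∃ η > 0, (∃ n, (sphMap f)^[n] (z : Sphere) ∈ chartDisk P w η) ∧
      volume (ball w η \ iota P ⁻¹' A) = 0 := by
  obtain ⟨N, hN, hNU⟩ := extraction_of_frequently_atTop (Nat.frequently_atTop_iff_infinite.2 hinf)
  choose hNz U hzU hQU hU using hNU
  have hzQ' : (z : Sphere) ≠ (Q : Sphere) := fun h => hzQ (OnePoint.coe_injective h)
  have hval : ∀ j, ∀ t ∈ iota Q ⁻¹' U j, ∃ s ∈ ball c ρ, iota P s = (sphMap f)^[N j] (iota Q t) :=
    fun j t ht => by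
      have h := mem_image_of_mem (sphMap f)^[N j] (show iota Q t ∈ U j from ht)
      rwa [(hU j).image_eq] at h
  have hne : ∀ j, ∀ t ∈ iota Q ⁻¹' U j, (sphMap f)^[N j] (iota Q t) ≠ (P : Sphere) :=
    fun j t ht => by
      obtain ⟨s, -, hs⟩ := hval j t ht
      rw [← hs]
      exact iota_ne P s
  have hzΩ : ∀ j, tau Q z ∈ iota Q ⁻¹' U j := fun j => by
    rw [mem_preimage, iota_tau hzQ']
    exact hzU j
  have him : ∀ j, (fun t => tau P ((sphMap f)^[N j] (iota Q t))) '' (iota Q ⁻¹' U j) =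
      ball c ρ := by
    intro j
    apply Subset.antisymm
    · rintro _ ⟨t, ht, rfl⟩
      obtain ⟨s, hs, hst⟩ := hval j t ht
      simp only [← hst, tau_iota]
      exact hs
    · intro s hs
      obtain ⟨x, hx, hxs⟩ : iota P s ∈ (sphMap f)^[N j] '' U j := by
        rw [(hU j).image_eq]
        exact mem_image_of_mem _ hs
      have hxQ : x ≠ (Q : Sphere) := fun h => hQU j (h ▸ hx)
      refine ⟨tau Q x, by rwa [mem_preimage, iota_tau hxQ], ?_⟩
      simp only [iota_tau hxQ, hxs, tau_iota]
  have hcen : ∀ j, tau P ((sphMap f)^[N j] (iota Q (tau Q z))) ∈ ball c (ρ / 2) := by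
    intro j
    obtain ⟨s, hs, hsz⟩ := hNz j
    simp only [iota_tau hzQ', ← hsz, tau_iota]
    exact hs
  have hEE : ∀ j, ∀ t ∈ iota Q ⁻¹' U j ∩ E,
      tau P ((sphMap f)^[N j] (iota Q t)) ∈ iota P ⁻¹' A := by
    intro j t ht
    rw [mem_preimage, iota_tau (hne j t ht.1)]
    exact iterate_mem_of_invariant hA (hEA t ht.2) ((hU j).iterDefined _ ht.1)
  obtain ⟨w, η, hη, ⟨j, hj⟩, hnull⟩ := exists_ball_diff_null hE hρ hdens
    (fun j => (hU j).isOpen.preimage (continuous_iota Q))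
    (fun j t ht => ((((meroAt_iota Q t).iterate_comp hf
      ((hU j).iterDefined _ ht)).2 P (hne j t ht)).differentiableAt).differentiableWithinAt)
    (fun j t ht s hs hts => iota_injective Q ((hU j).injOn ht hs
      (injOn_tau P (hne j t ht) (hne j s hs) hts)))
    him hzΩ hcen hEE (fun r hr => finite_setOf_ball_subset hf hconst hni hz hzQ hN hU hr)
  refine ⟨w, η, hη, ⟨N j, ?_⟩, hnull⟩
  have hne' := hne j _ (hzΩ j)
  simp only [iota_tau hzQ'] at hne' hj
  exact ⟨_, hj, iota_tau hne'⟩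

theorem exists_chartDisk_null (hf : IsMeromorphic f) (hconst : ¬ IsConst f)
    (hni : ¬ Function.Injective f) {A : Set Sphere}
    (hA : ∀ x ∈ A, x ∈ sphDom f → sphMap f x ∈ A)
    (hAm : NullMeasurableSet (finitePart A) volume)
    (hpos : volume (finitePart A ∩ radialJuliaSet f) ≠ 0) :
    ∃ z ∈ juliaSet f, (∀ n, IterDefined f n (z : Sphere)) ∧ ∃ P w, ∃ η > 0,
      (∃ n, (sphMap f)^[n] (z : Sphere) ∈ chartDisk P w η) ∧
      volume (ball w η \ iota P ⁻¹' A) = 0 := by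
  obtain ⟨a, b, -, -, hab, -, hne, -⟩ := exists_two_pairs hf hconst hni
  obtain ⟨B, hBA, hBm, hB⟩ := hAm.exists_measurable_subset_ae_eq
  -- A measurable part of `A` in the coordinate at `Q`. The point `z` is chosen as a density point
  -- for both `Q = a` and `Q = b`, since the times of `z` decide only afterwards which of the two is
  -- omitted infinitely often.
  set E : ℂ → Set ℂ := fun Q => {0}ᶜ ∩ (fun t => Q + t⁻¹) ⁻¹' B with hEdef
  have hE : ∀ Q, MeasurableSet (E Q) := fun Q =>
    (measurableSet_singleton 0).compl.inter (hBm.preimage (measurable_inv.const_add Q))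
  have hEA : ∀ Q, ∀ t ∈ E Q, iota Q t ∈ A := by
    rintro Q t ⟨ht0, htB⟩
    rw [iota_of_ne Q ht0]
    exact hBA htB
  have hdens := fun Q => ae_inv_sub Q
    (Besicovitch.ae_tendsto_measure_inter_div_of_measurableSet volume (hE Q).compl)
  have hpos' : volume (B ∩ radialJuliaSet f) ≠ 0 := by
    rwa [measure_congr (ae_eq_set_inter hB (ae_eq_refl (radialJuliaSet f)))]
  have hfreq : ∃ᵐ z, z ∈ B ∩ radialJuliaSet f := frequently_ae_mem_iff.2 hpos'
  obtain ⟨z, ⟨hzB, hzr⟩, hza, hzb, hda, hdb⟩ := (hfreq.and_eventually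
    ((volume.ae_ne a).and ((volume.ae_ne b).and ((hdens a).and (hdens b))))).exists
  obtain ⟨hzJ, β, k, m, hinf⟩ := (mem_radialJuliaSet_iff hf hconst).1 hzr
  set P := chartCenter β
  set c := TopologicalSpace.denseSeq ℂ k
  set ρ : ℝ := 1 / (m + 1)
  have hρ : 0 < ρ := by positivity
  refine ⟨z, hzJ, fun n => ?_, P, ?_⟩
  · obtain ⟨p, ⟨-, U, hzU, hU⟩, hnp⟩ := hinf.exists_gt n
    exact (hU.iterDefined _ hzU).mono hnp.le
  have hzE : ∀ Q, z ≠ Q → (z - Q)⁻¹ ∈ E Q := fun Q hQ =>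
    ⟨inv_ne_zero (sub_ne_zero.2 hQ), by simpa using hzB⟩
  have key : ∀ Q, z ≠ Q → Tendsto (fun r => volume ((E Q)ᶜ ∩ closedBall (z - Q)⁻¹ r) /
      volume (closedBall (z - Q)⁻¹ r)) (𝓝[>] 0) (𝓝 ((E Q)ᶜ.indicator 1 (z - Q)⁻¹)) →
      {n | (sphMap f)^[n] (z : Sphere) ∈ chartDisk P c (ρ / 2) ∧
      ∃ U, (z : Sphere) ∈ U ∧ (Q : Sphere) ∉ U ∧ IsBranch f n U (chartDisk P c ρ)}.Infinite →
      ∃ w, ∃ η > 0, (∃ n, (sphMap f)^[n] (z : Sphere) ∈ chartDisk P w η) ∧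
      volume (ball w η \ iota P ⁻¹' A) = 0 := fun Q hQ hd hi => by
    rw [indicator_of_notMem (by simpa using hzE Q hQ)] at hd
    exact exists_ball_diff_null_of_branches hf hconst hni hA hρ hzJ hQ (hE Q) (hEA Q) hd hi
  -- Time 0 is discarded because `coe_notMem` needs at least one application of `f`.
  have hunion := (hinf.sdiff (finite_singleton 0)).mono (t :=
    {n | (sphMap f)^[n] (z : Sphere) ∈ chartDisk P c (ρ / 2) ∧
      ∃ U, (z : Sphere) ∈ U ∧ (a : Sphere) ∉ U ∧ IsBranch f n U (chartDisk P c ρ)} ∪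
    {n | (sphMap f)^[n] (z : Sphere) ∈ chartDisk P c (ρ / 2) ∧
      ∃ U, (z : Sphere) ∈ U ∧ (b : Sphere) ∉ U ∧ IsBranch f n U (chartDisk P c ρ)}) (by
    rintro n ⟨⟨hn, U, hzU, hU⟩, hn0⟩
    obtain ⟨n, rfl⟩ := Nat.exists_eq_succ_of_ne_zero hn0
    exact (hU.coe_notMem hab hne).imp (fun h => ⟨hn, U, hzU, h, hU⟩) fun h => ⟨hn, U, hzU, h, hU⟩)
  rcases infinite_union.1 hunion with h | h
  · exact key a hza (hda hza) h
  · exact key b hzb (hdb hzb) h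

/-! ### Null sets -/

/-- Away from its poles `f` is differentiable, so it preserves null sets; the point `∞` contributes
at most one further value. -/
theorem volume_finitePart_image_sphMap (hf : IsMeromorphic f) {N : Set Sphere}
    (hN : volume (finitePart N) = 0) : volume (finitePart (sphMap f '' N)) = 0 := by
  have hd : DifferentiableOn ℝ (fun u => Function.invFun ((↑) : ℂ → Sphere) (f u))
      (finitePart N ∩ {u | f u ≠ OnePoint.infty}) := by
    intro u hu
    obtain ⟨g, hg, hgf⟩ := (hf.meroAt u).exists_analyticAt hu.2
    refine ((hg.differentiableAt.restrictScalars ℝ).congr_of_eventuallyEq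
      ?_).differentiableWithinAt
    filter_upwards [hgf] with v hv
    rw [hv, Function.leftInverse_invFun OnePoint.coe_injective]
  have h0 := addHaar_image_eq_zero_of_differentiableOn_of_addHaar_eq_zero volume hd
    (measure_mono_null inter_subset_left hN)
  have hfin : volume {z : ℂ | (z : Sphere) = sphMap f OnePoint.infty} = 0 :=
    (Set.Subsingleton.finite fun x hx y hy =>
      OnePoint.coe_injective (hx.trans (Eq.symm hy))).measure_zero _
  refine measure_mono_null ?_ (measure_union_null h0 hfin)
  rintro z ⟨x, hx, hxz⟩
  induction x using OnePoint.rec with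
  | infty => exact Or.inr hxz.symm
  | coe u =>
    rw [sphMap_coe] at hxz
    refine Or.inl ⟨u, ⟨hx, ?_⟩, ?_⟩
    · change f u ≠ _
      rw [hxz]
      exact OnePoint.coe_ne_infty z
    · simp only [hxz]
      exact Function.leftInverse_invFun OnePoint.coe_injective z

theorem volume_finitePart_image_iterate (hf : IsMeromorphic f) {N : Set Sphere}
    (hN : volume (finitePart N) = 0) (n : ℕ) :
    volume (finitePart ((sphMap f)^[n] '' N)) = 0 := by
  induction n with
  | zero => simpa using hN
  | succ n ih =>
    rw [Function.iterate_succ', image_comp]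
    exact volume_finitePart_image_sphMap hf ih

theorem volume_compl_eq_zero_of_chartDisk (hf : IsMeromorphic f) (hconst : ¬ IsConst f)
    {A : Set Sphere} (hA : ∀ x ∈ A, x ∈ sphDom f → sphMap f x ∈ A) {z : ℂ} (hz : z ∈ juliaSet f)
    (hzd : ∀ n, IterDefined f n (z : Sphere)) {P w : ℂ} {η : ℝ} {N : ℕ}
    (hN : (sphMap f)^[N] (z : Sphere) ∈ chartDisk P w η)
    (hnull : volume (ball w η \ iota P ⁻¹' A) = 0) : volume (finitePart A)ᶜ = 0 := by
  set V : Set Sphere := ⋃ n, (sphMap f)^[n] '' (chartDisk P w η ∩ {x | IterDefined f n x}) with hV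
  have hVo : IsOpen V := isOpen_iUnion fun n => isOpen_image_iterate hf hconst
    ((isOpen_chartDisk P w η).inter (isOpen_iterDefined hf n)) fun x hx => hx.2
  -- A compact set of positive area outside `V` would be omitted near `z` by all iterates of order
  -- at least `N`, and `z` would be a Fatou point.
  have hVfull : volume (finitePart V)ᶜ = 0 := by
    by_contra h
    have hm : MeasurableSet (finitePart V)ᶜ :=
      (hVo.preimage OnePoint.continuous_coe).measurableSet.compl
    obtain ⟨K, hKV, hK, hKpos⟩ := hm.exists_lt_isCompact (pos_iff_ne_zero.2 h)
    refine hz (mem_fatouSet_of_omits hf hconst hzd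
      (U := {u : ℂ | IterDefined f N (u : Sphere) ∧ (sphMap f)^[N] (u : Sphere) ∈ chartDisk P w η})
      ((isOpen_iterDefined_inter_preimage hf N (isOpen_chartDisk P w η)).preimage
        OnePoint.continuous_coe) ⟨hzd N, hN⟩ hK hKpos (N := N) ?_)
    intro n hn u hu hdu ζ hζ huζ
    refine hKV hζ ?_
    obtain ⟨k, rfl⟩ := Nat.exists_eq_add_of_le' hn
    rw [Function.iterate_add_apply] at huζ
    refine mem_iUnion.2 ⟨k, _, ⟨hu.2, fun i hi => ?_⟩, huζ⟩
    have := hdu (i + N) (by omega)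
    rwa [Function.iterate_add_apply] at this
  have hD : volume (finitePart (chartDisk P w η \ A)) = 0 := by
    refine measure_mono_null ?_ (measure_union_null (volume_image_add_inv_eq_zero P hnull)
      (measure_singleton P))
    rintro u ⟨⟨t, ht, htu⟩, huA⟩
    have ht0 : t ≠ 0 := by
      rintro rfl
      rw [iota_zero] at htu
      exact OnePoint.infty_ne_coe u htu
    refine Or.inl ⟨t, ⟨⟨ht, fun h => huA ?_⟩, ht0⟩, ?_⟩
    · rw [← htu]
      exact h
    · rw [iota_of_ne P ht0] at htu
      exact OnePoint.coe_injective htu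
  refine measure_mono_null ?_ (measure_union_null hVfull (measure_iUnion_null fun n =>
    volume_finitePart_image_iterate hf hD n))
  intro u hu
  by_cases huV : u ∈ finitePart V
  · obtain ⟨n, x, ⟨hxD, hxd⟩, hxu⟩ := mem_iUnion.1 huV
    refine Or.inr (mem_iUnion.2 ⟨n, x, ⟨hxD, fun hxA => hu ?_⟩, hxu⟩)
    change (u : Sphere) ∈ A
    rw [← hxu]
    exact iterate_mem_of_invariant hA hxA hxd
  · exact Or.inl huV

/-- A forward invariant set which charges the radial Julia set has full measure. -/
theorem IsForwardInvariant.volume_compl_eq_zero (hf : IsMeromorphic f) (hconst : ¬ IsConst f)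
    (hni : ¬ Function.Injective f) {A : Set Sphere} (hA : IsForwardInvariant f A)
    (hAm : NullMeasurableSet (finitePart A) volume)
    (hpos : volume (finitePart A ∩ radialJuliaSet f) ≠ 0) : volume (finitePart A)ᶜ = 0 := by
  -- If `∞ ∈ A`, forward invariance says nothing about the value at `∞`. Adjoining the countable
  -- forward orbit of `∞` makes the set invariant under the extended map without changing its
  -- measure.
  set O : Set Sphere := {x | ∃ n, IterDefined f n OnePoint.infty ∧
    (sphMap f)^[n] OnePoint.infty = x} with hO
  have hOc : (finitePart O).Countable := by
    refine Countable.preimage_of_injOn (s := O) ?_ OnePoint.coe_injective.injOn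
    refine (countable_range fun n => (sphMap f)^[n] OnePoint.infty).mono ?_
    rintro x ⟨n, -, hx⟩
    exact ⟨n, hx⟩
  have hO0 : volume (finitePart O) = 0 := hOc.measure_zero _
  have hinv : ∀ x ∈ A ∪ O, x ∈ sphDom f → sphMap f x ∈ A ∪ O := by
    rintro x (hx | ⟨n, hn, rfl⟩) hxd
    · induction x using OnePoint.rec with
      | infty => exact Or.inr ⟨1, by simpa [iterDefined_succ, IterDefined] using hxd, rfl⟩
      | coe z => exact Or.inl (hA z hx)
    · exact Or.inr ⟨n + 1, iterDefined_succ.2 ⟨hn, hxd⟩, Function.iterate_succ_apply' _ _ _⟩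
  have hm : NullMeasurableSet (finitePart (A ∪ O)) volume :=
    hAm.union (NullMeasurableSet.of_null hO0)
  have hpos' : volume (finitePart (A ∪ O) ∩ radialJuliaSet f) ≠ 0 := fun h =>
    hpos (measure_mono_null (inter_subset_inter_left _ fun z hz => Or.inl hz) h)
  obtain ⟨z, hz, hzd, P, w, η, -, ⟨n, hn⟩, hnull⟩ :=
    exists_chartDisk_null hf hconst hni hinv hm hpos'
  have hfull := volume_compl_eq_zero_of_chartDisk hf hconst hinv hz hzd hn hnull
  refine measure_mono_null ?_ (measure_union_null hfull hO0)
  intro u hu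
  by_cases huO : u ∈ finitePart O
  · exact Or.inr huO
  · exact Or.inl fun h => h.elim hu huO

theorem isForwardInvariant_avoiding (B : Set Sphere) :
    IsForwardInvariant f {x | Disjoint (orbit f x) B} := by
  intro z hz
  refine Disjoint.mono_left ?_ hz
  rintro x ⟨n, hn⟩
  obtain ⟨hd, hx⟩ := iter_eq_some_iff.1 hn
  exact ⟨n + 1, iter_eq_some_iff.2 ⟨iterDefined_succ'.2 ⟨coe_mem_sphDom z, hd⟩, hx⟩⟩

theorem measurableSet_avoiding (hf : IsMeromorphic f) {B : Set Sphere} (hB : IsOpen B) :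
    MeasurableSet (finitePart {x | Disjoint (orbit f x) B}) := by
  have : finitePart {x | Disjoint (orbit f x) B} =
      (⋃ n, ((↑) : ℂ → Sphere) ⁻¹' {x | IterDefined f n x ∧ (sphMap f)^[n] x ∈ B})ᶜ := by
    ext z
    simp only [mem_compl_iff, mem_iUnion, mem_preimage, mem_ofPred_eq, not_exists]
    change Disjoint _ _ ↔ _
    rw [disjoint_left]
    constructor
    · exact fun h n hn => h ⟨n, iter_eq_some_iff.2 ⟨hn.1, rfl⟩⟩ hn.2
    · rintro h x ⟨n, hn⟩ hxB
      obtain ⟨hd, rfl⟩ := iter_eq_some_iff.1 hn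
      exact h n ⟨hd, hxB⟩
  rw [this]
  exact (MeasurableSet.iUnion fun n => ((isOpen_iterDefined_inter_preimage hf n hB).preimage
    OnePoint.continuous_coe).measurableSet).compl

end MeroDyn

/-! ### The main theorem. -/

theorem mainTheorem11 (f : ℂ → MeroDyn.Sphere) (hf : MeroDyn.IsMeromorphic f)
    (hconst : ¬ MeroDyn.IsConst f) (hlin : ¬ MeroDyn.IsLinear f)
    (hpos : 0 < volume (MeroDyn.radialJuliaSet f)) :
    volume (MeroDyn.radialJuliaSet f)ᶜ = 0 ∧
    MeroDyn.juliaSet f = Set.univ ∧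
    (∀ᵐ z : ℂ, Dense (MeroDyn.orbit f (z : MeroDyn.Sphere))) ∧
    (∀ A : Set MeroDyn.Sphere, NullMeasurableSet (MeroDyn.finitePart A) volume →
      MeroDyn.IsForwardInvariant f A → MeroDyn.HasZeroOrFullMeasure A) ∧
    MeroDyn.IsErgodic f := by
  open MeroDyn in
  have hJ : radialJuliaSet f ⊆ juliaSet f := fun z hz => hz.1
  have hni : ¬ Function.Injective f := fun hi => by
    obtain ⟨p, hp⟩ := juliaSet_subset_singleton_of_injective hf hconst hlin hi
    exact hpos.ne' (measure_mono_null (hJ.trans hp) (measure_singleton p))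
  have hfull : volume (radialJuliaSet f)ᶜ = 0 := by
    have hfin : finitePart ((↑) '' radialJuliaSet f ∪ {OnePoint.infty}) = radialJuliaSet f := by
      ext z
      change (z : Sphere) ∈ (↑) '' radialJuliaSet f ∪ {OnePoint.infty} ↔ _
      simp
    -- The point `∞` is adjoined to absorb the poles lying in the radial Julia set.
    have hinv : IsForwardInvariant f ((↑) '' radialJuliaSet f ∪ {OnePoint.infty}) := by
      rintro z (⟨u, hu, huz⟩ | hz)
      · obtain rfl := OnePoint.coe_injective huz
        by_cases h : f u = OnePoint.infty
        · exact Or.inr h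
        · obtain ⟨w, hw⟩ := OnePoint.ne_infty_iff_exists.1 h
          exact Or.inl ⟨w, mem_radialJuliaSet_of_apply_eq hf hconst hw.symm hu, hw⟩
      · exact absurd hz (OnePoint.coe_ne_infty z)
    have h := hinv.volume_compl_eq_zero hf hconst hni
    rw [hfin, inter_self] at h
    exact h (measurableSet_radialJuliaSet hf hconst).nullMeasurableSet hpos.ne'
  have h01 : ∀ A : Set Sphere, NullMeasurableSet (finitePart A) volume →
      IsForwardInvariant f A → HasZeroOrFullMeasure A := by
    intro A hAm hA
    by_cases h : volume (finitePart A) = 0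
    · exact Or.inl h
    · refine Or.inr (hA.volume_compl_eq_zero hf hconst hni hAm ?_)
      rwa [measure_inter_conull hfull]
  refine ⟨hfull, ?_, ?_, h01, fun A hAm hA => h01 A hAm fun z hz => (hA z).2 hz⟩
  · have h : volume (juliaSet f)ᶜ = 0 := measure_mono_null (compl_subset_compl.2 hJ) hfull
    rwa [isClosed_juliaSet.isOpen_compl.measure_eq_zero_iff volume, compl_empty_iff] at h
  · have hB : ∀ B ∈ TopologicalSpace.countableBasis Sphere,
        ∀ᵐ z : ℂ, B.Nonempty → ¬ Disjoint (orbit f (z : Sphere)) B := by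
      intro B hB
      have hBo := TopologicalSpace.isOpen_of_mem_countableBasis hB
      rcases h01 _ (measurableSet_avoiding hf hBo).nullMeasurableSet
        (isForwardInvariant_avoiding B) with h | h
      · filter_upwards [measure_eq_zero_iff_ae_notMem.1 h] with z hz _ using hz
      · refine Eventually.of_forall fun z hBn => ?_
        obtain ⟨_, huB, u, rfl⟩ := (OnePoint.denseRange_coe (X := ℂ)).inter_open_nonempty B hBo hBn
        have hpre : volume (((↑) : ℂ → Sphere) ⁻¹' B) = 0 := by
          refine measure_mono_null (fun v hv => ?_) h
          exact fun hd => disjoint_left.1 hd ⟨0, rfl⟩ hv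
        rw [(hBo.preimage OnePoint.continuous_coe).measure_eq_zero_iff volume] at hpre
        exact absurd (show u ∈ ((↑) : ℂ → Sphere) ⁻¹' B from huB) (by simp [hpre])
    filter_upwards [(ae_ball_iff (TopologicalSpace.countable_countableBasis Sphere)).2 hB] with z hz
    rw [(TopologicalSpace.isBasis_countableBasis Sphere).dense_iff]
    intro B hBm hBn
    rw [inter_comm]
    exact not_disjoint_iff_nonempty_inter.1 (hz B hBm hBn)
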